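/- **Setting.** Let $T$ be a locally finite tree without vertices of valence $2$, which is uniform (some discrete subgroup of $\mathrm{Aut}(T)$ acting without inversion has finite quotient graph). Let $\Gamma$ be a discrete, non-elementary group of automorphisms of $T$ without inversion such that $T$ is the minimal $\Gamma$-invariant subtree and $\Gamma$ is geometrically finite: the quotient graph of groups with underlying graph $X=\Gamma\backslash T$ is a finite graph of finite groups $X_0$ to which finitely many cuspidal rays are glued at their origins. The $i$-th ray ($1\le i\le r$) has consecutive edges $a_{i,0},a_{i,1},\dots$ oriented towards its end, and the group of $a_{i,n}$ equals the group of its origin for $n\ge 1$. Assume that the vertex groups of $X_0$ are trivial. Write $o(e)$, $t(e)$, $\overline e$ for the origin, terminus and opposite of an edge $e$. Choose lifts $\tilde\beta$ to $T$ of the oriented edges $\beta$ of $X$, with $\tilde{\overline\beta}=\overline{\tilde\beta}$ and such that the $\tilde a_{i,n}$, $n\ge 0$, are the consecutive edges of a ray of $T$. Let $\Gamma_{i,n}$ be the stabiliser of the origin of $\tilde a_{i,n}$. Let $\mathcal GT$ be the space of geodesics $\ell:\mathbb Z\to VT$, let $\ell_k$ be the edge from $\ell(k)$ to $\ell(k+1)$,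 and let $\varphi$ be the map induced on $\Gamma\backslash\mathcal GT$ by $\ell\mapsto\ell(\cdot+1)$. Let $\delta$ be the critical exponent of $\Gamma$ and $(\mu_x)_{x\in VT}$ a Patterson–Sullivan measure of dimension $\delta$: finite measures on $\partial T$ of full support with $\gamma_*\mu_x=\mu_{\gamma x}$ for $\gamma\in\Gamma$ and $\frac{d\mu_x}{d\mu_y}(\xi)=e^{-\delta\beta_\xi(x,y)}$, where $\beta_\xi$ is the Busemann function. Let $m_{BM}$ be the measure induced on $\Gamma\backslash\mathcal GT$ by $\frac{d\mu_{x_0}(\ell_-)\,d\mu_{x_0}(\ell_+)\,dt}{d_{x_0}(\ell_-,\ell_+)^{2\delta}}$ (in Hopf coordinates based at $x_0$; $dt$ is counting measure and $d_{x_0}(\xi,\eta)=e^{-u}$ with $u$ the length of $[x_0,\xi)\cap[x_0,\eta)$), divided by its total mass. **Coding.** Let $\mathcal A$ consist of the oriented edges of $X$, the letters $(g,+)$ with $g\in(\Gamma_{i,n+1}-\Gamma_{i,n})/\Gamma_{i,n}$, and the letters $(g,-)$ with $g\in\Gamma_{i,n}\backslash(\Gamma_{i,n+1}-\Gamma_{i,n})$,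 for $1\le i\le r$ and $n\ge0$. For $\beta\in\mathcal A$ let $E_\beta$ be the image in $\Gamma\backslash\mathcal GT$ of the set of geodesics $\ell$ with * $\ell_0=\tilde\beta$, if $\beta$ is an edge of $X_0$; * $\ell_0=\tilde a_{i,n}$, $\ell_1=\tilde a_{i,n+1}$, $\ell_{-n}=\tilde a_{i,0}$, if $\beta=a_{i,n}$; * $\ell_0=\overline{\tilde a_{i,n}}$, $\ell_{-1}=\overline{\tilde a_{i,n+1}}$, $\ell_n=\overline{\tilde a_{i,0}}$, if $\beta=\overline{a_{i,n}}$; * $\ell_0=\tilde a_{i,n}$, $\ell_1=g\,\overline{\tilde a_{i,n}}$, $\ell_{-n}=\tilde a_{i,0}$, if $\beta=(g,+)$; * $\ell_0=\overline{\tilde a_{i,n}}$, $\ell_{-1}=g^{-1}\tilde a_{i,n}$, $\ell_n=\overline{\tilde a_{i,0}}$, if $\beta=(g,-)$. Let $X_A\subset\mathcal A^{\mathbb Z}$ be the subshift whose allowed transitions $\alpha\to\beta$ are exactly: 1. $\alpha,\beta$ edges with $t(\alpha)=o(\beta)$, $\beta\ne\overline\alpha$; 2. $\alpha$ an edge, $\beta=(g,+)$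 at $(i,n)$, with $t(\alpha)=o(a_{i,n})$, $\alpha\ne\overline{a_{i,n}}$; 3. $\alpha=(g\Gamma_{i,n},+)$, $\beta=(\Gamma_{i,n}g,-)$ for some $g\in\Gamma_{i,n+1}-\Gamma_{i,n}$; 4. $\alpha=(g,-)$ at $(i,n)$, $\beta$ an edge with $o(\beta)=o(a_{i,n})$, $\beta\neq a_{i,n}$; 5. $\alpha=(g,-)$ at $(i,n)$, $\beta=(h,+)$ at $(j,m)$, with $o(a_{j,m})=o(a_{i,n})$, $a_{j,m}\ne a_{i,n}$. Put $\nu_\beta=m_{BM}(E_\beta)$ and $\pi_{\alpha,\beta}=m_{BM}(\varphi^{-1}(E_\beta)\cap E_\alpha)/\nu_\alpha$. **Proposition.** The measure $m_{BM}$ is a probability measure, $\mathcal A$ is countable, $\Pi=(\pi_{\alpha,\beta})$ is a stochastic matrix and $\nu$ is a stationary probability vector for it. There is a unique map $\Theta:\Gamma\backslash\mathcal GT\to\mathcal A^{\mathbb Z}$ with $\varphi^i(\ell)\in E_{\Theta(\ell)_i}$ for all $\ell$ and all $i\in\mathbb Z$; moreover $\varphi^i(\ell)\in E_\beta$ only for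 $\beta=\Theta(\ell)_i$, and $\Theta$ is measurable with values in $X_A$. There is a unique shift-invariant probability measure $\mu_\Pi$ on $\mathcal A^{\mathbb Z}$ with $$\mu_\Pi[x_0=\alpha_0,\dots,x_k=\alpha_k]=\nu_{\alpha_0}\prod_{j<k}\pi_{\alpha_j,\alpha_{j+1}}$$ for all $k\ge0$ and $\alpha_0,\dots,\alpha_k\in\mathcal A$. Its support is $X_A$, and $$\Theta_*m_{BM}=\mu_\Pi.$$ If there are no cuspidal rays, $\Theta$ is a conjugacy modulo null sets from $(\Gamma\backslash\mathcal GT,m_{BM},\varphi)$ to the Markov shift $(\mathcal A^{\mathbb Z},\mu_\Pi,\sigma)$. In general $(\Gamma\backslash\mathcal GT,m_{BM},\varphi)$ is measurably conjugate to a countable-state Markov shift, by a coding map $F$ refining $\Theta$: for some map $q$ between the alphabets, $\Theta(\ell)_i=q(F(\ell)_i)$ for all $\ell$ and $i$. -/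

import Mathlib

open MeasureTheory Filter Topology
open scoped ENNReal NNReal

noncomputable section

namespace TreeCoding

/-! ## Trees, geodesics, ends -/

section Tree

variable {V : Type*} (T : SimpleGraph V)

/-- Bi-infinite geodesics of `T` (restricted to the vertices `ℤ` of the line): injective maps
sending consecutive integers to adjacent vertices. -/
structure Geodesic where
  toFun : ℤ → V
  adj : ∀ n, T.Adj (toFun n) (toFun (n + 1))
  inj : Function.Injective toFun

/-- Geodesic rays of `T`. -/
structure Ray where
  toFun : ℕ → V
  adj : ∀ n, T.Adj (toFun n) (toFun (n + 1))
  inj : Function.Injective toFun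

/-- Two rays are asymptotic if they coincide eventually, up to a shift of the parameter. -/
instance Ray.setoid : Setoid (Ray T) where
  r a b := ∃ m n : ℕ, ∀ k, a.toFun (m + k) = b.toFun (n + k)
  iseqv :=
    { refl := fun _ => ⟨0, 0, fun _ => rfl⟩
      symm := fun ⟨m, n, h⟩ => ⟨n, m, fun k => (h k).symm⟩
      trans := by
        rintro a b c ⟨m, n, h⟩ ⟨p, q, h'⟩
        refine ⟨m + p, q + n, fun k => ?_⟩
        have h1 := h (p + k)
        have h2 := h' (n + k)
        rw [show m + p + k = m + (p + k) by omega, show q + n + k = q + (n + k) by omega, h1, ← h2]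
        congr 1
        omega }

/-- The space of ends `∂T` of the tree `T`, as asymptoty classes of geodesic rays. -/
def Ends : Type _ := Quotient (Ray.setoid T)

variable {T}

/-- The end of a ray. -/
def Ray.toEnd (r : Ray T) : Ends T := Quotient.mk _ r

/-- `OnRay x ξ y`: the vertex `y` lies on the geodesic ray `[x, ξ)`. -/
def OnRay (x : V) (ξ : Ends T) (y : V) : Prop :=
  ∃ r : Ray T, r.toFun 0 = x ∧ r.toEnd = ξ ∧ ∃ n, r.toFun n = y

/-- The shadow of `y` seen from `x`: the ends `ξ` such that `[x, ξ)` passes through `y`. -/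
def shadow (x y : V) : Set (Ends T) := {ξ | OnRay x ξ y}

/-- The usual topology of the space of ends, generated by the shadows. -/
instance : TopologicalSpace (Ends T) :=
  TopologicalSpace.generateFrom {S | ∃ x y : V, S = shadow x y}

instance : MeasurableSpace (Ends T) := borel _

instance : BorelSpace (Ends T) := ⟨rfl⟩

/-- The Busemann function `β_ξ(x, y) = d(x, z) - d(z, y)` for `z` close enough to `ξ`; the
sequence below is eventually constant. -/
def busemann (ξ : Ends T) (x y : V) : ℝ :=
  limUnder atTop fun n : ℕ =>
    ((T.dist x ((Quotient.out ξ : Ray T).toFun n) : ℝ) -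
      (T.dist ((Quotient.out ξ : Ray T).toFun n) y : ℝ))

/-- The length of the intersection of the rays `[x, ξ)` and `[x, η)`, for `ξ ≠ η`. -/
def commonLength (x : V) (ξ η : Ends T) : ℕ :=
  sSup {n | ∃ y, OnRay x ξ y ∧ OnRay x η y ∧ T.dist x y = n}

open Classical in
/-- The visual distance `d_x(ξ, η) = e^{-u}`, `u` the length of `[x, ξ) ∩ [x, η)`. -/
def visualDist (x : V) (ξ η : Ends T) : ℝ :=
  if ξ = η then 0 else Real.exp (-(commonLength x ξ η : ℝ))

namespace Geodesic

@[ext] theorem ext' {ℓ ℓ' : Geodesic T} (h : ∀ n, ℓ.toFun n = ℓ'.toFun n) : ℓ = ℓ' := by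
  cases ℓ
  cases ℓ'
  congr
  exact funext h

/-- The `i`-th (oriented) edge of a geodesic, from `ℓ(i)` to `ℓ(i+1)`. -/
def edge (ℓ : Geodesic T) (i : ℤ) : T.Dart := ⟨(ℓ.toFun i, ℓ.toFun (i + 1)), ℓ.adj i⟩

/-- Translation at the source, `(φ̃^k ℓ)(t) = ℓ(t + k)`; the geodesic transformation is the
case `k = 1`. -/
def shift (k : ℤ) (ℓ : Geodesic T) : Geodesic T where
  toFun n := ℓ.toFun (n + k)
  adj n := by
    have := ℓ.adj (n + k)
    rwa [show n + k + 1 = n + 1 + k by ring] at this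
  inj := fun a b h => by simpa using ℓ.inj h

/-- The terminal end `ℓ_+`. -/
def endPlus (ℓ : Geodesic T) : Ends T :=
  Ray.toEnd ⟨fun n => ℓ.toFun n, fun n => by simpa using ℓ.adj n,
    fun a b h => by simpa using ℓ.inj h⟩

/-- The initial end `ℓ_-`. -/
def endMinus (ℓ : Geodesic T) : Ends T :=
  Ray.toEnd ⟨fun n => ℓ.toFun (-n), fun n => by
      have := (ℓ.adj (-((n : ℤ) + 1))).symm
      simpa using this,
    fun a b h => by simpa using ℓ.inj h⟩

/-- The parameter of the point of `ℓ` closest to `x`, that is its algebraic distance on `ℓ`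
from `ℓ(0)`. -/
def footTime (x : V) (ℓ : Geodesic T) : ℤ :=
  Function.argmin (fun s : ℤ => T.dist x (ℓ.toFun s))

/-- The Hopf parametrisation `ℓ ↦ (ℓ_-, ℓ_+, t)` with respect to the base point `x`. -/
def hopf (x : V) (ℓ : Geodesic T) : (Ends T × Ends T) × ℤ :=
  ((ℓ.endMinus, ℓ.endPlus), ℓ.footTime x)

end Geodesic

/-- The compact-open topology, i.e. pointwise convergence of the sequences of vertices in the
discrete set `V`. -/
instance : TopologicalSpace (Geodesic T) :=
  TopologicalSpace.induced Geodesic.toFun (@Pi.topologicalSpace ℤ (fun _ => V) fun _ => ⊥)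

instance : MeasurableSpace (Geodesic T) := borel _

instance : BorelSpace (Geodesic T) := ⟨rfl⟩

/-! ### Actions of automorphisms -/

instance : MulAction (T ≃g T) T.Dart where
  smul γ d := ⟨(γ d.fst, γ d.snd), γ.map_rel_iff.2 d.adj⟩
  one_smul _ := rfl
  mul_smul _ _ _ := rfl

/-- The image of a ray by an automorphism. -/
def Ray.map (γ : T ≃g T) (r : Ray T) : Ray T :=
  ⟨fun n => γ (r.toFun n), fun n => γ.map_rel_iff.2 (r.adj n), γ.injective.comp r.inj⟩

instance : MulAction (T ≃g T) (Ends T) where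
  smul γ := Quotient.map (Ray.map γ) (by
    rintro a b ⟨m, n, h⟩
    exact ⟨m, n, fun k => congrArg γ (h k)⟩)
  one_smul ξ := by
    induction ξ using Quotient.inductionOn
    rfl
  mul_smul _ _ ξ := by
    induction ξ using Quotient.inductionOn
    rfl

instance : MulAction (T ≃g T) (Geodesic T) where
  smul γ ℓ := ⟨fun n => γ (ℓ.toFun n), fun n => γ.map_rel_iff.2 (ℓ.adj n),
    γ.injective.comp ℓ.inj⟩
  one_smul _ := rfl
  mul_smul _ _ _ := rfl

end Tree

/-! ## Discrete groups of automorphisms -/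

section Groups

variable {V : Type*} {T : SimpleGraph V}

/-- `Γ` acts without inversion of edges. -/
def NoInversion (Γ : Subgroup (T ≃g T)) : Prop :=
  ∀ (γ : Γ) (d : T.Dart), γ • d ≠ d.symm

/-- For a locally finite tree, `Γ` is discrete in `Aut T` if and only if its vertex stabilisers
are finite. -/
def IsDiscreteGroup (Γ : Subgroup (T ≃g T)) : Prop :=
  ∀ v : V, Finite (MulAction.stabilizer Γ v)

/-- `Γ` preserves neither a point nor a pair of points of `T ∪ ∂T`. For a group acting without
inversion, fixing a point (or preserving a pair of points) of the geometric realisation forces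
fixing a vertex, so that only vertices and ends are considered. -/
def IsNonElementary (Γ : Subgroup (T ≃g T)) : Prop :=
  ∀ S : Set (V ⊕ Ends T), S.Nonempty → S.encard ≤ 2 →
    ¬ ∀ γ : Γ, Sum.map (fun v => γ • v) (fun ξ => γ • ξ) '' S = S

/-- `T` has no proper non-empty `Γ`-invariant subtree, i.e. `T` is the minimal subtree. -/
def IsMinimal (Γ : Subgroup (T ≃g T)) : Prop :=
  ∀ S : Set V, (T.induce S).Connected → (∀ γ : Γ, ∀ v ∈ S, γ • v ∈ S) → S = Set.univ

variable (T) in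
/-- `T` is uniform: it has a discrete group of automorphisms (without inversion) with finite
quotient graph. -/
def IsUniform : Prop :=
  ∃ Γ : Subgroup (T ≃g T), NoInversion Γ ∧ IsDiscreteGroup Γ ∧
    Finite (MulAction.orbitRel.Quotient Γ V)

/-- The critical exponent in `[0, ∞]` of the Poincaré series `∑_γ e^{-s d(x, γ x)}`. -/
def criticalExponent (Γ : Subgroup (T ≃g T)) (x : V) : ℝ≥0∞ :=
  sInf ((fun s : ℝ≥0 => (s : ℝ≥0∞)) ''
    {s | Summable fun γ : Γ => Real.exp (-(s : ℝ) * (T.dist x (γ • x) : ℝ))})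

/-- Patterson–Sullivan measures of dimension `δ` for `Γ`, when `T` is the minimal subtree
(so that the supports are the whole of `∂T`). -/
structure IsPattersonSullivan (Γ : Subgroup (T ≃g T)) (δ : ℝ) (μ : V → Measure (Ends T)) :
    Prop where
  finite : ∀ x, IsFiniteMeasure (μ x)
  support_eq : ∀ x, (μ x).support = Set.univ
  equivariant : ∀ (γ : Γ) (x : V), (μ x).map (fun ξ => γ • ξ) = μ (γ • x)
  conformal : ∀ x y : V,
    μ x = (μ y).withDensity fun ξ => ENNReal.ofReal (Real.exp (-δ * busemann ξ x y))

/-- The Bowen–Margulis measure on the space of geodesics: in the Hopf parametrisation,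
`dμ_x(ℓ_-) dμ_x(ℓ_+) dt / d_x(ℓ_-, ℓ_+)^{2δ}`. (The value of the density on the diagonal is
irrelevant, the image of the parametrisation being the complement of the diagonal.) -/
def bowenMargulisUp (δ : ℝ) (μ : V → Measure (Ends T)) (x : V) : Measure (Geodesic T) :=
  Measure.comap (Geodesic.hopf x)
    ((((μ x).prod (μ x)).withDensity fun p =>
      ENNReal.ofReal (visualDist x p.1 p.2 ^ (-(2 * δ)))).prod Measure.count)

/-- The quotient `Γ\𝒢T`. -/
abbrev GeodQuot (Γ : Subgroup (T ≃g T)) := MulAction.orbitRel.Quotient Γ (Geodesic T)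

/-- The projection `𝒢T → Γ\𝒢T`. -/
def GeodQuot.proj (Γ : Subgroup (T ≃g T)) (ℓ : Geodesic T) : GeodQuot Γ := Quotient.mk _ ℓ

/-- The `k`-th power `φ^k` of the geodesic transformation of `Γ\𝒢T`. -/
def GeodQuot.flow (Γ : Subgroup (T ≃g T)) (k : ℤ) : GeodQuot Γ → GeodQuot Γ :=
  Quotient.map (Geodesic.shift k) (by
    rintro a b ⟨γ, h⟩
    exact ⟨γ, by rw [← h]; rfl⟩)

open Classical in
/-- The measure on `Γ\X` induced by an invariant measure `m` on `X`, for an (essentially) free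
action: the image of the restriction of `m` to any fundamental domain (it does not depend on
the choice of the domain). -/
def inducedMeasure (G : Type*) {X : Type*} [Group G] [MulAction G X] [MeasurableSpace X]
    (m : Measure X) : Measure (MulAction.orbitRel.Quotient G X) :=
  if h : ∃ F : Set X, IsFundamentalDomain G F m then
    (m.restrict h.choose).map (fun x => Quotient.mk _ x)
  else 0

/-- The Bowen–Margulis measure on `Γ\𝒢T`, normalised by its total mass. -/
def bowenMargulis (Γ : Subgroup (T ≃g T)) (δ : ℝ) (μ : V → Measure (Ends T)) (x : V) :
    Measure (GeodQuot Γ) :=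
  (inducedMeasure Γ (bowenMargulisUp δ μ x) Set.univ)⁻¹ •
    inducedMeasure Γ (bowenMargulisUp δ μ x)

/-! ## The quotient graph and its cuspidal rays -/

/-- Vertices of the quotient graph `X = Γ\T`. -/
abbrev QVert (Γ : Subgroup (T ≃g T)) := MulAction.orbitRel.Quotient Γ V

/-- Oriented edges of the quotient graph `X = Γ\T`. -/
abbrev QEdge (Γ : Subgroup (T ≃g T)) := MulAction.orbitRel.Quotient Γ T.Dart

variable {Γ : Subgroup (T ≃g T)}

/-- Origin of an edge of `X`. -/
def QEdge.o : QEdge Γ → QVert Γ :=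
  Quotient.map (fun d : T.Dart => d.fst) (by
    rintro a b ⟨γ, h⟩
    exact ⟨γ, by rw [← h]; rfl⟩)

/-- Opposite edge. -/
def QEdge.rev : QEdge Γ → QEdge Γ :=
  Quotient.map (fun d : T.Dart => d.symm) (by
    rintro a b ⟨γ, h⟩
    exact ⟨γ, by rw [← h]; rfl⟩)

/-- Terminus of an edge of `X`. -/
def QEdge.t (e : QEdge Γ) : QVert Γ := QEdge.o (QEdge.rev e)

variable (Γ) in
/-- A presentation of the quotient graph of groups as a finite graph `X₀` to which `r` cuspidal
rays are glued at their origins. The `i`-th ray has consecutive edges `a i 0, a i 1, …`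
oriented towards its end. -/
structure CuspDecomposition where
  r : ℕ
  a : Fin r → ℕ → QEdge Γ
  consecutive : ∀ i n, (a i n).t = (a i (n + 1)).o
  /-- the vertices of a ray are distinct, and distinct rays meet at most at their origins -/
  embedded : ∀ i j n m, (a i (n + 1)).o = (a j m).o → i = j ∧ n + 1 = m
  /-- the rays are glued only at their origins -/
  glued : ∀ i n (e : QEdge Γ), e.o = (a i (n + 1)).o → e = a i (n + 1) ∨ e = (a i n).rev
  /-- for `n ≥ 1` the group of the edge `a i n` is the whole group of its origin -/
  cuspidal : ∀ i n (d : T.Dart), (Quotient.mk _ d : QEdge Γ) = a i (n + 1) →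
    ∀ γ : Γ, γ • d.fst = d.fst → γ • d.snd = d.snd
  /-- `X₀` has finitely many vertices -/
  finite_vert : {v : QVert Γ | ∀ i n, v ≠ (a i (n + 1)).o}.Finite
  /-- `X₀` has finitely many edges -/
  finite_edge : {e : QEdge Γ | ∀ i n, e ≠ a i n ∧ e ≠ (a i n).rev}.Finite

namespace CuspDecomposition

/-- Vertices of `X₀`, the complement of the open cuspidal rays. -/
def coreVert (D : CuspDecomposition Γ) : Set (QVert Γ) := {v | ∀ i n, v ≠ (D.a i (n + 1)).o}

/-- Edges of `X₀`. -/
def coreEdge (D : CuspDecomposition Γ) : Set (QEdge Γ) :=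
  {e | ∀ i n, e ≠ D.a i n ∧ e ≠ (D.a i n).rev}

/-- A choice of lifts to `T` of the edges of `X`, compatible with the reversal of edges, the lift
of each cuspidal ray being a ray of `T`. -/
structure Lifts (D : CuspDecomposition Γ) where
  lift : QEdge Γ → T.Dart
  lift_mk : ∀ e, (Quotient.mk _ (lift e) : QEdge Γ) = e
  lift_rev : ∀ e, lift e.rev = (lift e).symm
  lift_consecutive : ∀ i n, (lift (D.a i n)).snd = (lift (D.a i (n + 1))).fst

end CuspDecomposition

/-! ## The alphabet, the partition and the transition matrix -/

namespace CuspDecomposition.Lifts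

variable {D : CuspDecomposition Γ} (s : D.Lifts)

/-- The lift `ã_{i,n}`. -/
def aLift (i : Fin D.r) (n : ℕ) : T.Dart := s.lift (D.a i n)

/-- The group `Γ_{i,n}`, stabiliser of the origin of `ã_{i,n}`. -/
def grp (i : Fin D.r) (n : ℕ) : Subgroup Γ := MulAction.stabilizer Γ (s.aLift i n).fst

/-- The elements of `Γ_{i,n+1} - Γ_{i,n}`. -/
def turn (i : Fin D.r) (n : ℕ) : Set Γ := {g | g ∈ s.grp i (n + 1) ∧ g ∉ s.grp i n}

/-- The set `(Γ_{i,n+1} - Γ_{i,n})/Γ_{i,n}`. -/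
def UpTurn (i : Fin D.r) (n : ℕ) : Type _ :=
  {c : Γ ⧸ s.grp i n // ∃ g ∈ s.turn i n, (QuotientGroup.mk g : Γ ⧸ s.grp i n) = c}

/-- The set `Γ_{i,n}\(Γ_{i,n+1} - Γ_{i,n})`. -/
def DownTurn (i : Fin D.r) (n : ℕ) : Type _ :=
  {c : Quotient (QuotientGroup.rightRel (s.grp i n)) //
    ∃ g ∈ s.turn i n, Quotient.mk (QuotientGroup.rightRel (s.grp i n)) g = c}

/-- `g` represents the left coset `c`. -/
def UpTurn.Rep {s : D.Lifts} {i : Fin D.r} {n : ℕ} (c : s.UpTurn i n) (g : Γ) : Prop :=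
  (QuotientGroup.mk g : Γ ⧸ s.grp i n) = c.1

/-- `g` represents the right coset `c`. -/
def DownTurn.Rep {s : D.Lifts} {i : Fin D.r} {n : ℕ} (c : s.DownTurn i n) (g : Γ) : Prop :=
  Quotient.mk (QuotientGroup.rightRel (s.grp i n)) g = c.1

/-- The alphabet `𝒜`: the edges of `X`, the letters `(g, +)` with
`g ∈ (Γ_{i,n+1} - Γ_{i,n})/Γ_{i,n}` and the letters `(g, -)` with
`g ∈ Γ_{i,n}\(Γ_{i,n+1} - Γ_{i,n})`. -/
inductive Letter : Type _
  | edge (e : QEdge Γ)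
  | up (i : Fin D.r) (n : ℕ) (c : s.UpTurn i n)
  | down (i : Fin D.r) (n : ℕ) (c : s.DownTurn i n)

instance : TopologicalSpace s.Letter := ⊥
instance : DiscreteTopology s.Letter := ⟨rfl⟩
instance : MeasurableSpace s.Letter := ⊤
instance : DiscreteMeasurableSpace s.Letter := ⟨fun _ => trivial⟩

/-- The sets `E_β` of geodesics of `T`. -/
def cellUp : s.Letter → Set (Geodesic T)
  | .edge e => {ℓ |
      (e ∈ D.coreEdge ∧ ℓ.edge 0 = s.lift e) ∨
      (∃ i n, e = D.a i n ∧ ℓ.edge 0 = s.aLift i n ∧ ℓ.edge 1 = s.aLift i (n + 1) ∧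
        ℓ.edge (-n) = s.aLift i 0) ∨
      (∃ i n, e = (D.a i n).rev ∧ ℓ.edge 0 = (s.aLift i n).symm ∧
        ℓ.edge (-1) = (s.aLift i (n + 1)).symm ∧ ℓ.edge n = (s.aLift i 0).symm)}
  | .up i n c => {ℓ | ∃ g : Γ, c.Rep g ∧ ℓ.edge 0 = s.aLift i n ∧
      ℓ.edge 1 = g • (s.aLift i n).symm ∧ ℓ.edge (-n) = s.aLift i 0}
  | .down i n c => {ℓ | ∃ g : Γ, c.Rep g ∧ ℓ.edge 0 = (s.aLift i n).symm ∧
      ℓ.edge (-1) = g⁻¹ • s.aLift i n ∧ ℓ.edge n = (s.aLift i 0).symm}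

/-- The images of the sets `E_β` in `Γ\𝒢T`. -/
def cell (β : s.Letter) : Set (GeodQuot Γ) := GeodQuot.proj Γ '' s.cellUp β

/-- The transition relation `A_{α,β} = 1`: the letter `β` may follow the letter `α`. After `(g, +)`
come the letters `(g, -)` with the same `g`; after `(g, -)` at level `0` a geodesic may enter
another cuspidal ray with the same origin and turn back at once. -/
def Trans : s.Letter → s.Letter → Prop
  | .edge e, .edge f => e.t = f.o ∧ f ≠ e.rev
  | .edge e, .up i n _ => e.t = (D.a i n).o ∧ e ≠ (D.a i n).rev
  | .up i n c, .down j m c' => (i = j ∧ n = m) ∧ ∃ g ∈ s.turn i n, c.Rep g ∧ c'.Rep g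
  | .down i n _, .edge f => f.o = (D.a i n).rev.t ∧ f ≠ D.a i n
  | .down i n _, .up j m _ => (D.a j m).o = (D.a i n).rev.t ∧ D.a j m ≠ D.a i n
  | _, _ => False

/-- The subshift `X_A`. -/
def subshift : Set (ℤ → s.Letter) := {x | ∀ i, s.Trans (x i) (x (i + 1))}

end CuspDecomposition.Lifts

end Groups

/-! ## Markov shifts -/

section Markov

/-- The shift `(σ x)_i = x_{i+1}`. -/
def seqShift {A : Type*} (x : ℤ → A) : ℤ → A := fun i => x (i + 1)

/-- `P` is a stochastic matrix with stationary probability vector `p`. -/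
structure IsStationaryChain {A : Type*} (p : A → ℝ≥0∞) (P : A → A → ℝ≥0∞) : Prop where
  mass : ∑' α, p α = 1
  stochastic : ∀ α, ∑' β, P α β = 1
  stationary : ∀ β, ∑' α, p α * P α β = p β

/-- `μ` is a shift-invariant probability measure on `A^ℤ` with the cylinder formula of the Markov
measure associated with `(P, p)`. -/
structure IsMarkovMeasure {A : Type*} [MeasurableSpace A] (p : A → ℝ≥0∞) (P : A → A → ℝ≥0∞)
    (μ : Measure (ℤ → A)) : Prop where
  prob : IsProbabilityMeasure μ
  invariant : μ.map seqShift = μ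
  cylinder : ∀ (k : ℕ) (α : ℕ → A),
    μ {x | ∀ j ≤ k, x (j : ℤ) = α j} = p (α 0) * ∏ j ∈ Finset.range k, P (α j) (α (j + 1))

/-- `F` is a conjugacy (isomorphism modulo null sets) from the measured dynamical system
`(X, m, f)` to `(Y, m', g)`. -/
def IsMeasurableConjugacy {X Y : Type*} [MeasurableSpace X] [MeasurableSpace Y]
    (m : Measure X) (f : X → X) (m' : Measure Y) (g : Y → Y) (F : X → Y) : Prop :=
  Measurable F ∧ m.map F = m' ∧ (∀ᵐ x ∂m, F (f x) = g (F x)) ∧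
    ∃ G : Y → X, Measurable G ∧ (∀ᵐ x ∂m, G (F x) = x) ∧ ∀ᵐ y ∂m', F (G y) = y

end Markov

section Coding

variable {V : Type*} {T : SimpleGraph V} {Γ : Subgroup (T ≃g T)} {D : CuspDecomposition Γ}

/-- `ν_β = m(E_β)`. -/
def nu (s : D.Lifts) (m : Measure (GeodQuot Γ)) (β : s.Letter) : ℝ≥0∞ := m (s.cell β)

/-- `π_{α,β} = m(φ⁻¹(E_β) ∩ E_α) / ν_α`. -/
def transProb (s : D.Lifts) (m : Measure (GeodQuot Γ)) (α β : s.Letter) : ℝ≥0∞ :=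
  m (GeodQuot.flow Γ 1 ⁻¹' s.cell β ∩ s.cell α) / nu s m α

end Coding

end TreeCoding

end

open TreeCoding

/-! The Markov property comes from the product structure of the Bowen–Margulis measure. On the
geodesics that are at a given vertex `y` at a given time, the factor `d_x(ℓ_-, ℓ_+)^{-2δ}` cancels
the conformal densities exactly, and the measure becomes `μ_y × μ_y` on the pairs of ends
(`bowenMargulisUp_coord`). A cell `E_β` imposes separate conditions on the past and on the future of
an edge, hence is a rectangle for this product, and past and future are independent inside it
(`IsRect.independence`).

The cells upstairs form a strict fundamental domain for `Γ` (`exists_code`, `code_unique`). At a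
cusp vertex the edge towards the end of the cusp is unique, so a geodesic that starts to descend
must return to the core. Every piece of a geodesic in a cusp is thus attached to a core vertex,
whose stabiliser is trivial, and this pins the normalising element. For the same reason the letters
after time `0` depend only on the letter at time `0` and the future of the geodesic
(`future_determined`), and symmetrically for the past. Independence and invariance give the cylinder
formula (`isMarkovMeasure_of_independence`). Allowed transitions are exactly those realised by
geodesics (`exists_geodesic_of_trans`, `trans_of_geodesic`). Nonempty open sets have positive
measure, so the support is `X_A`.

The analytic point is finiteness of the measure. Write `q = e^{-δ}`. The mass in a cusp is bounded
by the sum of the masses of the shadows of its successive vertices. Disjoint shadows of exits from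
the cusp give `∑ |Γ_{i,n}| q^{2n} < ∞`. Uniformity of `T` makes the valences along the cusp
periodic, so this is a series of geometric blocks and its convergence is an open condition on `q`.
The shadows then decay geometrically, provided that the end of the cusp has no mass. If it were an
atom, the Poincaré series would converge at `δ` (`tsum_dist_ne_top_of_atom`), and a renewal argument
with convexity would give convergence below `δ` (`exists_gt_tsum_core_ne_top`), against the choice
of `δ` as critical exponent.

For the conjugacy, the letter is enriched by the element of `Γ` relating two successive
normalisations; these elements reconstruct the geodesic (`eq_of_refined`). Letters alone only know
the turns in a cusp up to cosets. Without cusps all stabilisers are trivial and two successive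
letters already determine this element (`refined_eq_of_letter`). -/

namespace TreeCoding

/-! ### Metric geometry of trees: segments, rays, projections, Busemann functions. -/

section TreeMetric

variable {V : Type*} {T : SimpleGraph V}

/-- `z` lies on the segment `[x, y]`. -/
def Btw (T : SimpleGraph V) (x z y : V) : Prop := T.dist x y = T.dist x z + T.dist z y

theorem dist_step (hT : T.IsTree) (x : V) {y z : V} (h : T.Adj y z) :
    T.dist x z = T.dist x y + 1 ∨ T.dist x y = T.dist x z + 1 := by
  rcases hT.dist_eq_dist_add_one_of_adj x h with h | h
  · exact Or.inr h
  · exact Or.inl h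

/-- Shortest walks through `z` and through `z'` are both paths from `x` to `y`, hence equal, and the
two vertices sit at the same index. -/
theorem Btw.unique (hT : T.IsTree) {x y z z' : V} (h : Btw T x z y) (h' : Btw T x z' y)
    (hd : T.dist x z = T.dist x z') : z = z' := by
  obtain ⟨p, hp⟩ := hT.1.exists_walk_length_eq_dist x z
  obtain ⟨q, hq⟩ := hT.1.exists_walk_length_eq_dist z y
  obtain ⟨p', hp'⟩ := hT.1.exists_walk_length_eq_dist x z'
  obtain ⟨q', hq'⟩ := hT.1.exists_walk_length_eq_dist z' y
  have h1 : (p.append q).IsPath := by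
    apply SimpleGraph.Walk.isPath_of_length_eq_dist
    rw [SimpleGraph.Walk.length_append, hp, hq, h]
  have h2 : (p'.append q').IsPath := by
    apply SimpleGraph.Walk.isPath_of_length_eq_dist
    rw [SimpleGraph.Walk.length_append, hp', hq', h']
  have h3 := (hT.existsUnique_path x y).unique h1 h2
  have h4 := congrArg (fun w => w.getVert p.length) h3
  simp only [SimpleGraph.Walk.getVert_append, lt_irrefl, if_false, Nat.sub_self,
    SimpleGraph.Walk.getVert_zero] at h4
  rw [if_neg (by omega), show p.length - p'.length = 0 by omega,
    SimpleGraph.Walk.getVert_zero] at h4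
  exact h4

theorem closer_unique (hT : T.IsTree) {x y z z' : V} (h : T.Adj y z) (h' : T.Adj y z')
    (hz : T.dist x y = T.dist x z + 1) (hz' : T.dist x y = T.dist x z' + 1) : z = z' := by
  have h1 : T.dist z y = 1 := SimpleGraph.dist_eq_one_iff_adj.2 h.symm
  have h2 : T.dist z' y = 1 := SimpleGraph.dist_eq_one_iff_adj.2 h'.symm
  exact Btw.unique hT (x := x) (y := y) (by rw [Btw]; omega) (by rw [Btw]; omega) (by omega)

/-- A path that has started to move away from `x` cannot come back: a step towards `x` goes to the
unique closer neighbour, which is the vertex just left. -/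
theorem nb_dist (hT : T.IsTree) (x : V) (p : ℕ → V) (N : ℕ)
    (adj : ∀ k < N, T.Adj (p k) (p (k + 1))) (nb : ∀ k, k + 2 ≤ N → p k ≠ p (k + 2))
    (h0 : 1 ≤ N → T.dist x (p 1) = T.dist x (p 0) + 1) :
    ∀ k ≤ N, T.dist x (p k) = T.dist x (p 0) + k := by
  have key : ∀ k < N, T.dist x (p (k + 1)) = T.dist x (p k) + 1 := by
    intro k
    induction k with
    | zero => intro h; simpa using h0 h
    | succ k ih =>
      intro hk
      have h1 := ih (by omega)
      rcases dist_step hT x (adj (k + 1) hk) with h | h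
      · exact h
      · exact absurd (closer_unique hT (adj k (by omega)).symm (adj (k + 1) hk) h1 h)
          (nb k (by omega))
  intro k
  induction k with
  | zero => simp
  | succ k ih =>
    intro hk
    rw [key k (by omega), ih (by omega)]
    ring

theorem nb_dist_self (hT : T.IsTree) (p : ℕ → V) (N : ℕ)
    (adj : ∀ k < N, T.Adj (p k) (p (k + 1))) (nb : ∀ k, k + 2 ≤ N → p k ≠ p (k + 2)) :
    ∀ k ≤ N, T.dist (p 0) (p k) = k := by
  intro k hk
  have := nb_dist hT (p 0) p N adj nb (fun h => by
    rw [SimpleGraph.dist_self, SimpleGraph.dist_eq_one_iff_adj.2 (adj 0 h)]) k hk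
  simpa using this

theorem dist_iso (γ : T ≃g T) (x y : V) : T.dist (γ x) (γ y) = T.dist x y := by
  have key : ∀ (γ : T ≃g T) (x y : V), T.Reachable x y → T.dist (γ x) (γ y) ≤ T.dist x y := by
    intro γ x y h
    obtain ⟨p, hp⟩ := h.exists_walk_length_eq_dist
    have := SimpleGraph.dist_le (p.map γ.toHom)
    rw [SimpleGraph.Walk.length_map, hp] at this
    exact this
  by_cases h : T.Reachable x y
  · refine le_antisymm (key γ x y h) ?_
    have h' : T.Reachable (γ x) (γ y) := h.map γ.toHom
    have := key γ.symm (γ x) (γ y) h'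
    simpa using this
  · have h' : ¬ T.Reachable (γ x) (γ y) := fun h' => h (by
      have := h'.map γ.symm.toHom
      simpa using this)
    rw [SimpleGraph.dist_eq_zero_of_not_reachable h, SimpleGraph.dist_eq_zero_of_not_reachable h']

theorem dist_smul {Γ : Subgroup (T ≃g T)} (γ : Γ) (x y : V) :
    T.dist (γ • x) (γ • y) = T.dist x y := dist_iso (γ : T ≃g T) x y

/-- A non-backtracking sequence of vertices of a tree is a ray. -/
def Ray.ofNB (hT : T.IsTree) (p : ℕ → V) (adj : ∀ k, T.Adj (p k) (p (k + 1)))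
    (nb : ∀ k, p k ≠ p (k + 2)) : Ray T where
  toFun := p
  adj := adj
  inj := by
    have key : ∀ a b, a ≤ b → p a = p b → a = b := by
      intro a b hab h
      have := nb_dist_self hT (fun k => p (a + k)) (b - a) (fun k _ => adj _) (fun k _ => nb _)
        (b - a) le_rfl
      simp only [add_zero, Nat.add_sub_cancel' hab, h, SimpleGraph.dist_self] at this
      omega
    intro a b h
    rcases le_total a b with hab | hab
    · exact key a b hab h
    · exact (key b a hab h.symm).symm

/-- A non-backtracking bi-infinite sequence of vertices of a tree is a geodesic. -/
def Geodesic.ofNB (hT : T.IsTree) (p : ℤ → V) (adj : ∀ k, T.Adj (p k) (p (k + 1)))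
    (nb : ∀ k, p k ≠ p (k + 2)) : Geodesic T where
  toFun := p
  adj := adj
  inj := by
    have key : ∀ a b, a ≤ b → p a = p b → a = b := by
      intro a b hab h
      have := nb_dist_self hT (fun k : ℕ => p (a + k)) (b - a).toNat
        (fun k _ => by have := adj (a + k); push_cast; rwa [← add_assoc])
        (fun k _ => by have := nb (a + k); push_cast; rwa [← add_assoc])
        (b - a).toNat le_rfl
      simp only [Nat.cast_zero, add_zero, Int.toNat_of_nonneg (sub_nonneg.2 hab),
        add_sub_cancel, h, SimpleGraph.dist_self] at this
      omega
    intro a b h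
    rcases le_total a b with hab | hab
    · exact key a b hab h
    · exact (key b a hab h.symm).symm

theorem Ray.nb (r : Ray T) (k : ℕ) : r.toFun k ≠ r.toFun (k + 2) := fun h => by
  have := r.inj h; omega

theorem Geodesic.nb (ℓ : Geodesic T) (k : ℤ) : ℓ.toFun k ≠ ℓ.toFun (k + 2) := fun h => by
  have := ℓ.inj h; omega

theorem Ray.dist_eq (hT : T.IsTree) (r : Ray T) (m k : ℕ) :
    T.dist (r.toFun m) (r.toFun (m + k)) = k :=
  nb_dist_self hT (fun k => r.toFun (m + k)) k (fun _ _ => r.adj _) (fun _ _ => r.nb _) k le_rfl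

theorem Geodesic.dist_add (hT : T.IsTree) (ℓ : Geodesic T) (m : ℤ) (k : ℕ) :
    T.dist (ℓ.toFun m) (ℓ.toFun (m + k)) = k := by
  have := nb_dist_self hT (fun k : ℕ => ℓ.toFun (m + k)) k
    (fun k _ => by have := ℓ.adj (m + k); push_cast; rwa [← add_assoc])
    (fun k _ => by have := ℓ.nb (m + k); push_cast; rwa [← add_assoc]) k le_rfl
  simpa using this

theorem Geodesic.dist_eq (hT : T.IsTree) (ℓ : Geodesic T) (a b : ℤ) :
    T.dist (ℓ.toFun a) (ℓ.toFun b) = (b - a).natAbs := by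
  rcases le_total a b with h | h
  · have := ℓ.dist_add hT a (b - a).natAbs
    rwa [show a + ((b - a).natAbs : ℤ) = b by omega] at this
  · have := ℓ.dist_add hT b (b - a).natAbs
    rwa [show b + ((b - a).natAbs : ℤ) = a by omega, SimpleGraph.dist_comm] at this

/-- At the foot of `x` the first step in either direction does not get closer to `x`, so `nb_dist`
applies to both halves of the geodesic. -/
theorem Geodesic.footTime_spec (hT : T.IsTree) (ℓ : Geodesic T) (x : V) (t : ℤ) :
    T.dist x (ℓ.toFun t) =
      T.dist x (ℓ.toFun (ℓ.footTime x)) + (t - ℓ.footTime x).natAbs := by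
  set s := ℓ.footTime x with hs
  have hmin : ∀ t, T.dist x (ℓ.toFun s) ≤ T.dist x (ℓ.toFun t) :=
    fun t => Function.argmin_le (fun s : ℤ => T.dist x (ℓ.toFun s)) t
  rcases le_total s t with h | h
  · have := nb_dist hT x (fun k : ℕ => ℓ.toFun (s + k)) (t - s).natAbs
      (fun k _ => by have := ℓ.adj (s + k); push_cast; rwa [← add_assoc])
      (fun k _ => by have := ℓ.nb (s + k); push_cast; rwa [← add_assoc])
      (fun _ => by
        have h1 := hmin (s + 1)
        rcases dist_step hT x (ℓ.adj s) with h' | h'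
        · simpa using h'
        · omega) _ le_rfl
    simp only [Nat.cast_zero, add_zero] at this
    rwa [show s + ((t - s).natAbs : ℤ) = t by omega] at this
  · have := nb_dist hT x (fun k : ℕ => ℓ.toFun (s - k)) (t - s).natAbs
      (fun k _ => by
        have := (ℓ.adj (s - k - 1)).symm
        rw [show s - k - 1 + 1 = s - k by ring] at this
        push_cast; rwa [← sub_sub])
      (fun k _ => by
        have := (ℓ.nb (s - k - 2)).symm
        rw [show s - k - 2 + 2 = s - k by ring] at this
        push_cast; rwa [← sub_sub])
      (fun _ => by
        have h1 := hmin (s - 1)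
        have h3 := ℓ.adj (s - 1)
        rw [show s - 1 + 1 = s by ring] at h3
        rcases dist_step hT x h3.symm with h' | h'
        · simpa using h'
        · omega) _ le_rfl
    simp only [Nat.cast_zero, sub_zero] at this
    rwa [show s - ((t - s).natAbs : ℤ) = t by omega] at this

theorem Geodesic.footTime_unique (hT : T.IsTree) (ℓ : Geodesic T) (x : V) (s : ℤ)
    (h : ∀ t, T.dist x (ℓ.toFun s) ≤ T.dist x (ℓ.toFun t)) : ℓ.footTime x = s := by
  have := ℓ.footTime_spec hT x s
  have := h (ℓ.footTime x)
  omega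

theorem Geodesic.footTime_eq_iff (hT : T.IsTree) (ℓ : Geodesic T) (x : V) (s : ℤ) :
    ℓ.footTime x = s ↔ ∀ t, T.dist x (ℓ.toFun s) ≤ T.dist x (ℓ.toFun t) := by
  refine ⟨?_, ℓ.footTime_unique hT x s⟩
  rintro rfl t
  rw [ℓ.footTime_spec hT x t]
  omega

theorem Geodesic.footTime_shift (hT : T.IsTree) (ℓ : Geodesic T) (x : V) (k : ℤ) :
    (ℓ.shift k).footTime x = ℓ.footTime x - k := by
  refine Geodesic.footTime_unique hT _ x _ fun t => ?_
  change T.dist x (ℓ.toFun (ℓ.footTime x - k + k)) ≤ T.dist x (ℓ.toFun (t + k))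
  rw [sub_add_cancel, ℓ.footTime_spec hT x (t + k)]
  omega

/-- Removing the initial vertices of a ray. -/
def Ray.tail (r : Ray T) (n : ℕ) : Ray T where
  toFun k := r.toFun (n + k)
  adj k := r.adj (n + k)
  inj a b h := by have := r.inj h; omega

theorem Ray.toEnd_tail (r : Ray T) (n : ℕ) : (r.tail n).toEnd = r.toEnd :=
  Quotient.sound ⟨0, n, fun k => by simp [Ray.tail]⟩

theorem Ray.toEnd_eq_iff {r r' : Ray T} :
    r.toEnd = r'.toEnd ↔ ∃ m n : ℕ, ∀ k, r.toFun (m + k) = r'.toFun (n + k) :=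
  ⟨fun h => Quotient.exact h, fun h => Quotient.sound h⟩

/-- Moving the origin along one edge either deletes the first vertex of the ray or prepends one;
this is iterated along a walk from any representative to `x`. -/
theorem exists_ray_from (hT : T.IsTree) (x : V) (ξ : Ends T) :
    ∃ r : Ray T, r.toFun 0 = x ∧ r.toEnd = ξ := by
  have step : ∀ {x y : V}, T.Adj x y → (∃ r : Ray T, r.toFun 0 = x ∧ r.toEnd = ξ) →
      ∃ r : Ray T, r.toFun 0 = y ∧ r.toEnd = ξ := by
    rintro x y h ⟨r, rfl, hξ⟩
    by_cases hy : r.toFun 1 = y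
    · exact ⟨r.tail 1, hy, by rw [r.toEnd_tail, hξ]⟩
    · refine ⟨Ray.ofNB hT (fun k => if k = 0 then y else r.toFun (k - 1)) ?_ ?_, rfl, ?_⟩
      · rintro (_ | k)
        · simpa using h.symm
        · simpa using r.adj k
      · rintro (_ | k)
        · simpa using fun h => hy h.symm
        · simpa using r.nb k
      · rw [← hξ]
        exact Quotient.sound ⟨1, 0, fun k => by simp [Ray.ofNB, Nat.add_comm 1 k]⟩
  obtain ⟨r, rfl⟩ := Quotient.exists_rep ξ
  have hw : T.Reachable (r.toFun 0) x := hT.1.preconnected _ _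
  obtain ⟨w⟩ := hw
  have : ∀ {u v : V}, T.Walk u v → (∃ r' : Ray T, r'.toFun 0 = u ∧ r'.toEnd = Quotient.mk _ r) →
      ∃ r' : Ray T, r'.toFun 0 = v ∧ r'.toEnd = Quotient.mk _ r := by
    intro u v w
    induction w with
    | nil => exact id
    | cons h _ ih => exact fun h' => ih (step h h')
  exact this w ⟨r, rfl, rfl⟩

theorem Ray.btw (hT : T.IsTree) (r : Ray T) {a b c : ℕ} (hab : a ≤ b) (hbc : b ≤ c) :
    Btw T (r.toFun a) (r.toFun b) (r.toFun c) := by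
  have h1 := r.dist_eq hT a (b - a)
  have h2 := r.dist_eq hT b (c - b)
  have h3 := r.dist_eq hT a (c - a)
  rw [Nat.add_sub_cancel' hab] at h1
  rw [Nat.add_sub_cancel' hbc] at h2
  rw [Nat.add_sub_cancel' (hab.trans hbc)] at h3
  rw [Btw, h1, h2, h3]
  omega

theorem Ray.dist_zero (hT : T.IsTree) (r : Ray T) (k : ℕ) :
    T.dist (r.toFun 0) (r.toFun k) = k := by simpa using r.dist_eq hT 0 k

theorem Ray.eq_of_toEnd_eq (hT : T.IsTree) {r r' : Ray T} (h0 : r.toFun 0 = r'.toFun 0)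
    (h : r.toEnd = r'.toEnd) (k : ℕ) : r.toFun k = r'.toFun k := by
  obtain ⟨m, n, hmn⟩ := Ray.toEnd_eq_iff.1 h
  have hd := congrArg (T.dist (r.toFun 0)) (hmn 0)
  rw [r.dist_zero hT] at hd
  rw [h0, r'.dist_zero hT] at hd
  have hmn' : m = n := by omega
  subst hmn'
  have hb := r.btw hT (Nat.zero_le k) (show k ≤ m + k by omega)
  have hb' := r'.btw hT (Nat.zero_le k) (show k ≤ m + k by omega)
  rw [← hmn k, ← h0] at hb'
  refine Btw.unique hT hb hb' ?_
  rw [r.dist_zero hT, h0, r'.dist_zero hT]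

/-- Replaces the ray from `x` by an arbitrary representative of the end. Membership in a shadow
becomes an eventual condition on distances, which suits Busemann functions and measurability. -/
theorem onRay_iff_eventually (hT : T.IsTree) (x y : V) (r : Ray T) :
    OnRay x r.toEnd y ↔ ∀ᶠ n in atTop, Btw T x y (r.toFun n) := by
  constructor
  · rintro ⟨r', rfl, he, j, rfl⟩
    obtain ⟨m, n, hmn⟩ := Ray.toEnd_eq_iff.1 he
    filter_upwards [eventually_ge_atTop (n + j)] with a ha
    have := hmn (a - n)
    rw [show n + (a - n) = a by omega] at this
    rw [← this]
    exact r'.btw hT (Nat.zero_le _) (by omega)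
  · intro h
    obtain ⟨r', rfl, he⟩ := exists_ray_from hT x r.toEnd
    obtain ⟨m, n, hmn⟩ := Ray.toEnd_eq_iff.1 he
    obtain ⟨N, hN⟩ := eventually_atTop.1 h
    have h1 := hN (n + (N + T.dist (r'.toFun 0) y)) (by omega)
    rw [← hmn] at h1
    have h2 := r'.btw hT (Nat.zero_le (T.dist (r'.toFun 0) y))
      (show _ ≤ m + (N + T.dist (r'.toFun 0) y) by omega)
    exact ⟨r', rfl, he, _, Btw.unique hT h2 h1 (r'.dist_zero hT _)⟩

theorem Ray.onRay (r : Ray T) (k : ℕ) : OnRay (r.toFun 0) r.toEnd (r.toFun k) :=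
  ⟨r, rfl, rfl, k, rfl⟩

theorem OnRay.eq_of_dist (hT : T.IsTree) {y : V} {r : Ray T} (h : OnRay (r.toFun 0) r.toEnd y)
    {k : ℕ} (hk : T.dist (r.toFun 0) y = k) : y = r.toFun k := by
  obtain ⟨r', h0, he, j, rfl⟩ := h
  have := Ray.eq_of_toEnd_eq hT h0 he
  rw [this j, r.dist_zero hT] at hk
  rw [this j, hk]

theorem exists_onRay_onRay (hT : T.IsTree) (x y : V) (ξ : Ends T) :
    ∃ z, OnRay x ξ z ∧ OnRay y ξ z := by
  obtain ⟨r, rfl, rfl⟩ := exists_ray_from hT x ξ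
  obtain ⟨r', rfl, h'⟩ := exists_ray_from hT y r.toEnd
  obtain ⟨m, n, hmn⟩ := Ray.toEnd_eq_iff.1 h'
  refine ⟨r.toFun n, r.onRay n, ?_⟩
  have := hmn 0
  rw [add_zero, add_zero] at this
  rw [← this, ← h']
  exact r'.onRay m

theorem busemann_eq (hT : T.IsTree) {ξ : Ends T} {x y z : V} (hx : OnRay x ξ z)
    (hy : OnRay y ξ z) : busemann ξ x y = (T.dist x z : ℝ) - T.dist y z := by
  refine Tendsto.limUnder_eq ?_
  have hξ : (Quotient.out ξ : Ray T).toEnd = ξ := Quotient.out_eq ξ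
  rw [← hξ, onRay_iff_eventually hT] at hx hy
  refine tendsto_const_nhds.congr' ?_
  filter_upwards [hx, hy] with n h1 h2
  rw [Btw] at h1 h2
  rw [SimpleGraph.dist_comm (u := (Quotient.out ξ : Ray T).toFun n), h1, h2]
  push_cast
  ring

theorem busemann_of_onRay (hT : T.IsTree) {ξ : Ends T} {x y : V} (h : OnRay x ξ y) :
    busemann ξ x y = T.dist x y := by
  have hy : OnRay y ξ y := by
    obtain ⟨r, h0, he, n, rfl⟩ := h
    exact ⟨r.tail n, rfl, by rw [r.toEnd_tail, he], 0, rfl⟩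
  rw [busemann_eq hT h hy, SimpleGraph.dist_self]
  simp

/-- The sub-ray of a geodesic starting at time `k`. -/
def Geodesic.posRay (ℓ : Geodesic T) (k : ℤ) : Ray T where
  toFun n := ℓ.toFun (k + n)
  adj n := by have := ℓ.adj (k + n); push_cast; rwa [← add_assoc]
  inj a b h := by have := ℓ.inj h; omega

/-- The reversed sub-ray of a geodesic starting at time `k`. -/
def Geodesic.negRay (ℓ : Geodesic T) (k : ℤ) : Ray T where
  toFun n := ℓ.toFun (k - n)
  adj n := by
    have := (ℓ.adj (k - n - 1)).symm
    rw [sub_add_cancel] at this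
    push_cast; rwa [← sub_sub]
  inj a b h := by have := ℓ.inj h; omega

theorem Geodesic.toEnd_posRay (ℓ : Geodesic T) (k : ℤ) : (ℓ.posRay k).toEnd = ℓ.endPlus :=
  Quotient.sound ⟨(-k).toNat, k.toNat, fun j => by
    change ℓ.toFun _ = ℓ.toFun _
    congr 1
    push_cast
    omega⟩

theorem Geodesic.toEnd_negRay (ℓ : Geodesic T) (k : ℤ) : (ℓ.negRay k).toEnd = ℓ.endMinus :=
  Quotient.sound ⟨k.toNat, (-k).toNat, fun j => by
    change ℓ.toFun _ = ℓ.toFun _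
    congr 1
    push_cast
    omega⟩

theorem Geodesic.endPlus_shift (ℓ : Geodesic T) (k : ℤ) : (ℓ.shift k).endPlus = ℓ.endPlus := by
  rw [← ℓ.toEnd_posRay k, ← (ℓ.shift k).toEnd_posRay 0]
  exact Quotient.sound ⟨0, 0, fun j => congrArg ℓ.toFun (by push_cast; ring)⟩

theorem Geodesic.endMinus_shift (ℓ : Geodesic T) (k : ℤ) :
    (ℓ.shift k).endMinus = ℓ.endMinus := by
  rw [← ℓ.toEnd_negRay k, ← (ℓ.shift k).toEnd_negRay 0]
  exact Quotient.sound ⟨0, 0, fun j => congrArg ℓ.toFun (by push_cast; ring)⟩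

theorem Geodesic.toFun_eq_of_endPlus_eq (hT : T.IsTree) {ℓ ℓ' : Geodesic T} {k : ℤ}
    (h : ℓ.endPlus = ℓ'.endPlus) (hk : ℓ.toFun k = ℓ'.toFun k) {n : ℤ} (hn : k ≤ n) :
    ℓ.toFun n = ℓ'.toFun n := by
  have := Ray.eq_of_toEnd_eq hT (r := ℓ.posRay k) (r' := ℓ'.posRay k) (by simpa [posRay] using hk)
    (by rw [toEnd_posRay, toEnd_posRay, h]) (n - k).toNat
  simpa [posRay, Int.toNat_of_nonneg (sub_nonneg.2 hn)] using this

theorem Geodesic.toFun_eq_of_endMinus_eq (hT : T.IsTree) {ℓ ℓ' : Geodesic T} {k : ℤ}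
    (h : ℓ.endMinus = ℓ'.endMinus) (hk : ℓ.toFun k = ℓ'.toFun k) {n : ℤ} (hn : n ≤ k) :
    ℓ.toFun n = ℓ'.toFun n := by
  have := Ray.eq_of_toEnd_eq hT (r := ℓ.negRay k) (r' := ℓ'.negRay k) (by simpa [negRay] using hk)
    (by rw [toEnd_negRay, toEnd_negRay, h]) (k - n).toNat
  simpa [negRay, Int.toNat_of_nonneg (sub_nonneg.2 hn)] using this

theorem Geodesic.eq_of_ends_eq (hT : T.IsTree) {ℓ ℓ' : Geodesic T} {k : ℤ}
    (h : ℓ.endMinus = ℓ'.endMinus) (h' : ℓ.endPlus = ℓ'.endPlus)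
    (hk : ℓ.toFun k = ℓ'.toFun k) : ℓ = ℓ' := by
  ext n
  rcases le_total k n with hn | hn
  · exact toFun_eq_of_endPlus_eq hT h' hk hn
  · exact toFun_eq_of_endMinus_eq hT h hk hn

theorem Geodesic.exists_shift_eq (hT : T.IsTree) {ℓ ℓ' : Geodesic T}
    (h : ℓ.endMinus = ℓ'.endMinus) (h' : ℓ.endPlus = ℓ'.endPlus) : ∃ c, ℓ' = ℓ.shift c := by
  have h1 : ∃ m n : ℕ, ∀ k : ℕ, ℓ.toFun (m + k : ℕ) = ℓ'.toFun (n + k : ℕ) :=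
    Ray.toEnd_eq_iff.1 h'
  have h2 : ∃ m n : ℕ, ∀ k : ℕ, ℓ.toFun (-(m + k : ℕ)) = ℓ'.toFun (-(n + k : ℕ)) :=
    Ray.toEnd_eq_iff.1 h
  obtain ⟨m, n, hmn⟩ := h1
  obtain ⟨a, b, hab⟩ := h2
  refine ⟨(m : ℤ) - n, (eq_of_ends_eq hT (k := (n : ℤ)) ?_ ?_ ?_).symm⟩
  · rw [endMinus_shift, h]
  · rw [endPlus_shift, h']
  · change ℓ.toFun (n + (m - n)) = _
    simpa using hmn 0

/-- The later of `ℓ(s)` and `ℓ(k)`, with `s` the foot time of `x`, lies on both rays towards `ℓ_+`,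
and the Busemann function is read off there. -/
theorem Geodesic.busemann_endPlus (hT : T.IsTree) (ℓ : Geodesic T) (x : V) (k : ℤ) :
    busemann ℓ.endPlus x (ℓ.toFun k) =
      (T.dist x (ℓ.toFun (ℓ.footTime x)) : ℝ) - ℓ.footTime x + k := by
  set s := ℓ.footTime x with hs
  have hz : OnRay x ℓ.endPlus (ℓ.toFun (max s k)) := by
    rw [← ℓ.toEnd_posRay (max s k), onRay_iff_eventually hT]
    refine Eventually.of_forall fun n => ?_
    change T.dist _ (ℓ.toFun (max s k + n)) = _ + T.dist _ (ℓ.toFun (max s k + n))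
    rw [ℓ.dist_eq hT, ℓ.footTime_spec hT x, ℓ.footTime_spec hT x (max s k), ← hs]
    omega
  have hy : OnRay (ℓ.toFun k) ℓ.endPlus (ℓ.toFun (max s k)) := by
    rw [← ℓ.toEnd_posRay k]
    refine ⟨ℓ.posRay k, by simp [posRay], rfl, (max s k - k).toNat, ?_⟩
    change ℓ.toFun _ = _
    congr 1
    omega
  rw [busemann_eq hT hz hy, ℓ.footTime_spec hT x (max s k), ← hs, ℓ.dist_eq hT]
  have : ((max s k - s).natAbs : ℤ) = (max s k - k).natAbs + k - s := by omega
  have h2 := congrArg (Int.cast (R := ℝ)) this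
  rw [Int.cast_sub, Int.cast_add, Int.cast_natCast, Int.cast_natCast] at h2
  rw [Nat.cast_add, h2]
  ring

theorem Geodesic.busemann_endMinus (hT : T.IsTree) (ℓ : Geodesic T) (x : V) (k : ℤ) :
    busemann ℓ.endMinus x (ℓ.toFun k) =
      (T.dist x (ℓ.toFun (ℓ.footTime x)) : ℝ) + ℓ.footTime x - k := by
  set s := ℓ.footTime x with hs
  have hz : OnRay x ℓ.endMinus (ℓ.toFun (min s k)) := by
    rw [← ℓ.toEnd_negRay (min s k), onRay_iff_eventually hT]
    refine Eventually.of_forall fun n => ?_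
    change T.dist _ (ℓ.toFun (min s k - n)) = _ + T.dist _ (ℓ.toFun (min s k - n))
    rw [ℓ.dist_eq hT, ℓ.footTime_spec hT x, ℓ.footTime_spec hT x (min s k), ← hs]
    omega
  have hy : OnRay (ℓ.toFun k) ℓ.endMinus (ℓ.toFun (min s k)) := by
    rw [← ℓ.toEnd_negRay k]
    refine ⟨ℓ.negRay k, by simp [negRay], rfl, (k - min s k).toNat, ?_⟩
    change ℓ.toFun _ = _
    congr 1
    omega
  rw [busemann_eq hT hz hy, ℓ.footTime_spec hT x (min s k), ← hs, ℓ.dist_eq hT]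
  have : ((min s k - s).natAbs : ℤ) = (min s k - k).natAbs - k + s := by omega
  have h2 := congrArg (Int.cast (R := ℝ)) this
  rw [Int.cast_add, Int.cast_sub, Int.cast_natCast, Int.cast_natCast] at h2
  rw [Nat.cast_add, h2]
  ring

theorem Geodesic.commonLength_eq (hT : T.IsTree) (ℓ : Geodesic T) (x : V) :
    commonLength x ℓ.endMinus ℓ.endPlus = T.dist x (ℓ.toFun (ℓ.footTime x)) := by
  set s := ℓ.footTime x with hs
  have hP : ∀ y, OnRay x ℓ.endPlus y ↔ ∀ᶠ n : ℕ in atTop, Btw T x y (ℓ.toFun (s + n)) := by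
    intro y
    rw [← ℓ.toEnd_posRay s, onRay_iff_eventually hT]
    rfl
  have hM : ∀ y, OnRay x ℓ.endMinus y ↔ ∀ᶠ n : ℕ in atTop, Btw T x y (ℓ.toFun (s - n)) := by
    intro y
    rw [← ℓ.toEnd_negRay s, onRay_iff_eventually hT]
    rfl
  refine IsGreatest.csSup_eq ⟨⟨ℓ.toFun s, ?_, ?_, rfl⟩, ?_⟩
  · rw [hM]
    refine Eventually.of_forall fun n => ?_
    rw [Btw, ℓ.dist_eq hT, ℓ.footTime_spec hT x, ← hs]
  · rw [hP]
    refine Eventually.of_forall fun n => ?_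
    rw [Btw, ℓ.dist_eq hT, ℓ.footTime_spec hT x, ← hs]
  · rintro n ⟨y, h1, h2, rfl⟩
    rw [hM] at h1
    rw [hP] at h2
    -- A common vertex `y` lies on the segments from `x` to `ℓ(s-N)` and to `ℓ(s+N)`; as these two
    -- are `2N` apart, the triangle inequality through `y` bounds `d(x,y)` by the distance to the
    -- foot.
    obtain ⟨N, h1, h2⟩ := (h1.and h2).exists
    have h3 := hT.1.dist_triangle (u := ℓ.toFun (s - N)) (v := y) (w := ℓ.toFun (s + N))
    rw [ℓ.dist_eq hT, SimpleGraph.dist_comm (u := ℓ.toFun (s - N))] at h3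
    rw [Btw, ℓ.footTime_spec hT x, ← hs] at h1 h2
    omega

theorem Geodesic.endMinus_ne_endPlus (hT : T.IsTree) (ℓ : Geodesic T) :
    ℓ.endMinus ≠ ℓ.endPlus := by
  intro h
  rw [← ℓ.toEnd_negRay 0, ← ℓ.toEnd_posRay 0] at h
  have := Ray.eq_of_toEnd_eq hT (by simp [posRay, negRay]) h 1
  have := ℓ.inj this
  simp at this

/-- The geodesic obtained from two rays with the same origin and no other common vertex. -/
theorem exists_geodesic_of_rays (hT : T.IsTree) (r r' : Ray T) (h0 : r.toFun 0 = r'.toFun 0)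
    (h1 : r.toFun 1 ≠ r'.toFun 1) :
    ∃ ℓ : Geodesic T, ∀ n : ℕ, ℓ.toFun n = r'.toFun n ∧ ℓ.toFun (-n) = r.toFun n := by
  obtain ⟨p, hpos, hneg⟩ : ∃ p : ℤ → V, (∀ n : ℕ, p n = r'.toFun n) ∧
      ∀ n : ℕ, p (-n) = r.toFun n := by
    refine ⟨fun k => if 0 ≤ k then r'.toFun k.toNat else r.toFun (-k).toNat, fun n => by simp,
      fun n => ?_⟩
    rcases n with _ | n
    · simp [h0]
    · simp only
      rw [if_neg (by omega)]
      congr 1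
  refine ⟨Geodesic.ofNB hT p ?_ ?_, fun n => ⟨hpos n, hneg n⟩⟩
  · intro k
    rcases le_or_gt 0 k with hk | hk
    · obtain ⟨n, rfl⟩ := Int.eq_ofNat_of_zero_le hk
      have := hpos (n + 1)
      push_cast at this
      rw [hpos n, this]
      exact r'.adj n
    · obtain ⟨n, rfl⟩ : ∃ n : ℕ, k = -((n + 1 : ℕ) : ℤ) := ⟨(-k - 1).toNat, by omega⟩
      rw [hneg, show -((n + 1 : ℕ) : ℤ) + 1 = -(n : ℤ) by push_cast; ring, hneg]
      exact (r.adj n).symm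
  · intro k
    rcases le_or_gt 0 k with hk | hk
    · obtain ⟨n, rfl⟩ := Int.eq_ofNat_of_zero_le hk
      have := hpos (n + 2)
      push_cast at this
      rw [hpos n, this]
      exact r'.nb n
    · rcases eq_or_ne k (-1) with rfl | hk'
      · have e1 := hneg 1
        have e2 := hpos 1
        push_cast at e1 e2
        rw [e1, show (-1 : ℤ) + 2 = 1 by norm_num, e2]
        exact h1
      · obtain ⟨n, rfl⟩ : ∃ n : ℕ, k = -((n + 2 : ℕ) : ℤ) := ⟨(-k - 2).toNat, by omega⟩
        rw [hneg, show -((n + 2 : ℕ) : ℤ) + 2 = -(n : ℤ) by push_cast; ring, hneg]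
        exact (r.nb n).symm

theorem onRay_smul {Γ : Subgroup (T ≃g T)} (γ : Γ) {x y : V} {ξ : Ends T} (h : OnRay x ξ y) :
    OnRay (γ • x) (γ • ξ) (γ • y) := by
  obtain ⟨r, rfl, rfl, n, rfl⟩ := h
  exact ⟨Ray.map γ r, rfl, rfl, n, rfl⟩

theorem onRay_smul_iff {Γ : Subgroup (T ≃g T)} (γ : Γ) {x y : V} {ξ : Ends T} :
    OnRay (γ • x) (γ • ξ) (γ • y) ↔ OnRay x ξ y :=
  ⟨fun h => by simpa using onRay_smul γ⁻¹ h, onRay_smul γ⟩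

end TreeMetric

/-! ### Borel structure of the space of ends. -/

section EndsTopology

variable {V : Type*} {T : SimpleGraph V}

theorem finite_ball (hT : T.IsTree) (hlf : ∀ v, (T.neighborSet v).Finite) (x : V) (n : ℕ) :
    {y | T.dist x y ≤ n}.Finite := by
  induction n with
  | zero =>
    refine (Set.finite_singleton x).subset fun y hy => ?_
    have : T.dist x y = 0 := by simpa using hy
    exact (hT.1.dist_eq_zero_iff.1 this).symm
  | succ n ih =>
    refine (ih.union (ih.biUnion fun v _ => hlf v)).subset fun y hy => ?_
    by_cases h : T.dist x y ≤ n
    · exact Or.inl h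
    · right
      obtain ⟨w, hw⟩ := hT.1.exists_walk_length_eq_dist y x
      rw [SimpleGraph.dist_comm] at hw
      cases w with
      | nil => simp at h
      | @cons _ z _ hz q =>
        rw [SimpleGraph.Walk.length_cons] at hw
        have h1 := SimpleGraph.dist_le q
        rw [SimpleGraph.dist_comm] at h1
        change T.dist x y ≤ n + 1 at hy
        exact Set.mem_biUnion (show T.dist x z ≤ n by omega) hz.symm

theorem countable_of_locallyFinite (hT : T.IsTree) (hlf : ∀ v, (T.neighborSet v).Finite) :
    Countable V := by
  obtain ⟨x⟩ := hT.1.nonempty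
  rw [← Set.countable_univ_iff]
  refine (Set.countable_iUnion fun n => (finite_ball hT hlf x n).countable).mono
    fun y _ => Set.mem_iUnion.2 ⟨T.dist x y, le_refl (T.dist x y)⟩

instance [Countable V] : SecondCountableTopology (Ends T) := by
  refine ⟨⟨_, ?_, rfl⟩⟩
  refine (Set.countable_range fun p : V × V => (shadow p.1 p.2 : Set (Ends T))).mono ?_
  rintro S ⟨x, y, rfl⟩
  exact ⟨(x, y), rfl⟩

theorem isOpen_shadow (x y : V) : IsOpen (shadow x y : Set (Ends T)) :=
  TopologicalSpace.isOpen_generateFrom_of_mem ⟨x, y, rfl⟩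

theorem measurableSet_shadow (x y : V) : MeasurableSet (shadow x y : Set (Ends T)) :=
  (isOpen_shadow x y).measurableSet

/-- Together with second countability this makes the Borel structure countably separated, as needed
for injective measurable maps out of standard Borel spaces to be embeddings. -/
theorem t0Space_ends (hT : T.IsTree) : T0Space (Ends T) := by
  refine ⟨fun ξ η h => ?_⟩
  obtain ⟨x⟩ := hT.1.nonempty
  obtain ⟨r, rfl, rfl⟩ := exists_ray_from hT x ξ
  obtain ⟨r', h0, rfl⟩ := exists_ray_from hT (r.toFun 0) η
  refine Quotient.sound ⟨0, 0, fun k => ?_⟩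
  have h1 := (h.mem_open_iff (isOpen_shadow (r.toFun 0) (r.toFun k))).1 (r.onRay k)
  have h2 : OnRay (r'.toFun 0) r'.toEnd (r.toFun k) := by rw [h0]; exact h1
  simpa using h2.eq_of_dist hT (k := k) (by rw [h0, r.dist_zero hT])

theorem measurable_of_shadow {X : Type*} [MeasurableSpace X] [Countable V] {f : X → Ends T}
    (h : ∀ x y, MeasurableSet (f ⁻¹' shadow x y)) : Measurable f := by
  have : borel (Ends T) = MeasurableSpace.generateFrom {S | ∃ x y : V, S = shadow x y} :=
    borel_eq_generateFrom_of_subbasis rfl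
  change @Measurable _ _ _ (borel (Ends T)) f
  rw [this]
  refine measurable_generateFrom ?_
  rintro S ⟨x, y, rfl⟩
  exact h x y

theorem isLocallyConstant_busemann (hT : T.IsTree) (x y : V) :
    IsLocallyConstant fun ξ : Ends T => busemann ξ x y := by
  rw [IsLocallyConstant.iff_exists_open]
  intro ξ
  obtain ⟨z, h1, h2⟩ := exists_onRay_onRay hT x y ξ
  refine ⟨shadow x z ∩ shadow y z, (isOpen_shadow _ _).inter (isOpen_shadow _ _), ⟨h1, h2⟩, ?_⟩
  rintro η ⟨h3, h4⟩
  rw [busemann_eq hT h1 h2, busemann_eq hT h3 h4]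

theorem measurable_busemann (hT : T.IsTree) (x y : V) :
    Measurable fun ξ : Ends T => busemann ξ x y :=
  (isLocallyConstant_busemann hT x y).continuous.measurable

theorem continuous_smul_ends {Γ : Subgroup (T ≃g T)} (γ : Γ) :
    Continuous fun ξ : Ends T => γ • ξ := by
  refine continuous_generateFrom_iff.2 ?_
  rintro S ⟨x, y, rfl⟩
  convert! isOpen_shadow (T := T) (γ⁻¹ • x) (γ⁻¹ • y) using 1
  ext ξ
  change OnRay x (γ • ξ) y ↔ OnRay _ _ _
  rw [← onRay_smul_iff γ (x := γ⁻¹ • x), smul_inv_smul, smul_inv_smul]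

end EndsTopology

/-! ### Topology of the space of geodesics and measurability of the Hopf coordinates. -/

section GeodesicTopology

variable {V : Type*} {T : SimpleGraph V}

theorem Geodesic.continuous_coord (n : ℤ) :
    @Continuous _ _ _ ⊥ fun ℓ : Geodesic T => ℓ.toFun n := by
  let : TopologicalSpace V := ⊥
  exact (continuous_apply n).comp continuous_induced_dom

theorem Geodesic.isOpen_coord (n : ℤ) (S : Set V) : IsOpen {ℓ : Geodesic T | ℓ.toFun n ∈ S} := by
  let : TopologicalSpace V := ⊥
  have : DiscreteTopology V := ⟨rfl⟩
  exact (isOpen_discrete S).preimage (Geodesic.continuous_coord n)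

theorem Geodesic.isOpen_coord_eq (n : ℤ) (v : V) : IsOpen {ℓ : Geodesic T | ℓ.toFun n = v} :=
  Geodesic.isOpen_coord n {v}

theorem Geodesic.isOpen_edge_eq (n : ℤ) (d : T.Dart) :
    IsOpen {ℓ : Geodesic T | ℓ.edge n = d} := by
  convert! (Geodesic.isOpen_coord_eq (T := T) n d.fst).inter
    (Geodesic.isOpen_coord_eq (n + 1) d.snd) using 1
  ext ℓ
  simp only [Set.mem_ofPred_eq, Set.mem_inter_iff, SimpleGraph.Dart.ext_iff, Prod.ext_iff]
  rfl

theorem Geodesic.continuous_of_coord {X : Type*} [TopologicalSpace X] {f : X → Geodesic T}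
    (h : ∀ n v, IsOpen {x | (f x).toFun n = v}) : Continuous f := by
  let : TopologicalSpace V := ⊥
  have : DiscreteTopology V := ⟨rfl⟩
  refine continuous_induced_rng.2 (continuous_pi fun n => continuous_def.2 fun S _ => ?_)
  have : (fun x => (f x).toFun n) ⁻¹' S = ⋃ v ∈ S, {x | (f x).toFun n = v} := by
    ext x; simp
  exact this ▸ isOpen_biUnion fun v _ => h n v

theorem Geodesic.continuous_shift (k : ℤ) : Continuous (Geodesic.shift k : Geodesic T → _) :=
  Geodesic.continuous_of_coord fun n v => Geodesic.isOpen_coord_eq (n + k) v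

theorem Geodesic.continuous_smul {Γ : Subgroup (T ≃g T)} (γ : Γ) :
    Continuous fun ℓ : Geodesic T => γ • ℓ := by
  refine Geodesic.continuous_of_coord fun n v => ?_
  convert! Geodesic.isOpen_coord_eq (T := T) n (γ⁻¹ • v) using 1
  ext ℓ
  change γ • (ℓ.toFun n) = v ↔ ℓ.toFun n = γ⁻¹ • v
  exact smul_eq_iff_eq_inv_smul γ

instance {Γ : Subgroup (T ≃g T)} : MeasurableConstSMul Γ (Geodesic T) :=
  ⟨fun γ => (Geodesic.continuous_smul γ).measurable⟩

theorem Geodesic.measurableSet_coord (n : ℤ) (S : Set V) :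
    MeasurableSet {ℓ : Geodesic T | ℓ.toFun n ∈ S} := (Geodesic.isOpen_coord n S).measurableSet

theorem Geodesic.measurableSet_coord_eq (n : ℤ) (v : V) :
    MeasurableSet {ℓ : Geodesic T | ℓ.toFun n = v} := Geodesic.measurableSet_coord n {v}

theorem Geodesic.exists_window {U : Set (Geodesic T)} (hU : IsOpen U) {ℓ : Geodesic T}
    (hℓ : ℓ ∈ U) : ∃ N : ℕ, ∀ ℓ' : Geodesic T,
      (∀ n : ℤ, n.natAbs ≤ N → ℓ'.toFun n = ℓ.toFun n) → ℓ' ∈ U := by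
  let : TopologicalSpace V := ⊥
  obtain ⟨W, hW, rfl⟩ := isOpen_induced_iff.1 hU
  obtain ⟨I, u, h1, h2⟩ := isOpen_pi_iff.1 hW _ hℓ
  refine ⟨I.sup Int.natAbs, fun ℓ' h => h2 fun i hi => ?_⟩
  change ℓ'.toFun i ∈ u i
  rw [h i (Finset.le_sup (f := Int.natAbs) hi)]
  exact (h1 i hi).2

/-- Adjacency and injectivity are closed conditions in the Polish space `V^ℤ`, `V` being countable
and discrete. -/
theorem Geodesic.standardBorelSpace [Countable V] : StandardBorelSpace (Geodesic T) := by
  let : TopologicalSpace V := ⊥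
  have : DiscreteTopology V := ⟨rfl⟩
  have hR : ∀ (a b : ℤ) (R : V → V → Prop), IsClosed {p : ℤ → V | R (p a) (p b)} :=
    fun a b R => IsClosed.preimage (t := {q : V × V | R q.1 q.2})
      (f := fun p : ℤ → V => (p a, p b))
      ((continuous_apply a).prodMk (continuous_apply b)) (isClosed_discrete _)
  have : PolishSpace V := inferInstance
  have hc : IsClosedEmbedding (Geodesic.toFun : Geodesic T → ℤ → V) := by
    refine ⟨⟨⟨rfl⟩, fun a b h => Geodesic.ext' fun n => congrFun h n⟩, ?_⟩
    have : Set.range (Geodesic.toFun : Geodesic T → ℤ → V) =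
        (⋂ n : ℤ, {p | T.Adj (p n) (p (n + 1))}) ∩
          ⋂ a : ℤ, ⋂ b : ℤ, {p | p a = p b → a = b} := by
      ext p
      simp only [Set.mem_range, Set.mem_inter_iff, Set.mem_iInter, Set.mem_ofPred_eq]
      constructor
      · rintro ⟨ℓ, rfl⟩
        exact ⟨ℓ.adj, fun a b h => ℓ.inj h⟩
      · rintro ⟨h1, h2⟩
        exact ⟨⟨p, h1, fun a b h => h2 a b h⟩, rfl⟩
    rw [this]
    exact (isClosed_iInter fun n => hR n (n + 1) T.Adj).inter
      (isClosed_iInter fun a => isClosed_iInter fun b => hR a b fun u v => u = v → a = b)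
  have : PolishSpace (Geodesic T) := hc.polishSpace
  infer_instance

theorem Geodesic.measurable_endPlus [Countable V] (hT : T.IsTree) :
    Measurable (Geodesic.endPlus : Geodesic T → Ends T) := by
  refine measurable_of_shadow fun x y => ?_
  have : (Geodesic.endPlus ⁻¹' shadow x y : Set (Geodesic T)) =
      ⋃ N : ℕ, ⋂ n ∈ Set.Ici N, {ℓ : Geodesic T | ℓ.toFun n ∈ {v | Btw T x y v}} := by
    ext ℓ
    change OnRay x ℓ.endPlus y ↔ _
    rw [← ℓ.toEnd_posRay 0, onRay_iff_eventually hT, eventually_atTop]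
    simp [Geodesic.posRay]
  rw [this]
  exact MeasurableSet.iUnion fun N => MeasurableSet.biInter (Set.to_countable _)
    fun n _ => Geodesic.measurableSet_coord _ _

theorem Geodesic.measurable_endMinus [Countable V] (hT : T.IsTree) :
    Measurable (Geodesic.endMinus : Geodesic T → Ends T) := by
  refine measurable_of_shadow fun x y => ?_
  have : (Geodesic.endMinus ⁻¹' shadow x y : Set (Geodesic T)) =
      ⋃ N : ℕ, ⋂ n ∈ Set.Ici N, {ℓ : Geodesic T | ℓ.toFun (-n) ∈ {v | Btw T x y v}} := by
    ext ℓ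
    change OnRay x ℓ.endMinus y ↔ _
    rw [← ℓ.toEnd_negRay 0, onRay_iff_eventually hT, eventually_atTop]
    simp [Geodesic.negRay]
  rw [this]
  exact MeasurableSet.iUnion fun N => MeasurableSet.biInter (Set.to_countable _)
    fun n _ => Geodesic.measurableSet_coord _ _

/-- The pair of ends of a geodesic. -/
def Geodesic.ends (ℓ : Geodesic T) : Ends T × Ends T := (ℓ.endMinus, ℓ.endPlus)

theorem Geodesic.measurable_ends [Countable V] (hT : T.IsTree) :
    Measurable (Geodesic.ends : Geodesic T → _) :=
  (measurable_endMinus hT).prodMk (measurable_endPlus hT)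

theorem Geodesic.measurable_footTime [Countable V] (hT : T.IsTree) (x : V) :
    Measurable (Geodesic.footTime x : Geodesic T → ℤ) := by
  refine measurable_to_countable' fun s => ?_
  have : (Geodesic.footTime x ⁻¹' {s} : Set (Geodesic T)) =
      ⋂ t : ℤ, ⋃ v : V, ({ℓ | ℓ.toFun s = v} ∩
        {ℓ | ℓ.toFun t ∈ {w | T.dist x v ≤ T.dist x w}}) := by
    ext ℓ
    rw [Set.mem_preimage, Set.mem_singleton_iff, ℓ.footTime_eq_iff hT]
    simp
  rw [this]
  exact MeasurableSet.iInter fun t => MeasurableSet.iUnion fun v =>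
    (measurableSet_coord_eq s v).inter (measurableSet_coord t _)

theorem countablySeparated_of_t0 [Countable V] (hT : T.IsTree) {X : Type*} [TopologicalSpace X]
    [T0Space X] [SecondCountableTopology X] [MeasurableSpace X] [OpensMeasurableSpace X] :
    MeasurableSpace.CountablySeparated ((Ends T × Ends T) × X) := by
  have := t0Space_ends hT
  infer_instance

/-- Being an embedding is what allows `Measure.comap` in `bowenMargulisUp` to be evaluated on
images. Equal ends mean equality up to a translation, and the foot time fixes the translation;
measurability of images is the Lusin–Souslin theorem. -/
theorem Geodesic.measurableEmbedding_hopf [Countable V] (hT : T.IsTree) (x : V) :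
    MeasurableEmbedding (Geodesic.hopf x : Geodesic T → _) := by
  have := standardBorelSpace (T := T)
  have := countablySeparated_of_t0 hT (X := ℤ)
  refine Measurable.measurableEmbedding
    ((measurable_ends hT).prodMk (measurable_footTime hT x)) fun ℓ ℓ' h => ?_
  have h1 : ℓ.endMinus = ℓ'.endMinus := congrArg (fun p => p.1.1) h
  have h2 : ℓ.endPlus = ℓ'.endPlus := congrArg (fun p => p.1.2) h
  have h3 : ℓ.footTime x = ℓ'.footTime x := congrArg (fun p => p.2) h
  obtain ⟨c, rfl⟩ := exists_shift_eq hT h1 h2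
  rw [footTime_shift hT] at h3
  have : c = 0 := by omega
  subst this
  ext n
  simp [shift]

theorem Geodesic.injOn_ends (hT : T.IsTree) (y : V) :
    Set.InjOn (Geodesic.ends : Geodesic T → _) {ℓ | ℓ.toFun 0 = y} := by
  intro ℓ hℓ ℓ' hℓ' h
  exact eq_of_ends_eq hT (congrArg Prod.fst h) (congrArg Prod.snd h)
    (hℓ.trans (Eq.symm hℓ'))

theorem Geodesic.measurableSet_image_ends [Countable V] (hT : T.IsTree) {y : V}
    {S : Set (Geodesic T)} (hS : MeasurableSet S) (hy : ∀ ℓ ∈ S, ℓ.toFun 0 = y) :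
    MeasurableSet (Geodesic.ends '' S) := by
  have := standardBorelSpace (T := T)
  have := t0Space_ends hT
  exact hS.image_of_measurable_injOn (measurable_ends hT) ((injOn_ends hT y).mono hy)

/-- The pairs of ends of the geodesics through `y`. -/
def endsThrough (T : SimpleGraph V) (y : V) : Set (Ends T × Ends T) :=
  Geodesic.ends '' {ℓ | ℓ.toFun 0 = y}

theorem measurableSet_endsThrough [Countable V] (hT : T.IsTree) (y : V) :
    MeasurableSet (endsThrough T y) :=
  Geodesic.measurableSet_image_ends hT (Geodesic.measurableSet_coord_eq 0 y) fun _ h => h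

end GeodesicTopology

/-! ### Product formula for the Bowen–Margulis measure. -/

section BowenMargulisMeasure

variable {V : Type*} {T : SimpleGraph V} {Γ : Subgroup (T ≃g T)} {δ : ℝ} {μ : V → Measure (Ends T)}

/-- The two Busemann functions at `ℓ(k)` add up to twice the distance from `x` to its foot, since
the foot time and `k` enter with opposite signs; that distance is also the common length defining
the visual distance. -/
theorem visualDist_rpow_mul (hT : T.IsTree) (ℓ : Geodesic T) (x : V) (k : ℤ) :
    visualDist x ℓ.endMinus ℓ.endPlus ^ (-(2 * δ)) =
      Real.exp (δ * (busemann ℓ.endMinus x (ℓ.toFun k) + busemann ℓ.endPlus x (ℓ.toFun k))) := by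
  rw [visualDist, if_neg (ℓ.endMinus_ne_endPlus hT), ℓ.commonLength_eq hT,
    ℓ.busemann_endMinus hT, ℓ.busemann_endPlus hT, ← Real.exp_mul]
  congr 1
  ring

/-- Given the two ends, at most one parametrised geodesic is at `y` at time `k`, so the fibre over a
pair of ends is a point or empty. -/
theorem count_hopf_section (hT : T.IsTree) (x y : V) (k : ℤ) (C : Set (Ends T × Ends T))
    (p : Ends T × Ends T) :
    Measure.count (Prod.mk p ⁻¹' (Geodesic.hopf x '' {ℓ | ℓ.toFun k = y ∧ ℓ.ends ∈ C})) =
      (C ∩ endsThrough T y).indicator (1 : Ends T × Ends T → ℝ≥0∞) p := by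
  by_cases hp : p ∈ C ∩ endsThrough T y
  · rw [Set.indicator_of_mem hp]
    obtain ⟨hpC, ℓ, hℓ, rfl⟩ := hp
    have : Prod.mk ℓ.ends ⁻¹' (Geodesic.hopf x '' {ℓ | ℓ.toFun k = y ∧ ℓ.ends ∈ C}) =
        {(ℓ.shift (-k)).footTime x} := by
      ext t
      simp only [Set.mem_preimage, Set.mem_image, Set.mem_singleton_iff]
      constructor
      · rintro ⟨ℓ', ⟨h1, -⟩, h2⟩
        have h3 : ℓ'.ends = ℓ.ends := congrArg Prod.fst h2
        have h4 : ℓ'.footTime x = t := congrArg Prod.snd h2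
        rw [← h4]
        congr 1
        refine Geodesic.eq_of_ends_eq hT (k := k) ?_ ?_ ?_
        · rw [Geodesic.endMinus_shift]; exact congrArg Prod.fst h3
        · rw [Geodesic.endPlus_shift]; exact congrArg Prod.snd h3
        · rw [h1]
          change y = ℓ.toFun (k + -k)
          rw [add_neg_cancel]
          exact hℓ.symm
      · rintro rfl
        have h3 : (ℓ.shift (-k)).ends = ℓ.ends :=
          Prod.ext (ℓ.endMinus_shift _) (ℓ.endPlus_shift _)
        refine ⟨ℓ.shift (-k), ⟨?_, by rw [h3]; exact hpC⟩, Prod.ext h3 rfl⟩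
        change ℓ.toFun (k + -k) = y
        rw [add_neg_cancel]
        exact hℓ
    rw [this, Measure.count_singleton, Pi.one_apply]
  · rw [Set.indicator_of_notMem hp, Measure.count_eq_zero_iff, Set.eq_empty_iff_forall_notMem]
    rintro t ⟨ℓ, ⟨h1, h2⟩, h3⟩
    have h4 : ℓ.ends = p := congrArg Prod.fst h3
    refine hp ⟨h4 ▸ h2, ℓ.shift k, ?_, ?_⟩
    · change ℓ.toFun (0 + k) = y
      rw [zero_add, h1]
    · rw [← h4]
      exact Prod.ext (ℓ.endMinus_shift _) (ℓ.endPlus_shift _)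

theorem setLIntegral_prod_withDensity {E : Type*} [MeasurableSpace E] {ν : Measure E}
    [IsFiniteMeasure ν] {f : E → ℝ≥0∞} {g : E × E → ℝ≥0∞} (hf : Measurable f)
    (hg : Measurable g) (h : ∀ p : E × E, f p.1 * f p.2 * g p = 1) {C : Set (E × E)}
    (hC : MeasurableSet C) :
    ∫⁻ p in C, g p ∂(ν.withDensity f).prod (ν.withDensity f) = (ν.prod ν) C := by
  have hF : Measurable fun p : E × E => f p.1 * f p.2 :=
    (hf.comp measurable_fst).mul (hf.comp measurable_snd)
  rw [prod_withDensity hf hf, setLIntegral_withDensity_eq_setLIntegral_mul _ hF hg hC,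
    ← setLIntegral_one]
  exact lintegral_congr fun p => h p

/-- After integrating out the counting measure, both factors are rewritten from base point `x` to
base point `y`; the two conformal densities are inverse to the visual-distance density by
`visualDist_rpow_mul`. The result depends neither on `x` nor on `k`. -/
theorem bowenMargulisUp_coord [Countable V] (hT : T.IsTree) (hμ : IsPattersonSullivan Γ δ μ)
    (x y : V) (k : ℤ) {C : Set (Ends T × Ends T)} (hC : MeasurableSet C) :
    bowenMargulisUp δ μ x {ℓ | ℓ.toFun k = y ∧ ℓ.ends ∈ C} =
      (μ y).prod (μ y) (C ∩ endsThrough T y) := by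
  have := hμ.finite
  have hS : MeasurableSet {ℓ : Geodesic T | ℓ.toFun k = y ∧ ℓ.ends ∈ C} :=
    (Geodesic.measurableSet_coord_eq k y).inter (Geodesic.measurable_ends hT hC)
  have hE := Geodesic.measurableEmbedding_hopf hT x (T := T)
  have hCy := hC.inter (measurableSet_endsThrough hT y)
  rw [bowenMargulisUp, hE.comap_apply, Measure.prod_apply (hE.measurableSet_image.2 hS)]
  simp only [count_hopf_section hT]
  rw [lintegral_indicator_one hCy, withDensity_apply _ hCy]
  have hb : Measurable fun ξ : Ends T => busemann ξ x y := measurable_busemann hT x y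
  set f : Ends T → ℝ≥0∞ := fun ξ => ENNReal.ofReal (Real.exp (-δ * busemann ξ x y)) with hf
  have hfm : Measurable f := (Real.measurable_exp.comp (hb.const_mul _)).ennreal_ofReal
  set g : Ends T × Ends T → ℝ≥0∞ := fun p =>
    ENNReal.ofReal (Real.exp (δ * (busemann p.1 x y + busemann p.2 x y))) with hg
  have hgm : Measurable g := (Real.measurable_exp.comp
    (((hb.comp measurable_fst).add (hb.comp measurable_snd)).const_mul _)).ennreal_ofReal
  have h1 : ∫⁻ p in C ∩ endsThrough T y, ENNReal.ofReal (visualDist x p.1 p.2 ^ (-(2 * δ)))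
      ∂(μ x).prod (μ x) = ∫⁻ p in C ∩ endsThrough T y, g p ∂(μ x).prod (μ x) := by
    refine setLIntegral_congr_fun hCy ?_
    rintro p ⟨-, ℓ, hℓ, rfl⟩
    have h0 : ℓ.toFun 0 = y := hℓ
    have := visualDist_rpow_mul (δ := δ) hT ℓ x 0
    rw [h0] at this
    simp only [hg]
    exact congrArg _ this
  have h2 : μ x = (μ y).withDensity f := hμ.conformal x y
  have h3 := setLIntegral_prod_withDensity (ν := μ y) hfm hgm (fun p => ?_) hCy
  · rw [h1, h2, h3]
  · simp only [hf, hg]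
    rw [← ENNReal.ofReal_mul (Real.exp_nonneg _), ← Real.exp_add,
      ← ENNReal.ofReal_mul (Real.exp_nonneg _), ← Real.exp_add,
      show -δ * busemann p.1 x y + -δ * busemann p.2 x y +
        δ * (busemann p.1 x y + busemann p.2 x y) = 0 by ring, Real.exp_zero, ENNReal.ofReal_one]

end BowenMargulisMeasure

/-! ### Invariance, independence of past and future, positivity on open sets. -/

section BowenMargulisProperties

variable {V : Type*} {T : SimpleGraph V} {Γ : Subgroup (T ≃g T)} {δ : ℝ} {μ : V → Measure (Ends T)}

theorem eq_setOf_ends (hT : T.IsTree) {y : V} {S : Set (Geodesic T)}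
    (hy : ∀ ℓ ∈ S, ℓ.toFun 0 = y) :
    S = {ℓ | ℓ.toFun 0 = y ∧ ℓ.ends ∈ Geodesic.ends '' S} := by
  ext ℓ
  constructor
  · exact fun h => ⟨hy ℓ h, ℓ, h, rfl⟩
  · rintro ⟨h0, ℓ', h', he⟩
    rwa [← Geodesic.injOn_ends hT y (hy ℓ' h') h0 he]

theorem bowenMargulisUp_eq_prod [Countable V] (hT : T.IsTree) (hμ : IsPattersonSullivan Γ δ μ)
    (x : V) {y : V} {S : Set (Geodesic T)} (hS : MeasurableSet S) (hy : ∀ ℓ ∈ S, ℓ.toFun 0 = y) :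
    bowenMargulisUp δ μ x S = (μ y).prod (μ y) (Geodesic.ends '' S) := by
  conv_lhs => rw [eq_setOf_ends hT hy]
  rw [bowenMargulisUp_coord hT hμ x y 0 (Geodesic.measurableSet_image_ends hT hS hy),
    Set.inter_eq_left.2 (show _ ⊆ endsThrough T y from Set.image_mono hy)]

theorem geodesic_measure_ext [Countable V] {m m' : Measure (Geodesic T)}
    (h : ∀ (y : V) (S : Set (Geodesic T)), MeasurableSet S → (∀ ℓ ∈ S, ℓ.toFun 0 = y) →
      m S = m' S) : m = m' := by
  ext S hS
  have hS' : S = ⋃ y : V, S ∩ {ℓ | ℓ.toFun 0 = y} := by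
    ext ℓ; simp
  have hm : ∀ y : V, MeasurableSet (S ∩ {ℓ : Geodesic T | ℓ.toFun 0 = y}) := fun y =>
    hS.inter (Geodesic.measurableSet_coord_eq 0 y)
  have hd : Pairwise (Function.onFun Disjoint fun y : V => S ∩ {ℓ : Geodesic T | ℓ.toFun 0 = y}) :=
    fun y z hyz => Set.disjoint_left.2 fun ℓ h1 h2 => hyz (h1.2.symm.trans h2.2)
  rw [hS', measure_iUnion hd hm, measure_iUnion hd hm]
  exact tsum_congr fun y => h y _ (hm y) fun ℓ h => h.2

/-- The right-hand side of `bowenMargulisUp_coord` does not involve the time `k`. -/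
theorem bowenMargulisUp_shift [Countable V] (hT : T.IsTree) (hμ : IsPattersonSullivan Γ δ μ)
    (x : V) (k : ℤ) :
    (bowenMargulisUp δ μ x).map (Geodesic.shift k) = bowenMargulisUp δ μ x := by
  refine geodesic_measure_ext fun y S hS hy => ?_
  have hR := Geodesic.measurableSet_image_ends hT hS hy
  rw [Measure.map_apply (Geodesic.continuous_shift k).measurable hS]
  have : Geodesic.shift k ⁻¹' S = {ℓ | ℓ.toFun k = y ∧ ℓ.ends ∈ Geodesic.ends '' S} := by
    conv_lhs => rw [eq_setOf_ends hT hy]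
    ext ℓ
    change ℓ.toFun (0 + k) = y ∧ (ℓ.shift k).ends ∈ _ ↔ _
    rw [zero_add, show (ℓ.shift k).ends = ℓ.ends from
      Prod.ext (ℓ.endMinus_shift _) (ℓ.endPlus_shift _)]
    rfl
  rw [this, bowenMargulisUp_coord hT hμ x y k hR]
  conv_rhs => rw [eq_setOf_ends hT hy, bowenMargulisUp_coord hT hμ x y 0 hR]

theorem Geodesic.ends_smul (γ : Γ) (ℓ : Geodesic T) :
    (γ • ℓ).ends = Prod.map (γ • ·) (γ • ·) ℓ.ends := rfl

theorem measurable_smul_ends (γ : Γ) : Measurable fun ξ : Ends T => γ • ξ :=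
  (continuous_smul_ends γ).borel_measurable

theorem bowenMargulisUp_map_smul [Countable V] (hT : T.IsTree) (hμ : IsPattersonSullivan Γ δ μ)
    (x : V) (γ : Γ) :
    (bowenMargulisUp δ μ x).map (fun ℓ => γ • ℓ) = bowenMargulisUp δ μ x := by
  have := hμ.finite
  refine geodesic_measure_ext fun y S hS hy => ?_
  have hm : Measurable fun ℓ : Geodesic T => γ • ℓ := (Geodesic.continuous_smul γ).measurable
  have hy' : ∀ ℓ ∈ (fun ℓ : Geodesic T => γ • ℓ) ⁻¹' S, ℓ.toFun 0 = γ⁻¹ • y := fun ℓ h =>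
    eq_inv_smul_iff.2 (hy _ h)
  rw [Measure.map_apply hm hS, bowenMargulisUp_eq_prod hT hμ x (hm hS) hy',
    bowenMargulisUp_eq_prod hT hμ x hS hy]
  have h1 : Geodesic.ends '' ((fun ℓ : Geodesic T => γ • ℓ) ⁻¹' S) =
      Prod.map (fun ξ : Ends T => γ • ξ) (fun ξ : Ends T => γ • ξ) ⁻¹' (Geodesic.ends '' S) := by
    ext p
    constructor
    · rintro ⟨ℓ, h, rfl⟩
      exact ⟨_, h, rfl⟩
    · rintro ⟨ℓ, h, he⟩
      refine ⟨γ⁻¹ • ℓ, by simpa using h, ?_⟩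
      rw [Geodesic.ends_smul, he]
      ext <;> simp
  have h2 : μ y = (μ (γ⁻¹ • y)).map fun ξ => γ • ξ := by
    rw [hμ.equivariant, smul_inv_smul]
  rw [h1, h2, Measure.map_prod_map _ _ (measurable_smul_ends γ) (measurable_smul_ends γ),
    Measure.map_apply ((measurable_smul_ends γ).prodMap (measurable_smul_ends γ))
      (Geodesic.measurableSet_image_ends hT hS hy)]

theorem smulInvariant_bowenMargulisUp [Countable V] (hT : T.IsTree)
    (hμ : IsPattersonSullivan Γ δ μ) (x : V) :
    SMulInvariantMeasure Γ (Geodesic T) (bowenMargulisUp δ μ x) := by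
  refine ⟨fun γ S hS => ?_⟩
  rw [← Measure.map_apply (Geodesic.continuous_smul γ).measurable hS,
    bowenMargulisUp_map_smul hT hμ]

theorem Geodesic.endPlus_congr {ℓ ℓ' : Geodesic T} (h : ∀ n, 0 ≤ n → ℓ.toFun n = ℓ'.toFun n) :
    ℓ.endPlus = ℓ'.endPlus :=
  Quotient.sound ⟨0, 0, fun k => h _ (by omega)⟩

theorem Geodesic.endMinus_congr {ℓ ℓ' : Geodesic T} (h : ∀ n, n ≤ 1 → ℓ.toFun n = ℓ'.toFun n) :
    ℓ.endMinus = ℓ'.endMinus :=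
  Quotient.sound ⟨0, 0, fun k => h _ (by omega)⟩

theorem Geodesic.exists_glue (hT : T.IsTree) (ℓ ℓ' : Geodesic T) (h0 : ℓ.toFun 0 = ℓ'.toFun 0)
    (h1 : ℓ.toFun 1 = ℓ'.toFun 1) : ∃ ℓ'' : Geodesic T,
      (∀ n ≤ 1, ℓ''.toFun n = ℓ.toFun n) ∧ ∀ n, 0 ≤ n → ℓ''.toFun n = ℓ'.toFun n := by
  -- Agreement at time `1`, and not only at time `0`, is what rules out backtracking at the gluing
  -- vertex.
  obtain ⟨ℓ'', h⟩ := exists_geodesic_of_rays hT (ℓ.negRay 0) (ℓ'.posRay 0)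
    (by simpa [negRay, posRay] using h0) (by
      simp only [negRay, posRay, Nat.cast_one, zero_add, ← h1, zero_sub]
      exact fun h => by have := ℓ.inj h; omega)
  simp only [negRay, posRay, zero_add, zero_sub] at h
  have hp : ∀ n, 0 ≤ n → ℓ''.toFun n = ℓ'.toFun n := fun n hn => by
    obtain ⟨k, rfl⟩ := Int.eq_ofNat_of_zero_le hn
    exact (h k).1
  refine ⟨ℓ'', fun n hn => ?_, hp⟩
  rcases eq_or_ne n 1 with rfl | hn1
  · rw [hp 1 (by omega), h1]
  · have := (h (-n).toNat).2
    rwa [show -((-n).toNat : ℤ) = n by omega] at this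

/-- A set of geodesics with prescribed edge at time `0` which, in terms of the pairs of ends, is a
product of a condition on the past and a condition on the future. -/
structure IsRect (C : Set (Geodesic T)) : Prop where
  zero : ∀ ℓ ∈ C, ∀ ℓ' ∈ C, ℓ.toFun 0 = ℓ'.toFun 0
  one : ∀ ℓ ∈ C, ∀ ℓ' ∈ C, ℓ.toFun 1 = ℓ'.toFun 1
  glue : ∀ ℓ ∈ C, ∀ ℓ' ∈ C, ∀ ℓ'' : Geodesic T, (∀ n ≤ 1, ℓ''.toFun n = ℓ.toFun n) →
    (∀ n, 0 ≤ n → ℓ''.toFun n = ℓ'.toFun n) → ℓ'' ∈ C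

/-- Gluing pasts to futures shows that, as sets of pairs of ends, `C` is `P × Q`, the future event
`S₁` is `P × Q₁` and the past event `S₂` is `P₂ × Q`. For a product measure both sides equal `μ(P₂)
μ(Q₁) μ(P) μ(Q)`. The product form avoids conditional probabilities. -/
theorem IsRect.independence [Countable V] (hT : T.IsTree) (hμ : IsPattersonSullivan Γ δ μ) (x : V)
    {C S₁ S₂ : Set (Geodesic T)} (hC : IsRect C) (hCm : MeasurableSet C)
    (hm₁ : MeasurableSet S₁) (hm₂ : MeasurableSet S₂) (hs₁ : S₁ ⊆ C) (hs₂ : S₂ ⊆ C)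
    (hfut : ∀ ℓ ∈ S₁, ∀ ℓ' ∈ C, (∀ n, 0 ≤ n → ℓ'.toFun n = ℓ.toFun n) → ℓ' ∈ S₁)
    (hpast : ∀ ℓ ∈ S₂, ∀ ℓ' ∈ C, (∀ n ≤ 1, ℓ'.toFun n = ℓ.toFun n) → ℓ' ∈ S₂) :
    bowenMargulisUp δ μ x (S₂ ∩ S₁) * bowenMargulisUp δ μ x C =
      bowenMargulisUp δ μ x S₂ * bowenMargulisUp δ μ x S₁ := by
  have := hμ.finite
  rcases C.eq_empty_or_nonempty with rfl | ⟨ℓ₀, h₀⟩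
  · rw [Set.subset_empty_iff.1 hs₁, Set.subset_empty_iff.1 hs₂]
    simp
  have hy : ∀ ℓ ∈ C, ℓ.toFun 0 = ℓ₀.toFun 0 := fun ℓ h => hC.zero ℓ h ℓ₀ h₀
  have glue : ∀ ℓ ∈ C, ∀ ℓ' ∈ C, ∃ ℓ'' ∈ C, ℓ''.ends = (ℓ.endMinus, ℓ'.endPlus) ∧
      (∀ n ≤ 1, ℓ''.toFun n = ℓ.toFun n) ∧ ∀ n, 0 ≤ n → ℓ''.toFun n = ℓ'.toFun n := by
    intro ℓ h ℓ' h'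
    obtain ⟨ℓ'', h1, h2⟩ := Geodesic.exists_glue hT ℓ ℓ' (hC.zero ℓ h ℓ' h') (hC.one ℓ h ℓ' h')
    exact ⟨ℓ'', hC.glue ℓ h ℓ' h' ℓ'' h1 h2, Prod.ext (Geodesic.endMinus_congr h1)
      (Geodesic.endPlus_congr h2), h1, h2⟩
  -- The factors are the slices through the pair of ends of a reference geodesic `ℓ₀`.
  set P := {ξ | (ξ, ℓ₀.endPlus) ∈ Geodesic.ends '' C} with hP
  set Q := {η | (ℓ₀.endMinus, η) ∈ Geodesic.ends '' C} with hQ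
  set Q₁ := {η | (ℓ₀.endMinus, η) ∈ Geodesic.ends '' S₁} with hQ₁
  set P₂ := {ξ | (ξ, ℓ₀.endPlus) ∈ Geodesic.ends '' S₂} with hP₂
  have e0 : Geodesic.ends '' C = P ×ˢ Q := by
    ext ⟨ξ, η⟩
    constructor
    · rintro ⟨ℓ, h, he⟩
      obtain ⟨rfl, rfl⟩ := Prod.ext_iff.1 he
      obtain ⟨a, ha, ha', -⟩ := glue ℓ h ℓ₀ h₀
      obtain ⟨b, hb, hb', -⟩ := glue ℓ₀ h₀ ℓ h
      exact ⟨⟨a, ha, ha'⟩, ⟨b, hb, hb'⟩⟩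
    · rintro ⟨⟨a, ha, ha'⟩, ⟨b, hb, hb'⟩⟩
      obtain ⟨c, hc, hc', -⟩ := glue a ha b hb
      exact ⟨c, hc, hc'.trans (Prod.ext (Prod.ext_iff.1 ha').1 (Prod.ext_iff.1 hb').2)⟩
  have e1 : Geodesic.ends '' S₁ = P ×ˢ Q₁ := by
    ext ⟨ξ, η⟩
    constructor
    · rintro ⟨ℓ, h, he⟩
      obtain ⟨rfl, rfl⟩ := Prod.ext_iff.1 he
      obtain ⟨a, ha, ha', -⟩ := glue ℓ (hs₁ h) ℓ₀ h₀
      obtain ⟨b, hb, hb', -, hb''⟩ := glue ℓ₀ h₀ ℓ (hs₁ h)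
      exact ⟨⟨a, ha, ha'⟩, ⟨b, hfut ℓ h b hb hb'', hb'⟩⟩
    · rintro ⟨⟨a, ha, ha'⟩, ⟨b, hb, hb'⟩⟩
      obtain ⟨c, hc, hc', -, hc''⟩ := glue a ha b (hs₁ hb)
      exact ⟨c, hfut b hb c hc hc'',
        hc'.trans (Prod.ext (Prod.ext_iff.1 ha').1 (Prod.ext_iff.1 hb').2)⟩
  have e2 : Geodesic.ends '' S₂ = P₂ ×ˢ Q := by
    ext ⟨ξ, η⟩
    constructor
    · rintro ⟨ℓ, h, he⟩
      obtain ⟨rfl, rfl⟩ := Prod.ext_iff.1 he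
      obtain ⟨a, ha, ha', ha'', -⟩ := glue ℓ (hs₂ h) ℓ₀ h₀
      obtain ⟨b, hb, hb', -⟩ := glue ℓ₀ h₀ ℓ (hs₂ h)
      exact ⟨⟨a, hpast ℓ h a ha ha'', ha'⟩, ⟨b, hb, hb'⟩⟩
    · rintro ⟨⟨a, ha, ha'⟩, ⟨b, hb, hb'⟩⟩
      obtain ⟨c, hc, hc', hc'', -⟩ := glue a (hs₂ ha) b hb
      exact ⟨c, hpast a ha c hc hc'',
        hc'.trans (Prod.ext (Prod.ext_iff.1 ha').1 (Prod.ext_iff.1 hb').2)⟩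
  have hPP : P₂ ⊆ P := fun ξ h => Set.image_mono hs₂ h
  have hQQ : Q₁ ⊆ Q := fun ξ h => Set.image_mono hs₁ h
  have e3 : Geodesic.ends '' (S₂ ∩ S₁) = P₂ ×ˢ Q₁ := by
    rw [((Geodesic.injOn_ends hT (ℓ₀.toFun 0)).mono hy).image_inter hs₂ hs₁, e1, e2,
      Set.prod_inter_prod, Set.inter_eq_left.2 hPP, Set.inter_eq_right.2 hQQ]
  rw [bowenMargulisUp_eq_prod hT hμ x (hm₂.inter hm₁) fun ℓ h => hy ℓ (hs₁ h.2),
    bowenMargulisUp_eq_prod hT hμ x hm₂ fun ℓ h => hy ℓ (hs₂ h),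
    bowenMargulisUp_eq_prod hT hμ x hm₁ fun ℓ h => hy ℓ (hs₁ h),
    bowenMargulisUp_eq_prod hT hμ x hCm hy, e0, e1, e2, e3]
  simp only [Measure.prod_prod]
  ring

theorem IsPattersonSullivan.pos_of_isOpen (hμ : IsPattersonSullivan Γ δ μ) (y : V)
    {U : Set (Ends T)} (hU : IsOpen U) (hne : U.Nonempty) : 0 < μ y U := by
  obtain ⟨ξ, hξ⟩ := hne
  have h : ξ ∈ (μ y).support := by rw [hμ.support_eq]; trivial
  exact (Measure.mem_support_iff_forall _).1 h U (hU.mem_nhds hξ)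

theorem prod_shadow_subset_endsThrough (hT : T.IsTree) {y u w : V} (hu : T.Adj y u)
    (hw : T.Adj y w) (huw : u ≠ w) :
    (shadow y u ×ˢ shadow y w : Set (Ends T × Ends T)) ⊆ endsThrough T y := by
  rintro ⟨ξ, η⟩ ⟨h1, h2⟩
  obtain ⟨r, rfl, rfl⟩ := exists_ray_from hT y ξ
  obtain ⟨r', h0, rfl⟩ := exists_ray_from hT (r.toFun 0) η
  have e1 := OnRay.eq_of_dist hT (k := 1) h1 (SimpleGraph.dist_eq_one_iff_adj.2 hu)
  have e2 := OnRay.eq_of_dist hT (r := r') (k := 1) (y := w) (by rw [h0]; exact h2)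
    (by rw [h0]; exact SimpleGraph.dist_eq_one_iff_adj.2 hw)
  obtain ⟨ℓ, hℓ⟩ := exists_geodesic_of_rays hT r r' h0.symm (by rw [← e1, ← e2]; exact huw)
  refine ⟨ℓ, by simpa [h0] using (hℓ 0).1, ?_⟩
  refine Prod.ext ?_ ?_
  · exact Quotient.sound ⟨0, 0, fun k => (hℓ _).2⟩
  · exact Quotient.sound ⟨0, 0, fun k => (hℓ _).1⟩

theorem shadow_subset_shadow (hT : T.IsTree) (r : Ray T) {a b : ℕ} (hab : a ≤ b) :
    (shadow (r.toFun 0) (r.toFun b) : Set (Ends T)) ⊆ shadow (r.toFun 0) (r.toFun a) := by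
  rintro ξ ⟨r', h0, rfl, n, hn⟩
  have hnb : n = b := by
    have := congrArg (T.dist (r.toFun 0)) hn
    rw [r.dist_zero hT, ← h0, r'.dist_zero hT] at this
    exact this
  subst hnb
  refine ⟨r', h0, rfl, a, ?_⟩
  have hb := r.btw hT (Nat.zero_le a) hab
  have hb' := r'.btw hT (Nat.zero_le a) hab
  rw [h0, hn] at hb'
  refine Btw.unique hT hb' hb ?_
  rw [r.dist_zero hT, ← h0, r'.dist_zero hT]

/-- A neighbourhood of `ℓ` contains the geodesics at `ℓ(0)` at time `0` with ends in two deep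
shadows. This set has product measure, positive since the Patterson–Sullivan measures have full
support. -/
theorem bowenMargulisUp_pos_of_isOpen [Countable V] (hT : T.IsTree)
    (hμ : IsPattersonSullivan Γ δ μ) (x : V) {U : Set (Geodesic T)} (hU : IsOpen U)
    (hne : U.Nonempty) : 0 < bowenMargulisUp δ μ x U := by
  have := hμ.finite
  obtain ⟨ℓ, hℓ⟩ := hne
  obtain ⟨N, hN⟩ := Geodesic.exists_window hU hℓ
  set y := ℓ.toFun 0 with hy
  -- Depth `N + 1` is at least `1` even for `N = 0`: the two shadows then leave `y` by different
  -- edges, and all pairs of ends in the product are joined through `y`.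
  set C : Set (Ends T × Ends T) := shadow y (ℓ.toFun (-(N + 1 : ℕ))) ×ˢ
    shadow y (ℓ.toFun (N + 1 : ℕ)) with hC
  have hCo : MeasurableSet C := (measurableSet_shadow _ _).prod (measurableSet_shadow _ _)
  have hneg : ∀ k : ℕ, (ℓ.negRay 0).toFun k = ℓ.toFun (-k) := fun k => by simp [Geodesic.negRay]
  have hpos : ∀ k : ℕ, (ℓ.posRay 0).toFun k = ℓ.toFun k := fun k => by simp [Geodesic.posRay]
  have hsub : {ℓ' : Geodesic T | ℓ'.toFun 0 = y ∧ ℓ'.ends ∈ C} ⊆ U := by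
    rintro ℓ' ⟨h0, h1, h2⟩
    refine hN ℓ' fun n hn => ?_
    have h1' : ∀ k ≤ N + 1, ℓ'.ends.1 ∈ shadow y (ℓ.toFun (-k)) := fun k hk => by
      have := shadow_subset_shadow hT (ℓ.negRay 0) (a := k) (b := N + 1) hk
      simp only [hneg] at this
      exact this (by simpa [← hy] using h1)
    have h2' : ∀ k ≤ N + 1, ℓ'.ends.2 ∈ shadow y (ℓ.toFun k) := fun k hk => by
      have := shadow_subset_shadow hT (ℓ.posRay 0) (a := k) (b := N + 1) hk
      simp only [hpos] at this
      exact this (by simpa [← hy] using h2)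
    rcases le_total 0 n with hn0 | hn0
    · obtain ⟨k, rfl⟩ := Int.eq_ofNat_of_zero_le hn0
      have h3 := h2' k (by simp at hn; omega)
      have h4 := OnRay.eq_of_dist hT (r := ℓ'.posRay 0) (k := k) (y := ℓ.toFun k)
        (by rw [ℓ'.toEnd_posRay]; change OnRay _ ℓ'.endPlus _ at h3; simpa [Geodesic.posRay, h0] using h3)
        (by simpa [Geodesic.posRay, h0, hy] using ℓ.dist_add hT 0 k)
      simpa [Geodesic.posRay] using h4.symm
    · obtain ⟨k, rfl⟩ := Int.exists_eq_neg_ofNat hn0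
      have h3 := h1' k (by simp at hn; omega)
      have h4 := OnRay.eq_of_dist hT (r := ℓ'.negRay 0) (k := k) (y := ℓ.toFun (-k))
        (by rw [ℓ'.toEnd_negRay]; change OnRay _ ℓ'.endMinus _ at h3; simpa [Geodesic.negRay, h0] using h3)
        (by simpa [Geodesic.negRay, h0, hy] using ℓ.dist_eq hT 0 (-k))
      simpa [Geodesic.negRay] using h4.symm
  have hthr : C ⊆ endsThrough T y := by
    have a1 := ℓ.adj 0
    have a2 := ℓ.adj (-1)
    rw [zero_add] at a1
    rw [neg_add_cancel] at a2
    refine (Set.prod_mono ?_ ?_).trans (prod_shadow_subset_endsThrough hT a2.symm a1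
      fun h => by have := ℓ.inj h; omega)
    · have := shadow_subset_shadow hT (ℓ.negRay 0) (a := 1) (b := N + 1) (by omega)
      simpa only [hneg, Nat.cast_zero, neg_zero, Nat.cast_one] using this
    · have := shadow_subset_shadow hT (ℓ.posRay 0) (a := 1) (b := N + 1) (by omega)
      simpa only [hpos, Nat.cast_zero, Nat.cast_one] using this
  refine lt_of_lt_of_le ?_ (measure_mono hsub)
  rw [bowenMargulisUp_coord hT hμ x y 0 hCo, Set.inter_eq_left.2 hthr, Measure.prod_prod]
  refine ENNReal.mul_pos (hμ.pos_of_isOpen y (isOpen_shadow _ _) ⟨ℓ.endMinus, ?_⟩).ne'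
    (hμ.pos_of_isOpen y (isOpen_shadow _ _) ⟨ℓ.endPlus, ?_⟩).ne'
  · have := (ℓ.negRay 0).onRay (N + 1)
    rw [ℓ.toEnd_negRay] at this
    change OnRay _ _ _
    simpa only [hneg, Nat.cast_zero, neg_zero] using this
  · have := (ℓ.posRay 0).onRay (N + 1)
    rw [ℓ.toEnd_posRay] at this
    change OnRay _ _ _
    simpa only [hpos, Nat.cast_zero] using this

end BowenMargulisProperties

/-! ### Measures induced on the quotient. -/

section Induced

variable {V : Type*} {T : SimpleGraph V} {Γ : Subgroup (T ≃g T)}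

theorem countable_of_isDiscreteGroup [Countable V] (hT : T.IsTree) (hdisc : IsDiscreteGroup Γ) :
    Countable Γ := by
  obtain ⟨v⟩ := hT.1.nonempty
  have := hdisc v
  rw [← Set.countable_univ_iff]
  refine Set.Countable.mono (fun γ _ => Set.mem_iUnion.2 ⟨γ • v, rfl⟩)
    (Set.countable_iUnion fun w => ?_) (s₂ := ⋃ w : V, {γ : Γ | γ • v = w})
  by_cases h : ∃ γ₀ : Γ, γ₀ • v = w
  · obtain ⟨γ₀, rfl⟩ := h
    refine ((Set.toFinite (MulAction.stabilizer Γ v : Set Γ)).image (γ₀ * ·)).countable.mono ?_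
    intro γ h
    refine ⟨γ₀⁻¹ * γ, ?_, by simp⟩
    change (γ₀⁻¹ * γ) • v = v
    rw [mul_smul, inv_smul_eq_iff]
    exact h
  · exact Set.Countable.mono (fun γ hγ => (h ⟨γ, hγ⟩).elim) Set.countable_empty

theorem GeodQuot.measurable_proj : Measurable (GeodQuot.proj Γ) := fun _ h => h

/-- Saturated sets meet any two fundamental domains in sets of equal measure, so the domain picked
by `choose` may be replaced by a convenient one. -/
theorem inducedMeasure_eq {G X : Type*} [Group G] [Countable G] [MulAction G X]
    [MeasurableSpace X] [MeasurableConstSMul G X] {m : Measure X} [SMulInvariantMeasure G X m]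
    {F : Set X} (hF : IsFundamentalDomain G F m) :
    inducedMeasure G m = (m.restrict F).map fun x =>
      (Quotient.mk _ x : MulAction.orbitRel.Quotient G X) := by
  have hex : ∃ F : Set X, IsFundamentalDomain G F m := ⟨F, hF⟩
  have hq : Measurable fun x : X => (Quotient.mk _ x : MulAction.orbitRel.Quotient G X) :=
    fun _ h => h
  rw [inducedMeasure, dif_pos hex]
  ext A hA
  rw [Measure.map_apply hq hA, Measure.map_apply hq hA, Measure.restrict_apply (hq hA),
    Measure.restrict_apply (hq hA)]
  refine hex.choose_spec.measure_set_eq hF (hq hA) fun g => ?_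
  ext x
  have : (Quotient.mk _ (g • x) : MulAction.orbitRel.Quotient G X) = Quotient.mk _ x :=
    Quotient.sound ⟨g, rfl⟩
  simp only [Set.mem_preimage, this]

end Induced

/-! ### Edges, reversal and translation of geodesics. -/

section Rays

variable {V : Type*} {T : SimpleGraph V}

theorem Ray.eq_of_eq_at (hT : T.IsTree) {r r' : Ray T} (h0 : r.toFun 0 = r'.toFun 0) {N : ℕ}
    (hN : r.toFun N = r'.toFun N) {k : ℕ} (hk : k ≤ N) : r.toFun k = r'.toFun k := by
  have hb := r.btw hT (Nat.zero_le k) hk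
  have hb' := r'.btw hT (Nat.zero_le k) hk
  rw [← h0, ← hN] at hb'
  refine Btw.unique hT hb hb' ?_
  rw [r.dist_zero hT, h0, r'.dist_zero hT]

/-- The `n`-th edge of a ray. -/
def Ray.edge (r : Ray T) (n : ℕ) : T.Dart := ⟨(r.toFun n, r.toFun (n + 1)), r.adj n⟩

theorem dart_ext {d d' : T.Dart} (h : d.fst = d'.fst) (h' : d.snd = d'.snd) : d = d' :=
  SimpleGraph.Dart.ext _ _ (Prod.ext h h')

theorem Ray.edge_succ_ne (r : Ray T) (n : ℕ) : r.edge (n + 1) ≠ (r.edge n).symm := fun h =>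
  r.nb n (congrArg (fun d : T.Dart => d.snd) h).symm

theorem Geodesic.edge_succ_ne (ℓ : Geodesic T) (n : ℤ) : ℓ.edge (n + 1) ≠ (ℓ.edge n).symm :=
  fun h => by
    have h1 : ℓ.toFun (n + 1 + 1) = ℓ.toFun n := congrArg (fun d : T.Dart => d.snd) h
    have := ℓ.inj h1
    omega

/-- The reversed geodesic; the edge at time `0` is reversed. -/
def Geodesic.rev (ℓ : Geodesic T) : Geodesic T where
  toFun n := ℓ.toFun (1 - n)
  adj n := by
    have := (ℓ.adj (-n)).symm
    rwa [show -n + 1 = 1 - n by ring, show -n = 1 - (n + 1) by ring] at this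
  inj a b h := by have := ℓ.inj h; omega

theorem Geodesic.rev_rev (ℓ : Geodesic T) : ℓ.rev.rev = ℓ := by
  ext n
  simp [rev]

theorem Geodesic.rev_edge (ℓ : Geodesic T) (k : ℤ) : ℓ.rev.edge k = (ℓ.edge (-k)).symm := by
  refine dart_ext ?_ ?_
  · change ℓ.toFun (1 - k) = ℓ.toFun (-k + 1)
    rw [neg_add_eq_sub]
  · change ℓ.toFun (1 - (k + 1)) = ℓ.toFun (-k)
    congr 1
    ring

theorem Geodesic.rev_shift (ℓ : Geodesic T) (k : ℤ) : (ℓ.shift k).rev = ℓ.rev.shift (-k) := by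
  ext n
  change ℓ.toFun (1 - n + k) = ℓ.toFun (1 - (n + -k))
  congr 1
  ring

theorem Geodesic.shift_edge (ℓ : Geodesic T) (k n : ℤ) :
    (ℓ.shift k).edge n = ℓ.edge (n + k) := by
  refine dart_ext rfl ?_
  change ℓ.toFun (n + 1 + k) = ℓ.toFun (n + k + 1)
  congr 1
  ring

theorem Geodesic.shift_shift (ℓ : Geodesic T) (a b : ℤ) :
    (ℓ.shift a).shift b = ℓ.shift (a + b) := by
  ext n
  change ℓ.toFun (n + b + a) = ℓ.toFun (n + (a + b))
  congr 1
  ring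

theorem Geodesic.shift_zero (ℓ : Geodesic T) : ℓ.shift 0 = ℓ := by
  ext n
  simp [shift]

variable {Γ : Subgroup (T ≃g T)}

theorem Geodesic.rev_smul (γ : Γ) (ℓ : Geodesic T) : (γ • ℓ).rev = γ • ℓ.rev := rfl

theorem Geodesic.smul_edge (γ : Γ) (ℓ : Geodesic T) (k : ℤ) :
    (γ • ℓ).edge k = γ • ℓ.edge k := rfl

theorem smul_dart_symm (γ : Γ) (d : T.Dart) : (γ • d).symm = γ • d.symm := rfl

end Rays

/-! ### The quotient graph of groups and the rigidity of cusps. -/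

section Quotients

variable {V : Type*} {T : SimpleGraph V} (Γ : Subgroup (T ≃g T))

/-- The image in `X` of an edge of `T`. -/
def qe (d : T.Dart) : QEdge Γ := Quotient.mk _ d

/-- The image in `X` of a vertex of `T`. -/
def qv (v : V) : QVert Γ := Quotient.mk _ v

variable {Γ}

theorem qe_eq_iff {d d' : T.Dart} : qe Γ d = qe Γ d' ↔ ∃ γ : Γ, γ • d' = d :=
  ⟨fun h => Quotient.exact h, fun h => Quotient.sound h⟩

theorem qv_eq_iff {v v' : V} : qv Γ v = qv Γ v' ↔ ∃ γ : Γ, γ • v' = v :=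
  ⟨fun h => Quotient.exact h, fun h => Quotient.sound h⟩

@[simp] theorem qe_smul (γ : Γ) (d : T.Dart) : qe Γ (γ • d) = qe Γ d := qe_eq_iff.2 ⟨γ, rfl⟩

@[simp] theorem qv_smul (γ : Γ) (v : V) : qv Γ (γ • v) = qv Γ v := qv_eq_iff.2 ⟨γ, rfl⟩

theorem qe_symm (d : T.Dart) : qe Γ d.symm = (qe Γ d).rev := rfl

theorem qe_o (d : T.Dart) : (qe Γ d).o = qv Γ d.fst := rfl

theorem qe_t (d : T.Dart) : (qe Γ d).t = qv Γ d.snd := rfl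

@[simp] theorem QEdge.rev_rev (e : QEdge Γ) : e.rev.rev = e := by
  induction e using Quotient.inductionOn with
  | _ d => change qe Γ d.symm.symm = qe Γ d; rw [SimpleGraph.Dart.symm_symm]

@[simp] theorem QEdge.rev_o (e : QEdge Γ) : e.rev.o = e.t := rfl

@[simp] theorem QEdge.rev_t (e : QEdge Γ) : e.rev.t = e.o := by rw [QEdge.t, QEdge.rev_rev]

theorem QEdge.rev_inj {e f : QEdge Γ} : e.rev = f.rev ↔ e = f :=
  ⟨fun h => by rw [← e.rev_rev, h, f.rev_rev], fun h => h ▸ rfl⟩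

namespace CuspDecomposition

variable (D : CuspDecomposition Γ)

theorem a_inj {i j : Fin D.r} {n m : ℕ} (h : D.a i n = D.a j m) : i = j ∧ n = m := by
  have := D.embedded i j n (m + 1) (by rw [← D.consecutive, ← D.consecutive, h])
  exact ⟨this.1, by omega⟩

/-- Comparing origins and termini would force both `m + 1 = n` and `n + 1 = m`. -/
theorem a_ne_rev (i j : Fin D.r) (n m : ℕ) : D.a i n ≠ (D.a j m).rev := by
  intro h
  have h1 := D.embedded j i m n (by rw [← D.consecutive, h, QEdge.rev_o])
  have h2 := D.embedded i j n m (by rw [← D.consecutive, h, QEdge.rev_t])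
  omega

theorem o_zero_mem_coreVert (i : Fin D.r) : (D.a i 0).o ∈ D.coreVert := by
  intro j n h
  have := D.embedded j i n 0 h.symm
  omega

theorem o_succ_notMem_coreVert (i : Fin D.r) (n : ℕ) : (D.a i (n + 1)).o ∉ D.coreVert :=
  fun h => h i n rfl

theorem rev_mem_coreEdge {e : QEdge Γ} (h : e ∈ D.coreEdge) : e.rev ∈ D.coreEdge := fun i n =>
  ⟨fun h' => (h i n).2 (by rw [← h', QEdge.rev_rev]), fun h' => (h i n).1 (QEdge.rev_inj.1 h')⟩

theorem o_mem_coreVert {e : QEdge Γ} (h : e ∈ D.coreEdge) : e.o ∈ D.coreVert := by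
  intro i n h'
  rcases D.glued i n e h' with rfl | rfl
  · exact (h i (n + 1)).1 rfl
  · exact (h i n).2 rfl

theorem t_mem_coreVert {e : QEdge Γ} (h : e ∈ D.coreEdge) : e.t ∈ D.coreVert :=
  D.o_mem_coreVert (D.rev_mem_coreEdge h)

theorem edge_cases (e : QEdge Γ) :
    e ∈ D.coreEdge ∨ ∃ i n, e = D.a i n ∨ e = (D.a i n).rev := by
  by_cases h : e ∈ D.coreEdge
  · exact Or.inl h
  · right
    simp only [coreEdge, Set.mem_ofPred_eq, not_forall] at h
    obtain ⟨i, n, h⟩ := h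
    exact ⟨i, n, by tauto⟩

/-- The stabilisers of the core vertices are trivial. -/
def IsFree : Prop := ∀ v : V, qv Γ v ∈ D.coreVert → ∀ γ : Γ, γ • v = v → γ = 1

variable {D}

theorem IsFree.dart_eq_of_core (hD : D.IsFree) {d d' : T.Dart} (h : qe Γ d = qe Γ d')
    (h0 : d.fst = d'.fst) (hc : qv Γ d.fst ∈ D.coreVert) : d = d' := by
  obtain ⟨γ, hγ⟩ := qe_eq_iff.1 h
  have h1 : γ • d'.fst = d.fst := congrArg (fun d : T.Dart => d.fst) hγ
  have : γ = 1 := hD _ (h0 ▸ hc) γ (h1.trans h0)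
  rw [← hγ, this, one_smul]

/-- There is only one way up a cusp. For `n = 0` the origin has trivial stabiliser; for `n ≥ 1` the
stabiliser of the origin fixes the edge. -/
theorem IsFree.dart_eq (hD : D.IsFree) {d d' : T.Dart} {i : Fin D.r} {n : ℕ}
    (h : qe Γ d = D.a i n) (h' : qe Γ d' = D.a i n) (h0 : d.fst = d'.fst) : d = d' := by
  rcases n with _ | n
  · refine hD.dart_eq_of_core (h.trans h'.symm) h0 ?_
    rw [← qe_o, h]
    exact D.o_zero_mem_coreVert i
  · obtain ⟨γ, hγ⟩ := qe_eq_iff.1 (h.trans h'.symm)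
    have h1 : γ • d'.fst = d.fst := congrArg (fun d : T.Dart => d.fst) hγ
    have h2 := D.cuspidal i n d' h' γ (h1.trans h0)
    refine dart_ext h0 ?_
    have h3 : γ • d'.snd = d.snd := congrArg (fun d : T.Dart => d.snd) hγ
    rw [← h3, h2]

theorem next_of_a {d d' : T.Dart} {i : Fin D.r} {n : ℕ} (h : qe Γ d = D.a i n)
    (h0 : d.snd = d'.fst) : qe Γ d' = D.a i (n + 1) ∨ qe Γ d' = (D.a i n).rev :=
  D.glued i n _ (by rw [qe_o, ← h0, ← qe_t, h, D.consecutive])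

/-- A descent cannot be interrupted: the edge going up from the vertex reached is unique, and it is
the one just traversed. -/
theorem IsFree.next_of_rev (hD : D.IsFree) {d d' : T.Dart} {i : Fin D.r} {n : ℕ}
    (h : qe Γ d = (D.a i (n + 1)).rev) (h0 : d.snd = d'.fst) (h1 : d' ≠ d.symm) :
    qe Γ d' = (D.a i n).rev := by
  rcases D.glued i n (qe Γ d') (by rw [qe_o, ← h0, ← qe_t, h, QEdge.rev_t]) with h2 | h2
  · exact absurd (hD.dart_eq (d := d') (d' := d.symm) h2
      (by rw [qe_symm, h, QEdge.rev_rev]) h0.symm) h1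
  · exact h2

/-- A geodesic whose projection to `X` backtracks can only do so at the top of a climb in a cusp: at
core vertices lifts are determined by their origin, and descents continue. -/
theorem IsFree.exists_turn (hD : D.IsFree) {d d' : T.Dart} (h : qe Γ d' = (qe Γ d).rev)
    (h0 : d.snd = d'.fst) (h1 : d' ≠ d.symm) : ∃ i n, qe Γ d = D.a i n := by
  have key : qv Γ d'.fst ∉ D.coreVert := fun hc =>
    h1 (hD.dart_eq_of_core (d' := d.symm) (by rw [h, qe_symm]) h0.symm hc)
  rcases D.edge_cases (qe Γ d) with hc | ⟨i, n, hc | hc⟩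
  · exact absurd (by rw [← h0, ← qe_t]; exact D.t_mem_coreVert hc) key
  · exact ⟨i, n, hc⟩
  · rcases n with _ | n
    · refine absurd ?_ key
      rw [← h0, ← qe_t, hc, QEdge.rev_t]
      exact D.o_zero_mem_coreVert i
    · have h2 := hD.next_of_rev hc h0 h1
      rw [h, hc, QEdge.rev_rev] at h2
      exact absurd h2 (D.a_ne_rev _ _ _ _)

namespace Lifts

variable (s : D.Lifts)

/-- The vertices of the lifts of the cuspidal rays. -/
def vx (i : Fin D.r) (n : ℕ) : V := (s.aLift i n).fst

theorem aLift_fst (i : Fin D.r) (n : ℕ) : (s.aLift i n).fst = s.vx i n := rfl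

theorem aLift_snd (i : Fin D.r) (n : ℕ) : (s.aLift i n).snd = s.vx i (n + 1) :=
  s.lift_consecutive i n

theorem qe_lift (e : QEdge Γ) : qe Γ (s.lift e) = e := s.lift_mk e

theorem qe_aLift (i : Fin D.r) (n : ℕ) : qe Γ (s.aLift i n) = D.a i n := s.lift_mk _

theorem qv_vx (i : Fin D.r) (n : ℕ) : qv Γ (s.vx i n) = (D.a i n).o := by
  rw [vx, ← qe_o, qe_aLift]

theorem qv_vx_zero (i : Fin D.r) : qv Γ (s.vx i 0) ∈ D.coreVert := by
  rw [qv_vx]; exact D.o_zero_mem_coreVert i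

theorem qv_vx_succ (i : Fin D.r) (n : ℕ) : qv Γ (s.vx i (n + 1)) ∉ D.coreVert := by
  rw [qv_vx]; exact D.o_succ_notMem_coreVert i n

theorem o_a_inj {i j : Fin D.r} {n m : ℕ} (hn : n ≠ 0) (h : (D.a i n).o = (D.a j m).o) :
    i = j ∧ n = m := by
  obtain ⟨n, rfl⟩ := Nat.exists_eq_succ_of_ne_zero hn
  exact D.embedded i j n m h

/-- The lift of a cuspidal ray. -/
def vRay (i : Fin D.r) : Ray T where
  toFun := s.vx i
  adj n := by have := (s.aLift i n).adj; rwa [s.aLift_snd] at this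
  inj n m h := by
    have h := congrArg (qv Γ) h
    rw [qv_vx, qv_vx] at h
    by_cases hn : n = 0
    · by_cases hm : m = 0
      · rw [hn, hm]
      · exact (o_a_inj hm h.symm).2.symm
    · exact (o_a_inj hn h).2

theorem vx_injective (i : Fin D.r) : Function.Injective (s.vx i) := (s.vRay i).inj

theorem dart_eq_aLift (hD : D.IsFree) {d : T.Dart} {i : Fin D.r} {n : ℕ} (h : qe Γ d = D.a i n)
    (h0 : d.fst = s.vx i n) : d = s.aLift i n :=
  hD.dart_eq h (s.qe_aLift i n) h0

/-- The lower part of the descent is normalised by induction; the edge above it, reversed, is then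
forced by uniqueness of the way up. -/
theorem descend (hD : D.IsFree) {i : Fin D.r} {n : ℕ} (r : Ray T)
    (h : qe Γ (r.edge 0) = (D.a i n).rev) :
    ∃ γ : Γ, ∀ k ≤ n + 1, γ • r.toFun k = s.vx i (n + 1 - k) := by
  induction n generalizing r with
  | zero =>
    rw [← s.qe_aLift i 0, ← qe_symm] at h
    obtain ⟨γ, hγ⟩ := qe_eq_iff.1 h.symm
    refine ⟨γ, fun k hk => ?_⟩
    interval_cases k
    · have : γ • r.toFun 0 = (s.aLift i 0).snd := congrArg (fun d : T.Dart => d.fst) hγ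
      rw [this, s.aLift_snd]
    · exact congrArg (fun d : T.Dart => d.snd) hγ
  | succ n ih =>
    obtain ⟨γ, hγ⟩ := ih (r.tail 1) (hD.next_of_rev h rfl (r.edge_succ_ne 0))
    refine ⟨γ, fun k hk => ?_⟩
    rcases k with _ | k
    · have h1 := hγ 0 (by omega)
      have h2 : γ • (r.edge 0).symm = s.aLift i (n + 1) := by
        refine s.dart_eq_aLift hD ?_ h1
        rw [qe_smul, qe_symm, h, QEdge.rev_rev]
      have : γ • r.toFun 0 = (s.aLift i (n + 1)).snd :=
        congrArg (fun d : T.Dart => d.snd) h2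
      rw [this, s.aLift_snd]
      rfl
    · have h1 := hγ k (by omega)
      rw [show n + 1 + 1 - (k + 1) = n + 1 - k by omega, ← h1, add_comm k 1]
      rfl

end Lifts

end CuspDecomposition

end Quotients

/-! ### The cells: existence, uniqueness and locality of the code. -/

namespace CuspDecomposition.Lifts

variable {V : Type*} {T : SimpleGraph V} {Γ : Subgroup (T ≃g T)} {D : CuspDecomposition Γ}
  (s : D.Lifts)

open Geodesic

variable {s}

/-- The letter `(g, -)` opposite to `(g⁻¹, +)`. -/
def UpTurn.inv {i : Fin D.r} {n : ℕ} (c : s.UpTurn i n) : s.DownTurn i n :=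
  ⟨(QuotientGroup.quotientRightRelEquivQuotientLeftRel _).symm c.1, by
    obtain ⟨c, g, hg, rfl⟩ := c
    refine ⟨g⁻¹, ⟨inv_mem hg.1, fun h => hg.2 (by simpa using h)⟩, rfl⟩⟩

/-- The letter `(g, +)` opposite to `(g⁻¹, -)`. -/
def DownTurn.inv {i : Fin D.r} {n : ℕ} (c : s.DownTurn i n) : s.UpTurn i n :=
  ⟨QuotientGroup.quotientRightRelEquivQuotientLeftRel _ c.1, by
    obtain ⟨c, g, hg, rfl⟩ := c
    refine ⟨g⁻¹, ⟨inv_mem hg.1, fun h => hg.2 (by simpa using h)⟩, rfl⟩⟩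

theorem UpTurn.inv_inv {i : Fin D.r} {n : ℕ} (c : s.UpTurn i n) : c.inv.inv = c :=
  Subtype.ext (Equiv.apply_symm_apply _ _)

theorem DownTurn.inv_inv {i : Fin D.r} {n : ℕ} (c : s.DownTurn i n) : c.inv.inv = c :=
  Subtype.ext (Equiv.symm_apply_apply _ _)

theorem DownTurn.rep_inv {i : Fin D.r} {n : ℕ} {c : s.DownTurn i n} {g : Γ} :
    c.inv.Rep g⁻¹ ↔ c.Rep g := by
  have : (QuotientGroup.mk g⁻¹ : Γ ⧸ s.grp i n) =
    QuotientGroup.quotientRightRelEquivQuotientLeftRel _ (Quotient.mk _ g) := rfl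
  rw [UpTurn.Rep, DownTurn.Rep, this]
  exact (Equiv.apply_eq_iff_eq _)

theorem UpTurn.rep_inv {i : Fin D.r} {n : ℕ} {c : s.UpTurn i n} {g : Γ} :
    c.inv.Rep g⁻¹ ↔ c.Rep g := by
  rw [← DownTurn.rep_inv, c.inv_inv, _root_.inv_inv]

/-- The letter of the reversed geodesic. -/
def Letter.rev : s.Letter → s.Letter
  | .edge e => .edge e.rev
  | .up i n c => .down i n c.inv
  | .down i n c => .up i n c.inv

theorem Letter.rev_rev (β : s.Letter) : β.rev.rev = β := by
  cases β with
  | edge e => exact congrArg Letter.edge e.rev_rev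
  | up i n c => exact congrArg (Letter.up i n) c.inv_inv
  | down i n c => exact congrArg (Letter.down i n) c.inv_inv

theorem Letter.rev_injective : Function.Injective (Letter.rev : s.Letter → _) := fun a b h => by
  rw [← a.rev_rev, h, b.rev_rev]

theorem mem_cellUp_core {e : QEdge Γ} (he : e ∈ D.coreEdge) (ℓ : Geodesic T) :
    ℓ ∈ s.cellUp (.edge e) ↔ ℓ.edge 0 = s.lift e := by
  constructor
  · rintro (h | ⟨i, n, rfl, -⟩ | ⟨i, n, rfl, -⟩)
    · exact h.2
    · exact absurd rfl (he i n).1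
    · exact absurd rfl (he i n).2
  · exact fun h => Or.inl ⟨he, h⟩

theorem mem_cellUp_a {i : Fin D.r} {n : ℕ} (ℓ : Geodesic T) :
    ℓ ∈ s.cellUp (.edge (D.a i n)) ↔ ℓ.edge 0 = s.aLift i n ∧ ℓ.edge 1 = s.aLift i (n + 1) ∧
      ℓ.edge (-n) = s.aLift i 0 := by
  constructor
  · rintro (h | ⟨j, m, h, h'⟩ | ⟨j, m, h, -⟩)
    · exact absurd rfl (h.1 i n).1
    · obtain ⟨rfl, rfl⟩ := D.a_inj h
      exact h'
    · exact absurd h (D.a_ne_rev _ _ _ _)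
  · exact fun h => Or.inr (Or.inl ⟨i, n, rfl, h⟩)

theorem mem_cellUp_aRev {i : Fin D.r} {n : ℕ} (ℓ : Geodesic T) :
    ℓ ∈ s.cellUp (.edge (D.a i n).rev) ↔ ℓ.edge 0 = (s.aLift i n).symm ∧
      ℓ.edge (-1) = (s.aLift i (n + 1)).symm ∧ ℓ.edge n = (s.aLift i 0).symm := by
  constructor
  · rintro (h | ⟨j, m, h, -⟩ | ⟨j, m, h, h'⟩)
    · exact absurd rfl (h.1 i n).2
    · exact absurd h.symm (D.a_ne_rev _ _ _ _)
    · obtain ⟨rfl, rfl⟩ := D.a_inj (QEdge.rev_inj.1 h)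
      exact h'
  · exact fun h => Or.inr (Or.inr ⟨i, n, rfl, h⟩)

theorem mem_cellUp_up {i : Fin D.r} {n : ℕ} {c : s.UpTurn i n} (ℓ : Geodesic T) :
    ℓ ∈ s.cellUp (.up i n c) ↔ ∃ g : Γ, c.Rep g ∧ ℓ.edge 0 = s.aLift i n ∧
      ℓ.edge 1 = g • (s.aLift i n).symm ∧ ℓ.edge (-n) = s.aLift i 0 := Iff.rfl

theorem mem_cellUp_down {i : Fin D.r} {n : ℕ} {c : s.DownTurn i n} (ℓ : Geodesic T) :
    ℓ ∈ s.cellUp (.down i n c) ↔ ∃ g : Γ, c.Rep g ∧ ℓ.edge 0 = (s.aLift i n).symm ∧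
      ℓ.edge (-1) = g⁻¹ • s.aLift i n ∧ ℓ.edge n = (s.aLift i 0).symm := Iff.rfl

theorem dart_symm_eq_iff {d d' : T.Dart} : d.symm = d' ↔ d = d'.symm :=
  ⟨fun h => by rw [← h, SimpleGraph.Dart.symm_symm], fun h => by
    rw [h, SimpleGraph.Dart.symm_symm]⟩

/-- Time reversal exchanges ascents with descents and futures with pasts, so that only one of the
two directions has to be treated below. -/
theorem rev_mem_cellUp {β : s.Letter} {ℓ : Geodesic T} :
    ℓ.rev ∈ s.cellUp β.rev ↔ ℓ ∈ s.cellUp β := by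
  have key : ∀ {β : s.Letter} {ℓ : Geodesic T}, ℓ ∈ s.cellUp β → ℓ.rev ∈ s.cellUp β.rev := by
    rintro β ℓ h
    cases β with
    | edge e =>
      change _ ∈ s.cellUp (.edge e.rev)
      rcases D.edge_cases e with he | ⟨i, n, rfl | rfl⟩
      · rw [mem_cellUp_core he] at h
        rw [mem_cellUp_core (D.rev_mem_coreEdge he), rev_edge, neg_zero, h, s.lift_rev]
      · rw [mem_cellUp_a] at h
        rw [mem_cellUp_aRev, rev_edge, rev_edge, rev_edge, neg_zero, _root_.neg_neg, h.1, h.2.1,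
          h.2.2]
        exact ⟨rfl, rfl, rfl⟩
      · rw [mem_cellUp_aRev] at h
        rw [QEdge.rev_rev, mem_cellUp_a, rev_edge, rev_edge, rev_edge, neg_zero, _root_.neg_neg,
          h.1, h.2.1, h.2.2]
        simp
    | up i n c =>
      obtain ⟨g, hg, h0, h1, h2⟩ := h
      refine ⟨g⁻¹, UpTurn.rep_inv.2 hg, ?_, ?_, ?_⟩
      · rw [rev_edge, neg_zero, h0]
      · rw [rev_edge, _root_.neg_neg, h1, _root_.inv_inv, smul_dart_symm,
          SimpleGraph.Dart.symm_symm]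
      · rw [rev_edge, h2]
    | down i n c =>
      obtain ⟨g, hg, h0, h1, h2⟩ := h
      refine ⟨g⁻¹, DownTurn.rep_inv.2 hg, ?_, ?_, ?_⟩
      · rw [rev_edge, neg_zero, h0, SimpleGraph.Dart.symm_symm]
      · rw [rev_edge, h1, smul_dart_symm]
      · rw [rev_edge, _root_.neg_neg, h2, SimpleGraph.Dart.symm_symm]
  refine ⟨fun h => ?_, key⟩
  have := key h
  rwa [ℓ.rev_rev, β.rev_rev] at this

theorem edge_fst (ℓ : Geodesic T) (k : ℤ) : (ℓ.edge k).fst = ℓ.toFun k := rfl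

theorem edge_snd (ℓ : Geodesic T) (k : ℤ) : (ℓ.edge k).snd = ℓ.toFun (k + 1) := rfl

theorem mem_turn_of_edge (hD : D.IsFree) {ℓ : Geodesic T} {i : Fin D.r} {n : ℕ} {g : Γ}
    (h0 : ℓ.edge 0 = s.aLift i n) (h1 : ℓ.edge 1 = g • (s.aLift i n).symm) : g ∈ s.turn i n := by
  constructor
  · change g • (s.aLift i (n + 1)).fst = (s.aLift i (n + 1)).fst
    rw [aLift_fst, ← aLift_snd]
    have e1 : ℓ.toFun 1 = g • (s.aLift i n).snd := congrArg (fun d : T.Dart => d.fst) h1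
    have e2 : ℓ.toFun (0 + 1) = (s.aLift i n).snd := congrArg (fun d : T.Dart => d.snd) h0
    rw [← e1, ← e2, zero_add]
  -- If `g` fixed `v_{i,n}`, it would fix the whole edge `ã_{i,n}`, and the geodesic would backtrack
  -- at its top.
  · intro hg
    have e : g • s.aLift i n = s.aLift i n :=
      s.dart_eq_aLift hD (by rw [qe_smul, qe_aLift]) hg
    have := ℓ.edge_succ_ne 0
    rw [zero_add, h1, h0, ← smul_dart_symm, e] at this
    exact this rfl

/-- The geodesic comes up the cuspidal ray until time `1`. -/
def Ascends (s : D.Lifts) (ℓ : Geodesic T) (i : Fin D.r) (n : ℕ) : Prop :=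
  ∀ k : ℕ, k ≤ n + 1 → ℓ.toFun (-n + k) = s.vx i k

theorem ascends_of_edges (hT : T.IsTree) {ℓ : Geodesic T} {i : Fin D.r} {n : ℕ}
    (h0 : ℓ.edge 0 = s.aLift i n) (h1 : ℓ.edge (-n) = s.aLift i 0) : Ascends s ℓ i n := by
  intro k hk
  have := Ray.eq_of_eq_at hT (r := ℓ.posRay (-n)) (r' := s.vRay i) (N := n + 1) ?_ ?_ hk
  · exact this
  · have e : ℓ.toFun (-n) = s.vx i 0 := congrArg (fun d : T.Dart => d.fst) h1
    simpa [posRay, vRay] using e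
  · have e : ℓ.toFun (0 + 1) = (s.aLift i n).snd := congrArg (fun d : T.Dart => d.snd) h0
    rw [aLift_snd] at e
    change ℓ.toFun (-n + (n + 1 : ℕ)) = s.vx i (n + 1)
    rw [← e]
    congr 1
    push_cast
    ring

theorem Ascends.edges {ℓ : Geodesic T} {i : Fin D.r} {n : ℕ} (h : Ascends s ℓ i n) {k : ℕ}
    (hk : k ≤ n) : ℓ.edge (-n + k) = s.aLift i k := by
  refine dart_ext (h k (by omega)) ?_
  rw [aLift_snd, ← h (k + 1) (by omega), edge_snd]
  congr 1
  push_cast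
  ring

/-- Read backwards from time `1`, a geodesic going up is a descent, so its entrance in the cusp can
be normalised by `descend`. -/
theorem exists_ascends (hD : D.IsFree) {ℓ : Geodesic T} {i : Fin D.r} {n : ℕ}
    (h : qe Γ (ℓ.edge 0) = D.a i n) : ∃ γ : Γ, Ascends s (γ • ℓ) i n := by
  obtain ⟨γ, hγ⟩ := s.descend hD (i := i) (n := n) (ℓ.negRay 1) (by
    rw [← h, ← qe_symm]
    congr 1)
  refine ⟨γ, fun k hk => ?_⟩
  have h1 := hγ (n + 1 - k) (by omega)
  rw [show n + 1 - (n + 1 - k) = k by omega] at h1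
  rw [← h1]
  change γ • ℓ.toFun _ = γ • ℓ.toFun _
  congr 2
  omega

theorem exists_code_of_ascends (hD : D.IsFree) {ℓ : Geodesic T} {i : Fin D.r}
    {n : ℕ} (h : Ascends s ℓ i n) : ∃ β : s.Letter, ℓ ∈ s.cellUp β := by
  have e0 : ℓ.edge 0 = s.aLift i n := by simpa using h.edges (le_refl n)
  have e1 : ℓ.edge (-n) = s.aLift i 0 := by simpa using h.edges (Nat.zero_le n)
  have hsnd : ℓ.toFun 1 = s.vx i (n + 1) := by
    rw [← aLift_snd, ← e0]; rfl
  rcases next_of_a (d := ℓ.edge 0) (d' := ℓ.edge 1) (by rw [e0, qe_aLift]) rfl with h2 | h2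
  · exact ⟨.edge (D.a i n), (mem_cellUp_a ℓ).2 ⟨e0, s.dart_eq_aLift hD h2 hsnd, e1⟩⟩
  · rw [← s.qe_aLift, ← qe_symm] at h2
    obtain ⟨g, hg⟩ := qe_eq_iff.1 h2
    exact ⟨.up i n ⟨QuotientGroup.mk g, g, mem_turn_of_edge hD e0 hg.symm, rfl⟩,
      g, rfl, e0, hg.symm, e1⟩

theorem exists_code (hD : D.IsFree) (ℓ : Geodesic T) :
    ∃ (γ : Γ) (β : s.Letter), γ • ℓ ∈ s.cellUp β := by
  rcases D.edge_cases (qe Γ (ℓ.edge 0)) with h | ⟨i, n, h | h⟩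
  · obtain ⟨γ, hγ⟩ := qe_eq_iff.1 (s.qe_lift (qe Γ (ℓ.edge 0)))
    exact ⟨γ, .edge _, (mem_cellUp_core h _).2 hγ⟩
  · obtain ⟨γ, hγ⟩ := exists_ascends (s := s) hD h
    exact ⟨γ, exists_code_of_ascends hD hγ⟩
  · obtain ⟨γ, hγ⟩ := exists_ascends (s := s) (ℓ := ℓ.rev) hD (i := i) (n := n) (by
      rw [rev_edge, neg_zero, qe_symm, h, QEdge.rev_rev])
    obtain ⟨β, hβ⟩ := exists_code_of_ascends hD hγ
    refine ⟨γ, β.rev, ?_⟩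
    rw [← rev_mem_cellUp, β.rev_rev]
    exact hβ

/-- The three kinds of letters, according to the edge of the geodesic at time `0`. -/
theorem cellUp_cases (hT : T.IsTree) {ℓ : Geodesic T} {β : s.Letter} (h : ℓ ∈ s.cellUp β) :
    (∃ e ∈ D.coreEdge, β = .edge e ∧ ℓ.edge 0 = s.lift e) ∨
    (∃ i n, Ascends s ℓ i n ∧ ((β = .edge (D.a i n) ∧ ℓ.edge 1 = s.aLift i (n + 1)) ∨
      ∃ c, β = .up i n c ∧ ∃ g, c.Rep g ∧ ℓ.edge 1 = g • (s.aLift i n).symm)) ∨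
    (∃ i n, Ascends s ℓ.rev i n ∧ (β = .edge (D.a i n).rev ∨ ∃ c, β = .down i n c)) := by
  cases β with
  | edge e =>
    rcases D.edge_cases e with he | ⟨i, n, rfl | rfl⟩
    · exact Or.inl ⟨e, he, rfl, (mem_cellUp_core he ℓ).1 h⟩
    · rw [mem_cellUp_a] at h
      exact Or.inr (Or.inl ⟨i, n, ascends_of_edges hT h.1 h.2.2, Or.inl ⟨rfl, h.2.1⟩⟩)
    · rw [mem_cellUp_aRev] at h
      refine Or.inr (Or.inr ⟨i, n, ascends_of_edges hT ?_ ?_, Or.inl rfl⟩)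
      · rw [rev_edge, neg_zero, h.1, SimpleGraph.Dart.symm_symm]
      · rw [rev_edge, _root_.neg_neg, h.2.2, SimpleGraph.Dart.symm_symm]
  | up i n c =>
    obtain ⟨g, hg, h0, h1, h2⟩ := h
    exact Or.inr (Or.inl ⟨i, n, ascends_of_edges hT h0 h2, Or.inr ⟨c, rfl, g, hg, h1⟩⟩)
  | down i n c =>
    obtain ⟨g, hg, h0, h1, h2⟩ := h
    refine Or.inr (Or.inr ⟨i, n, ascends_of_edges hT ?_ ?_, Or.inr ⟨c, rfl⟩⟩)
    · rw [rev_edge, neg_zero, h0, SimpleGraph.Dart.symm_symm]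
    · rw [rev_edge, _root_.neg_neg, h2, SimpleGraph.Dart.symm_symm]

theorem Ascends.qe_eq {ℓ : Geodesic T} {i : Fin D.r} {n : ℕ} (h : Ascends s ℓ i n) :
    qe Γ (ℓ.edge 0) = D.a i n := by
  have e0 : ℓ.edge 0 = s.aLift i n := by simpa using h.edges (le_refl n)
  rw [e0, qe_aLift]

theorem Ascends.qe_eq_rev {ℓ : Geodesic T} {i : Fin D.r} {n : ℕ} (h : Ascends s ℓ.rev i n) :
    qe Γ (ℓ.edge 0) = (D.a i n).rev := by
  rw [← h.qe_eq, rev_edge, neg_zero, qe_symm, QEdge.rev_rev]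

/-- The edge class at time `0` gives the cusp and the height; then `γ` fixes the lifted entrance
vertex, which has trivial stabiliser. -/
theorem Ascends.normaliser_unique (hD : D.IsFree) {ℓ : Geodesic T} {γ : Γ} {i j : Fin D.r}
    {n m : ℕ} (h : Ascends s ℓ i n) (h' : Ascends s (γ • ℓ) j m) : γ = 1 ∧ i = j ∧ n = m := by
  have e := h'.qe_eq
  rw [smul_edge, qe_smul, h.qe_eq] at e
  obtain ⟨rfl, rfl⟩ := D.a_inj e
  refine ⟨hD _ (s.qv_vx_zero i) γ ?_, rfl, rfl⟩
  have h1 := h 0 (by omega)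
  have h2 := h' 0 (by omega)
  rwa [← h1]  at h2 ⊢

theorem code_unique_of_ascends (hT : T.IsTree) (hD : D.IsFree) {ℓ : Geodesic T} {γ : Γ}
    {β β' : s.Letter} {i : Fin D.r} {n : ℕ} (ha : Ascends s ℓ i n) (h : ℓ ∈ s.cellUp β)
    (h' : γ • ℓ ∈ s.cellUp β') : γ = 1 ∧ β = β' := by
  rcases cellUp_cases hT h with ⟨e, he, rfl, h0⟩ | ⟨j, m, h0, h1⟩ | ⟨j, m, h0, -⟩
  · have := ha.qe_eq
    rw [h0, qe_lift] at this
    exact absurd this (he i n).1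
  · obtain ⟨-, rfl, rfl⟩ := ha.normaliser_unique hD (γ := 1) (by rwa [one_smul])
    rcases cellUp_cases hT h' with ⟨e, he, rfl, h0'⟩ | ⟨j, m, h0', h1'⟩ | ⟨j, m, h0', -⟩
    · have := ha.qe_eq
      rw [← qe_smul γ, ← smul_edge, h0', qe_lift] at this
      exact absurd this (he _ _).1
    · obtain ⟨rfl, rfl, rfl⟩ := ha.normaliser_unique hD h0'
      rw [one_smul] at h1'
      refine ⟨rfl, ?_⟩
      rcases h1 with ⟨rfl, h1⟩ | ⟨c, rfl, g, hg, h1⟩ <;>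
        rcases h1' with ⟨rfl, h1'⟩ | ⟨c', rfl, g', hg', h1'⟩
      · rfl
      · have := congrArg (qe Γ) (h1.symm.trans h1')
        rw [qe_aLift, qe_smul, qe_symm, qe_aLift] at this
        exact absurd this (D.a_ne_rev _ _ _ _)
      · have := congrArg (qe Γ) (h1'.symm.trans h1)
        rw [qe_aLift, qe_smul, qe_symm, qe_aLift] at this
        exact absurd this (D.a_ne_rev _ _ _ _)
      · congr 1
        refine Subtype.ext (hg.symm.trans (Eq.trans (QuotientGroup.eq.2 ?_) hg'))
        -- Both elements carry `v_{i,n}` to `ℓ(2)`, and the stabiliser of `v_{i,n}` is `Γ_{i,n}`: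
        -- the turn is known exactly up to the coset in the letter.
        have : g • (s.aLift i n).fst = g' • (s.aLift i n).fst :=
          congrArg (fun d : T.Dart => d.snd) (h1.symm.trans h1')
        change (g⁻¹ * g') • (s.aLift i n).fst = (s.aLift i n).fst
        rw [mul_smul, ← this, inv_smul_smul]
    · have := h0'.qe_eq_rev
      rw [smul_edge, qe_smul, ha.qe_eq] at this
      exact absurd this (D.a_ne_rev _ _ _ _)
  · have := h0.qe_eq_rev
    rw [ha.qe_eq] at this
    exact absurd this (D.a_ne_rev _ _ _ _)

/-- With `exists_code`, this makes the union of the cells a strict fundamental domain, partitioned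
by the letters. The normalisation is anchored at a core vertex: the origin of the edge, or the
entrance or exit of the cusp. -/
theorem code_unique (hT : T.IsTree) (hD : D.IsFree) {ℓ : Geodesic T} {γ : Γ} {β β' : s.Letter}
    (h : ℓ ∈ s.cellUp β) (h' : γ • ℓ ∈ s.cellUp β') : γ = 1 ∧ β = β' := by
  rcases cellUp_cases hT h with ⟨e, he, rfl, h0⟩ | ⟨i, n, h0, -⟩ | ⟨i, n, h0, -⟩
  · rcases cellUp_cases hT h' with ⟨f, hf, rfl, h0'⟩ | ⟨i, n, h0', -⟩ | ⟨i, n, h0', -⟩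
    · have hef : e = f := by
        rw [← s.qe_lift e, ← s.qe_lift f, ← h0, ← h0', smul_edge, qe_smul]
      subst hef
      refine ⟨hD (s.lift e).fst ?_ γ ?_, rfl⟩
      · rw [← qe_o, qe_lift]
        exact D.o_mem_coreVert he
      · rw [smul_edge, h0] at h0'
        exact congrArg (fun d : T.Dart => d.fst) h0'
    · have := h0'.qe_eq
      rw [smul_edge, qe_smul, h0, qe_lift] at this
      exact absurd this (he _ _).1
    · have := h0'.qe_eq_rev
      rw [smul_edge, qe_smul, h0, qe_lift] at this
      exact absurd this (he _ _).2
  · exact code_unique_of_ascends hT hD h0 h h'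
  · have := code_unique_of_ascends hT hD h0 (rev_mem_cellUp.2 h)
      (γ := γ) (β' := β'.rev) (rev_mem_cellUp.2 h')
    exact ⟨this.1, Letter.rev_injective this.2⟩

/-- A visit to the core screens off everything before it: the conditions of a cell reach back at
most to the entrance of the current cusp, and no vertex strictly inside a cusp is in the core. -/
theorem cellUp_of_agree_ge (hT : T.IsTree) {ℓ ℓ' : Geodesic T} {t : ℤ} (ht : t ≤ 0)
    (hc : qv Γ (ℓ.toFun t) ∈ D.coreVert) (h : ∀ k, t ≤ k → ℓ.toFun k = ℓ'.toFun k)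
    {β : s.Letter} (hβ : ℓ ∈ s.cellUp β) : ℓ' ∈ s.cellUp β := by
  have he : ∀ k, t ≤ k → ℓ'.edge k = ℓ.edge k := fun k hk =>
    (dart_ext (h k hk) (h (k + 1) (by omega))).symm
  rcases cellUp_cases hT hβ with ⟨e, hcore, rfl, -⟩ | ⟨i, n, h0, h1⟩ | ⟨i, n, h0, h1⟩
  · rw [mem_cellUp_core hcore] at hβ ⊢
    rwa [he 0 ht]
  · have htn : t ≤ -n := by
      by_contra hlt
      have h2 := h0 (t + n).toNat (by omega)
      rw [show (-n + (t + n).toNat : ℤ) = t by omega] at h2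
      obtain ⟨k, hk⟩ : ∃ k, (t + n).toNat = k + 1 := ⟨(t + n).toNat - 1, by omega⟩
      rw [h2, hk] at hc
      exact s.qv_vx_succ i k hc
    rcases h1 with ⟨rfl, -⟩ | ⟨c, rfl, -⟩
    · rw [mem_cellUp_a] at hβ ⊢
      rwa [he 0 ht, he 1 (by omega), he _ htn]
    · rw [mem_cellUp_up] at hβ ⊢
      rwa [he 0 ht, he 1 (by omega), he _ htn]
  · have ht1 : t ≤ -1 := by
      by_contra hlt
      obtain rfl : t = 0 := by omega
      have h2 := h0 (n + 1) le_rfl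
      change ℓ.toFun (1 - (-n + (n + 1 : ℕ))) = _ at h2
      rw [show (1 - (-n + (n + 1 : ℕ)) : ℤ) = 0 by push_cast; ring] at h2
      rw [h2] at hc
      exact s.qv_vx_succ i n hc
    rcases h1 with rfl | ⟨c, rfl⟩
    · rw [mem_cellUp_aRev] at hβ ⊢
      rwa [he 0 ht, he _ ht1, he n (by omega)]
    · rw [mem_cellUp_down] at hβ ⊢
      rwa [he 0 ht, he _ ht1, he n (by omega)]

theorem code_of_agree_ge (hT : T.IsTree) {ℓ ℓ' : Geodesic T} {t j : ℤ} (ht : t ≤ j)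
    (hc : qv Γ (ℓ.toFun t) ∈ D.coreVert) (h : ∀ k, t ≤ k → ℓ.toFun k = ℓ'.toFun k)
    {γ : Γ} {β : s.Letter} (hβ : γ • ℓ.shift j ∈ s.cellUp β) : γ • ℓ'.shift j ∈ s.cellUp β := by
  refine cellUp_of_agree_ge hT (t := t - j) (by omega) ?_ ?_ hβ
  · change qv Γ (γ • ℓ.toFun (t - j + j)) ∈ _
    rwa [sub_add_cancel, qv_smul]
  · intro k hk
    exact congrArg (γ • ·) (h (k + j) (by omega))

/-- The letters and the normalising elements in the future of a cell depend only on the future of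
the geodesic. -/
theorem future_determined (hT : T.IsTree) (hD : D.IsFree) {α : s.Letter} {ℓ ℓ' : Geodesic T}
    (hα : ℓ ∈ s.cellUp α) (hα' : ℓ' ∈ s.cellUp α)
    (h : ∀ k, 0 ≤ k → ℓ'.toFun k = ℓ.toFun k) (j : ℕ) {γ : Γ} {β : s.Letter}
    (hβ : γ • ℓ.shift j ∈ s.cellUp β) : γ • ℓ'.shift j ∈ s.cellUp β := by
  have hs : ∀ k, 0 ≤ k → ℓ.toFun k = ℓ'.toFun k := fun k hk => (h k hk).symm
  rcases cellUp_cases hT hα with ⟨e, he, rfl, h0⟩ | ⟨i, n, h0, h1⟩ | ⟨i, n, h0, h1⟩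
  · refine code_of_agree_ge hT (t := 0) (by omega) ?_ hs hβ
    rw [← edge_fst, h0, ← qe_o, qe_lift]
    exact D.o_mem_coreVert he
  -- In an ascent the common letter prescribes the segment from the core entrance at time `-n`, so
  -- agreement of the futures extends back to `-n`.
  · refine code_of_agree_ge hT (t := -n) (by omega) ?_ ?_ hβ
    · have := h0 0 (by omega)
      simp only [Nat.cast_zero, add_zero] at this
      rw [this]
      exact s.qv_vx_zero i
    · intro k hk
      have h0' : Ascends s ℓ' i n := by
        rcases h1 with ⟨rfl, -⟩ | ⟨c, rfl, -⟩
        · rw [mem_cellUp_a] at hα'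
          exact ascends_of_edges hT hα'.1 hα'.2.2
        · obtain ⟨g, -, h2, -, h3⟩ := hα'
          exact ascends_of_edges hT h2 h3
      rcases le_total 0 k with hk0 | hk0
      · exact hs k hk0
      · have e1 := h0 (k + n).toNat (by omega)
        have e2 := h0' (k + n).toNat (by omega)
        rw [show (-n + (k + n).toNat : ℤ) = k by omega] at e1 e2
        rw [e1, e2]
  -- In a descent the geodesic is back in the core at time `n + 1`. After that time locality
  -- applies; before it, the letters are forced by the height.
  · by_cases hj : n + 1 ≤ j
    · refine code_of_agree_ge hT (t := n + 1) (by omega) ?_ (fun k hk => hs k (by omega)) hβ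
      have := h0 0 (by omega)
      change ℓ.toFun (1 - (-n + (0 : ℕ))) = _ at this
      rw [show (1 - (-n + (0 : ℕ)) : ℤ) = n + 1 by push_cast; ring] at this
      rw [this]
      exact s.qv_vx_zero i
    · rcases j with _ | j
      · rw [Nat.cast_zero, shift_zero] at hβ ⊢
        obtain ⟨rfl, rfl⟩ := code_unique hT hD hα hβ
        rwa [one_smul]
      · have hedge : ∀ k : ℕ, k ≤ n → ℓ.edge k = (s.aLift i (n - k)).symm := by
          intro k hk
          have := h0.edges (k := n - k) (by omega)
          rw [rev_edge, dart_symm_eq_iff] at this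
          rw [← this]
          congr 1
          omega
        have hcell : ∀ ℓ₁ : Geodesic T, (∀ k : ℕ, k ≤ n → ℓ₁.edge k = (s.aLift i (n - k)).symm) →
            ℓ₁.shift (j + 1 : ℕ) ∈ s.cellUp (.edge (D.a i (n - (j + 1))).rev) := by
          intro ℓ₁ hℓ₁
          rw [mem_cellUp_aRev, shift_edge, shift_edge, shift_edge]
          refine ⟨?_, ?_, ?_⟩
          · rw [zero_add]; exact hℓ₁ _ (by omega)
          · rw [show (-1 + (j + 1 : ℕ) : ℤ) = j by push_cast; ring, hℓ₁ j (by omega)]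
            congr 2
            omega
          · rw [show ((n - (j + 1) : ℕ) + (j + 1 : ℕ) : ℤ) = n by omega, hℓ₁ n le_rfl, Nat.sub_self]
        obtain ⟨rfl, rfl⟩ := code_unique hT hD (hcell ℓ hedge) hβ
        rw [one_smul]
        refine hcell ℓ' fun k hk => ?_
        rw [← hedge k hk]
        exact dart_ext (h k (by omega)) (h (k + 1) (by omega))

/-- The letters and the normalising elements in the past of a cell depend only on the past of
the geodesic. -/
theorem past_determined (hT : T.IsTree) (hD : D.IsFree) {α : s.Letter} {ℓ ℓ' : Geodesic T}
    (hα : ℓ ∈ s.cellUp α) (hα' : ℓ' ∈ s.cellUp α)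
    (h : ∀ k ≤ 1, ℓ'.toFun k = ℓ.toFun k) (j : ℕ) {γ : Γ} {β : s.Letter}
    (hβ : γ • ℓ.shift (-j) ∈ s.cellUp β) : γ • ℓ'.shift (-j) ∈ s.cellUp β := by
  rw [← rev_mem_cellUp, rev_smul, rev_shift, _root_.neg_neg] at hβ ⊢
  exact future_determined hT hD (rev_mem_cellUp.2 hα) (rev_mem_cellUp.2 hα')
    (fun k hk => h (1 - k) (by omega)) j hβ

theorem isOpen_cellUp (β : s.Letter) : IsOpen (s.cellUp β) := by
  cases β with
  | edge e =>
    rcases D.edge_cases e with he | ⟨i, n, rfl | rfl⟩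
    · convert! isOpen_edge_eq (T := T) 0 (s.lift e) using 1
      ext ℓ
      exact mem_cellUp_core he ℓ
    · convert! (isOpen_edge_eq (T := T) 0 (s.aLift i n)).inter
        ((isOpen_edge_eq 1 (s.aLift i (n + 1))).inter (isOpen_edge_eq (-n) (s.aLift i 0))) using 1
      ext ℓ
      exact mem_cellUp_a ℓ
    · convert! (isOpen_edge_eq (T := T) 0 (s.aLift i n).symm).inter
        ((isOpen_edge_eq (-1) (s.aLift i (n + 1)).symm).inter
          (isOpen_edge_eq n (s.aLift i 0).symm)) using 1
      ext ℓ
      exact mem_cellUp_aRev ℓ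
  | up i n c =>
    have : s.cellUp (.up i n c) = ⋃ g ∈ {g : Γ | c.Rep g}, ({ℓ | ℓ.edge 0 = s.aLift i n} ∩
        ({ℓ | ℓ.edge 1 = g • (s.aLift i n).symm} ∩ {ℓ | ℓ.edge (-n) = s.aLift i 0})) := by
      ext ℓ
      simp only [mem_cellUp_up, Set.mem_iUnion, exists_prop]
      rfl
    rw [this]
    exact isOpen_biUnion fun g _ => (isOpen_edge_eq 0 _).inter
      ((isOpen_edge_eq 1 _).inter (isOpen_edge_eq _ _))
  | down i n c =>
    have : s.cellUp (.down i n c) = ⋃ g ∈ {g : Γ | c.Rep g}, ({ℓ | ℓ.edge 0 = (s.aLift i n).symm} ∩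
        ({ℓ | ℓ.edge (-1) = g⁻¹ • s.aLift i n} ∩ {ℓ | ℓ.edge n = (s.aLift i 0).symm})) := by
      ext ℓ
      simp only [mem_cellUp_down, Set.mem_iUnion, exists_prop]
      rfl
    rw [this]
    exact isOpen_biUnion fun g _ => (isOpen_edge_eq 0 _).inter
      ((isOpen_edge_eq (-1) _).inter (isOpen_edge_eq _ _))

/-- Each condition in the definition of a cell bears on one edge, of index `≤ 0` or `≥ 0`, and is
inherited from the geodesic supplying that side. For turns, the existence of `g` is a condition on
one side only. -/
theorem isRect_cellUp (β : s.Letter) : IsRect (s.cellUp β) := by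
  have key : ∃ d : T.Dart, ∀ ℓ ∈ s.cellUp β, ℓ.edge 0 = d := by
    cases β with
    | edge e =>
      rcases D.edge_cases e with he | ⟨i, n, rfl | rfl⟩
      · exact ⟨_, fun ℓ h => (mem_cellUp_core he ℓ).1 h⟩
      · exact ⟨_, fun ℓ h => ((mem_cellUp_a ℓ).1 h).1⟩
      · exact ⟨_, fun ℓ h => ((mem_cellUp_aRev ℓ).1 h).1⟩
    | up i n c => exact ⟨s.aLift i n, fun ℓ ⟨g, _, h, _⟩ => h⟩
    | down i n c => exact ⟨(s.aLift i n).symm, fun ℓ ⟨g, _, h, _⟩ => h⟩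
  obtain ⟨d, hd⟩ := key
  refine ⟨fun ℓ h ℓ' h' => ?_, fun ℓ h ℓ' h' => ?_, ?_⟩
  · exact congrArg (fun d : T.Dart => d.fst) ((hd ℓ h).trans (hd ℓ' h').symm)
  · exact congrArg (fun d : T.Dart => d.snd) ((hd ℓ h).trans (hd ℓ' h').symm)
  intro ℓ h ℓ' h' ℓ'' h1 h2
  have e1 : ∀ k ≤ 0, ℓ''.edge k = ℓ.edge k := fun k hk =>
    dart_ext (h1 k (by omega)) (h1 (k + 1) (by omega))
  have e2 : ∀ k, 0 ≤ k → ℓ''.edge k = ℓ'.edge k := fun k hk =>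
    dart_ext (h2 k (by omega)) (h2 (k + 1) (by omega))
  cases β with
  | edge e =>
    rcases D.edge_cases e with he | ⟨i, n, rfl | rfl⟩
    · rw [mem_cellUp_core he] at h ⊢
      rwa [e1 0 le_rfl]
    · rw [mem_cellUp_a] at h h' ⊢
      exact ⟨(e1 0 le_rfl).trans h.1, (e2 1 (by omega)).trans h'.2.1,
        (e1 (-n) (by omega)).trans h.2.2⟩
    · rw [mem_cellUp_aRev] at h h' ⊢
      exact ⟨(e1 0 le_rfl).trans h.1, (e1 (-1) (by omega)).trans h.2.1,
        (e2 n (by omega)).trans h'.2.2⟩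
  | up i n c =>
    obtain ⟨g, hg, a1, a2, a3⟩ := h
    obtain ⟨g', hg', b1, b2, b3⟩ := h'
    exact ⟨g', hg', (e1 0 le_rfl).trans a1, (e2 1 (by omega)).trans b2,
      (e1 (-n) (by omega)).trans a3⟩
  | down i n c =>
    obtain ⟨g, hg, a1, a2, a3⟩ := h
    obtain ⟨g', hg', b1, b2, b3⟩ := h'
    exact ⟨g, hg, (e1 0 le_rfl).trans a1, (e1 (-1) (by omega)).trans a2,
      (e2 n (by omega)).trans b3⟩

end CuspDecomposition.Lifts

/-! ### Absence of leaves, and extension of paths to geodesics. -/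

section Branching

variable {V : Type*} {T : SimpleGraph V}

/-- `T` has no vertex of valence at most `1`. -/
def Branching (T : SimpleGraph V) : Prop := ∀ v u : V, ∃ w, w ≠ u ∧ T.Adj v w

theorem exists_closer (hT : T.IsTree) {x y : V} {n : ℕ} (h : T.dist x y = n + 1) :
    ∃ z, T.Adj z y ∧ T.dist x z = n := by
  obtain ⟨w, hw⟩ := hT.1.exists_walk_length_eq_dist y x
  rw [SimpleGraph.dist_comm] at hw
  cases w with
  | nil => simp at h
  | @cons _ z _ hz q =>
    rw [SimpleGraph.Walk.length_cons] at hw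
    refine ⟨z, hz.symm, ?_⟩
    have h1 := SimpleGraph.dist_le q
    rw [SimpleGraph.dist_comm] at h1
    rcases dist_step hT x hz with h2 | h2 <;> omega

theorem connected_induce_branching (hT : T.IsTree)
    (hne : {v : V | ∃ u w, u ≠ w ∧ T.Adj v u ∧ T.Adj v w}.Nonempty) :
    (T.induce {v : V | ∃ u w, u ≠ w ∧ T.Adj v u ∧ T.Adj v w}).Connected := by
  set S := {v : V | ∃ u w, u ≠ w ∧ T.Adj v u ∧ T.Adj v w} with hS
  have key : ∀ (u : S) (n : ℕ) (w : S), T.dist u.1 w.1 = n → (T.induce S).Reachable u w := by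
    intro u n
    induction n with
    | zero =>
      intro w h
      have := hT.1.dist_eq_zero_iff.1 h
      rw [Subtype.ext this]
    | succ n ih =>
      intro w h
      obtain ⟨z, hz, hd⟩ := exists_closer hT h
      have hzS : z ∈ S := by
        rcases n with _ | n
        · rw [← hT.1.dist_eq_zero_iff.1 hd]
          exact u.2
        · obtain ⟨z', hz', hd'⟩ := exists_closer hT hd
          refine ⟨z', w, ?_, hz'.symm, hz⟩
          rintro rfl
          omega
      refine (ih ⟨z, hzS⟩ hd).trans (SimpleGraph.Adj.reachable ?_)
      exact hz
  have := hne.to_subtype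
  exact ⟨fun u w => key u _ w rfl⟩

/-- The vertices with two distinct neighbours span an invariant subtree, which is everything by
minimality once it is nonempty. -/
theorem branching_of_isMinimal {Γ : Subgroup (T ≃g T)} (hT : T.IsTree) (hne : IsNonElementary Γ)
    (hmin : IsMinimal Γ) : Branching T := by
  have hS : {v : V | ∃ u w, u ≠ w ∧ T.Adj v u ∧ T.Adj v w}.Nonempty := by
    by_contra hemp
    have huniq : ∀ v u w, T.Adj v u → T.Adj v w → u = w := by
      intro v u w hu hw
      by_contra huw
      exact hemp ⟨v, u, w, huw, hu, hw⟩
    obtain ⟨v⟩ := hT.1.nonempty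
    obtain ⟨u, hu⟩ : ∃ u, ∀ w, T.Adj v w → w = u := by
      by_cases h : ∃ u, T.Adj v u
      · obtain ⟨u, hu⟩ := h
        exact ⟨u, fun w hw => huniq v w u hw hu⟩
      · exact ⟨v, fun w hw => (h ⟨w, hw⟩).elim⟩
    have hall : ∀ w, w = v ∨ w = u := by
      have hstep : ∀ {x y : V}, T.Adj x y → (x = v ∨ x = u) → (y = v ∨ y = u) := by
        intro x y h hx
        by_cases hxv : x = v
        · exact Or.inr (hu _ (hxv ▸ h))
        · have hxu : x = u := hx.resolve_left hxv
          obtain ⟨q⟩ := hT.1.preconnected v x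
          cases q with
          | nil => exact (hxv rfl).elim
          | cons h' _ =>
            have := hu _ h'
            subst this
            subst hxu
            exact Or.inl (huniq _ _ _ h h'.symm)
      have : ∀ {x y : V}, T.Walk x y → (x = v ∨ x = u) → (y = v ∨ y = u) := by
        intro x y p
        induction p with
        | nil => exact id
        | cons h _ ih =>
          exact fun hx => ih (hstep h hx)
      intro w
      obtain ⟨p⟩ := hT.1.preconnected v w
      exact this p (Or.inl rfl)
    -- Otherwise `T` has at most two vertices, and its vertex set is an invariant set forbidden by
    -- non-elementarity.
    refine hne (Set.range Sum.inl) ⟨_, v, rfl⟩ ?_ fun γ => ?_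
    · have : (Set.range Sum.inl : Set (V ⊕ Ends T)) ⊆ {Sum.inl v, Sum.inl u} := by
        rintro _ ⟨w, rfl⟩
        rcases hall w with rfl | rfl
        · exact Or.inl rfl
        · exact Or.inr rfl
      refine (Set.encard_le_encard this).trans ((Set.encard_insert_le _ _).trans ?_)
      rw [Set.encard_singleton]
      exact one_add_one_eq_two.le
    · ext p
      constructor
      · rintro ⟨_, ⟨w, rfl⟩, rfl⟩
        exact ⟨γ • w, rfl⟩
      · rintro ⟨w, rfl⟩
        exact ⟨Sum.inl (γ⁻¹ • w), ⟨_, rfl⟩, by simp⟩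
  have huniv := hmin _ (connected_induce_branching hT hS) (by
    rintro γ v ⟨u, w, huw, hu, hw⟩
    exact ⟨γ • u, γ • w, fun h => huw (smul_left_cancel γ h),
      (γ : T ≃g T).map_rel_iff.2 hu, (γ : T ≃g T).map_rel_iff.2 hw⟩)
  intro v u
  obtain ⟨a, b, hab, ha, hb⟩ : v ∈ {v : V | ∃ u w, u ≠ w ∧ T.Adj v u ∧ T.Adj v w} := by
    rw [huniv]; trivial
  by_cases h : a = u
  · exact ⟨b, fun hb' => hab (h.trans hb'.symm), hb⟩
  · exact ⟨a, h, ha⟩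

theorem exists_ray_of_adj (hT : T.IsTree) (hb : Branching T) {u v : V} (h : T.Adj u v) :
    ∃ r : Ray T, r.toFun 0 = u ∧ r.toFun 1 = v := by
  choose f hf hadj using hb
  let p : ℕ → T.Dart := fun n =>
    Nat.rec ⟨(u, v), h⟩ (fun _ d => ⟨(d.snd, f d.snd d.fst), hadj d.snd d.fst⟩) n
  exact ⟨Ray.ofNB hT (fun n => (p n).fst) (fun n => (p n).adj)
    (fun n => (hf (p n).snd (p n).fst).symm), rfl, rfl⟩

theorem exists_geodesic_extending (hT : T.IsTree) (hb : Branching T) (r : Ray T) :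
    ∃ ℓ : Geodesic T, ∀ n : ℕ, ℓ.toFun n = r.toFun n := by
  obtain ⟨w, hw, hadj⟩ := hb (r.toFun 0) (r.toFun 1)
  obtain ⟨r', h0, h1⟩ := exists_ray_of_adj hT hb hadj
  obtain ⟨ℓ, hℓ⟩ := exists_geodesic_of_rays hT r' r h0 (by rw [h1]; exact hw)
  exact ⟨ℓ, fun n => (hℓ n).1⟩

theorem exists_geodesic_edge (hT : T.IsTree) (hb : Branching T) (d : T.Dart) :
    ∃ ℓ : Geodesic T, ℓ.edge 0 = d := by
  obtain ⟨r, h0, h1⟩ := exists_ray_of_adj hT hb d.adj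
  obtain ⟨ℓ, hℓ⟩ := exists_geodesic_extending hT hb r
  exact ⟨ℓ, dart_ext ((hℓ 0).trans h0) ((hℓ 1).trans h1)⟩

end Branching

/-! ### Transitions: allowed if and only if realised by a geodesic. -/

namespace CuspDecomposition.Lifts

variable {V : Type*} {T : SimpleGraph V} {Γ : Subgroup (T ≃g T)} {D : CuspDecomposition Γ}
  {s : D.Lifts}

open Geodesic

/-- A line `L` extending the cusp ray is followed up to `v_{i,n+1}`, then left along the reversed
image `gL`. The two halves fit because `g` fixes `v_{i,n+1}` and moves `v_{i,n}`. -/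
theorem exists_turning_geodesic (hT : T.IsTree) (hb : Branching T) {i : Fin D.r} {n : ℕ} {g : Γ}
    (hg : g ∈ s.turn i n) : ∃ ℓ : Geodesic T, Ascends s ℓ i n ∧
      ∀ k ≤ n, ℓ.edge (1 + k : ℕ) = g • (s.aLift i (n - k)).symm := by
  obtain ⟨L, hL⟩ := exists_geodesic_extending hT hb (s.vRay i)
  have hL' : ∀ k : ℕ, L.toFun k = s.vx i k := hL
  obtain ⟨ℓ, hℓ⟩ := exists_geodesic_of_rays hT (L.negRay (n + 1)) (Ray.map g (L.negRay (n + 1)))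
    (by
      change L.toFun (n + 1 - (0 : ℕ)) = g • L.toFun (n + 1 - (0 : ℕ))
      have := hL' (n + 1)
      push_cast at this ⊢
      rw [sub_zero, this]
      exact hg.1.symm)
    (by
      change L.toFun (n + 1 - (1 : ℕ)) ≠ g • L.toFun (n + 1 - (1 : ℕ))
      rw [show (n + 1 - (1 : ℕ) : ℤ) = n by push_cast; ring, hL']
      exact fun h => hg.2 h.symm)
  have h1 : ∀ k : ℕ, ℓ.toFun k = g • L.toFun (n + 1 - k) := fun k => (hℓ k).1
  have h2 : ∀ k : ℕ, ℓ.toFun (-k) = L.toFun (n + 1 - k) := fun k => (hℓ k).2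
  -- The translation puts the turning vertex at time `1`, so that the edge at time `0` is the last
  -- ascending one.
  refine ⟨ℓ.shift (-1), fun k hk => ?_, fun k hk => dart_ext ?_ ?_⟩
  · change ℓ.toFun (-n + k + -1) = _
    have := h2 (n + 1 - k)
    rw [show (-((n + 1 - k : ℕ) : ℤ)) = -n + k + -1 by omega,
      show ((n : ℤ) + 1 - (n + 1 - k : ℕ)) = k by omega, hL'] at this
    exact this
  · change ℓ.toFun ((1 + k : ℕ) + -1) = g • (s.aLift i (n - k)).snd
    rw [aLift_snd, show ((1 + k : ℕ) + -1 : ℤ) = (k : ℕ) by push_cast; ring, h1, ← hL']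
    congr 2
    omega
  · change ℓ.toFun ((1 + k : ℕ) + 1 + -1) = g • s.vx i (n - k)
    rw [show ((1 + k : ℕ) + 1 + -1 : ℤ) = (k + 1 : ℕ) by push_cast; ring, h1, ← hL']
    congr 2
    omega

theorem cellUp_nonempty (hT : T.IsTree) (hb : Branching T) (β : s.Letter) :
    (s.cellUp β).Nonempty := by
  have hasc : ∀ i n, (s.cellUp (.edge (D.a i n))).Nonempty := by
    intro i n
    obtain ⟨L, hL⟩ := exists_geodesic_extending hT hb (s.vRay i)
    have hL' : ∀ k : ℕ, L.edge k = s.aLift i k := fun k =>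
      dart_ext (hL k) (by rw [aLift_snd]; exact hL (k + 1))
    refine ⟨L.shift n, (mem_cellUp_a _).2 ?_⟩
    rw [shift_edge, shift_edge, shift_edge, zero_add, neg_add_cancel, hL', add_comm 1 (n : ℤ)]
    exact ⟨rfl, hL' (n + 1), hL' 0⟩
  have hup : ∀ i n c, (s.cellUp (.up i n c)).Nonempty := by
    intro i n c
    obtain ⟨g, hg, hc⟩ := c.2
    obtain ⟨ℓ, h1, h2⟩ := exists_turning_geodesic hT hb hg
    have e0 := h1.edges (le_refl n)
    have e1 := h1.edges (Nat.zero_le n)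
    rw [neg_add_cancel] at e0
    rw [Nat.cast_zero, add_zero] at e1
    exact ⟨ℓ, g, hc, e0, h2 0 (Nat.zero_le n), e1⟩
  cases β with
  | edge e =>
    rcases D.edge_cases e with he | ⟨i, n, rfl | rfl⟩
    · obtain ⟨ℓ, hℓ⟩ := exists_geodesic_edge hT hb (s.lift e)
      exact ⟨ℓ, (mem_cellUp_core he ℓ).2 hℓ⟩
    · exact hasc i n
    · obtain ⟨ℓ, hℓ⟩ := hasc i n
      exact ⟨ℓ.rev, rev_mem_cellUp.2 hℓ⟩
  | up i n c => exact hup i n c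
  | down i n c =>
    obtain ⟨ℓ, hℓ⟩ := hup i n c.inv
    refine ⟨ℓ.rev, ?_⟩
    have := rev_mem_cellUp.2 hℓ
    rwa [show (Letter.up i n c.inv : s.Letter).rev = .down i n c.inv.inv from rfl,
      c.inv_inv] at this

/-- The edge of `X` followed by the geodesics of a cell at time `0`. -/
def Letter.base : s.Letter → QEdge Γ
  | .edge e => e
  | .up i n _ => D.a i n
  | .down i n _ => (D.a i n).rev

theorem qe_edge_zero (hT : T.IsTree) {β : s.Letter} {ℓ : Geodesic T} (h : ℓ ∈ s.cellUp β) :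
    qe Γ (ℓ.edge 0) = β.base := by
  rcases cellUp_cases hT h with ⟨e, he, rfl, h0⟩ | ⟨i, n, h0, ⟨rfl, -⟩ | ⟨c, rfl, -⟩⟩ |
    ⟨i, n, h0, rfl | ⟨c, rfl⟩⟩
  · rw [h0, qe_lift]; rfl
  · exact h0.qe_eq
  · exact h0.qe_eq
  · exact h0.qe_eq_rev
  · exact h0.qe_eq_rev

/-- Apart from the turn `(g,+) → (g,-)`, all transition rules say the same thing: the base edges can
be concatenated in `X` without backtracking. `trans_cases` is the converse. -/
theorem trans_of_base {α β : s.Letter} (hα : ∀ i n c, α ≠ .up i n c)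
    (hβ : ∀ i n c, β ≠ .down i n c) (h1 : β.base.o = α.base.t) (h2 : β.base ≠ α.base.rev) :
    s.Trans α β := by
  cases α with
  | up i n c => exact absurd rfl (hα i n c)
  | edge e =>
    cases β with
    | down i n c => exact absurd rfl (hβ i n c)
    | edge f => exact ⟨h1.symm, h2⟩
    | up i n c =>
      refine ⟨h1.symm, ?_⟩
      rintro rfl
      exact h2 (QEdge.rev_rev _).symm
  | down i n c =>
    have h2' : β.base ≠ D.a i n := fun h => h2 (by rw [h]; exact (QEdge.rev_rev _).symm)
    cases β with
    | down i n c => exact absurd rfl (hβ i n c)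
    | edge f => exact ⟨h1, h2'⟩
    | up j m c' => exact ⟨h1, h2'⟩

theorem trans_cases {α β : s.Letter} (h : s.Trans α β) :
    ((∀ i n c, α ≠ .up i n c) ∧ (∀ i n c, β ≠ .down i n c) ∧
      β.base.o = α.base.t ∧ β.base ≠ α.base.rev) ∨
    ∃ i n c c', α = .up i n c ∧ β = .down i n c' ∧ ∃ g ∈ s.turn i n, c.Rep g ∧ c'.Rep g := by
  cases α with
  | up i n c =>
    cases β with
    | down j m c' =>
      obtain ⟨⟨rfl, rfl⟩, h⟩ := h
      exact Or.inr ⟨i, n, c, c', rfl, rfl, h⟩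
    | edge f => exact h.elim
    | up j m c' => exact h.elim
  | edge e =>
    cases β with
    | down i n c => exact h.elim
    | edge f => exact Or.inl ⟨by simp, by simp, h.1.symm, h.2⟩
    | up i n c =>
      refine Or.inl ⟨by simp, by simp, h.1.symm, fun h' => h.2 ?_⟩
      change D.a i n = e.rev at h'
      rw [h', QEdge.rev_rev]
  | down i n c =>
    have key : ∀ e : QEdge Γ, e ≠ D.a i n → e ≠ (D.a i n).rev.rev := fun e he => by
      rwa [QEdge.rev_rev]
    cases β with
    | down i n c => exact h.elim
    | edge f => exact Or.inl ⟨by simp, by simp, h.1, key _ h.2⟩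
    | up j m c' => exact Or.inl ⟨by simp, by simp, h.1, key _ h.2⟩

theorem cellUp_of_agree_le (hT : T.IsTree) {ℓ ℓ' : Geodesic T} {t : ℤ} (ht : 1 ≤ t)
    (hc : qv Γ (ℓ.toFun t) ∈ D.coreVert) (h : ∀ k ≤ t, ℓ.toFun k = ℓ'.toFun k)
    {β : s.Letter} (hβ : ℓ ∈ s.cellUp β) : ℓ' ∈ s.cellUp β := by
  rw [← rev_mem_cellUp] at hβ ⊢
  refine cellUp_of_agree_ge hT (t := 1 - t) (by omega) ?_ (fun k hk => h (1 - k) (by omega)) hβ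
  change qv Γ (ℓ.toFun (1 - (1 - t))) ∈ _
  rwa [sub_sub_cancel]

theorem shift_mem_of_ascends {ℓ : Geodesic T} {i : Fin D.r} {n : ℕ}
    (h : Ascends s ℓ i (n + 1)) : ℓ.shift (-1) ∈ s.cellUp (.edge (D.a i n)) := by
  have e : ∀ k : ℕ, k ≤ n + 1 → (ℓ.shift (-1)).edge (-n + k) = s.aLift i k := by
    intro k hk
    rw [shift_edge, ← h.edges hk]
    congr 1
    push_cast
    ring
  rw [mem_cellUp_a]
  refine ⟨?_, ?_, ?_⟩
  · simpa using e n (by omega)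
  · rw [← e (n + 1) le_rfl]
    congr 1
    push_cast
    ring
  · simpa using e 0 (by omega)

theorem shift_mem_of_ascends_rev {ℓ : Geodesic T} {i : Fin D.r} {n : ℕ}
    (h : Ascends s ℓ.rev i (n + 1)) : ℓ.shift 1 ∈ s.cellUp (.edge (D.a i n).rev) := by
  have := rev_mem_cellUp.2 (shift_mem_of_ascends h)
  rwa [← rev_shift, Geodesic.rev_rev] at this

/-- The past of one geodesic is glued to the future of a translate of the other at a core vertex;
since a core vertex screens off the other side, neither letter changes. -/
theorem exists_geodesic_of_core (hT : T.IsTree) {α β : s.Letter} {ℓ ℓ' : Geodesic T}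
    (hα : ℓ ∈ s.cellUp α) (hβ : ℓ' ∈ s.cellUp β) (hc : α.base.t ∈ D.coreVert)
    (h1 : β.base.o = α.base.t) (h2 : β.base ≠ α.base.rev) :
    ∃ (L : Geodesic T) (γ : Γ), L ∈ s.cellUp α ∧ γ • L.shift 1 ∈ s.cellUp β := by
  have hv : qv Γ (ℓ.toFun 1) = α.base.t := by
    rw [← qe_edge_zero hT hα, qe_t]; rfl
  have hv' : qv Γ (ℓ'.toFun 0) = β.base.o := by
    rw [← qe_edge_zero hT hβ, qe_o]; rfl
  obtain ⟨γ, hγ⟩ := qv_eq_iff.1 (hv.trans (h1.symm.trans hv'.symm))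
  obtain ⟨ℓ'', h⟩ := exists_geodesic_of_rays hT (ℓ.negRay 1) ((γ • ℓ').posRay 0) (by
      change ℓ.toFun (1 - (0 : ℕ)) = γ • ℓ'.toFun (0 + (0 : ℕ))
      simpa using hγ.symm) (by
      change ℓ.toFun (1 - (1 : ℕ)) ≠ γ • ℓ'.toFun (0 + (1 : ℕ))
      rw [Nat.cast_one, sub_self, zero_add]
      intro h
      apply h2
      rw [← qe_edge_zero hT hα, ← qe_edge_zero hT hβ, ← qe_symm]
      exact qe_eq_iff.2 ⟨γ⁻¹, by
        refine dart_ext ?_ ?_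
        · change γ⁻¹ • ℓ.toFun 1 = ℓ'.toFun 0
          rw [← hγ, inv_smul_smul]
        · change γ⁻¹ • ℓ.toFun 0 = ℓ'.toFun 1
          rw [h, inv_smul_smul]⟩)
  have hn : ∀ k ≤ 1, ℓ.toFun k = (ℓ''.shift (-1)).toFun k := by
    intro k hk
    have := (h (1 - k).toNat).2
    change ℓ''.toFun _ = ℓ.toFun (1 - (1 - k).toNat) at this
    rw [show (-((1 - k).toNat : ℤ)) = k + -1 by omega,
      show (1 - ((1 - k).toNat : ℤ)) = k by omega] at this
    exact this.symm
  have hp : ∀ k, 0 ≤ k → ℓ'.toFun k = (γ⁻¹ • ℓ'').toFun k := by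
    intro k hk
    have := (h k.toNat).1
    change ℓ''.toFun _ = γ • ℓ'.toFun (0 + k.toNat) at this
    rw [zero_add, Int.toNat_of_nonneg hk] at this
    change _ = γ⁻¹ • ℓ''.toFun k
    rw [this, inv_smul_smul]
  refine ⟨ℓ''.shift (-1), γ⁻¹, cellUp_of_agree_le hT le_rfl (by rwa [hv]) hn hα, ?_⟩
  rw [shift_shift, neg_add_cancel, shift_zero]
  exact cellUp_of_agree_ge hT le_rfl (by rwa [hv', h1]) hp hβ

theorem exists_geodesic_of_trans (hT : T.IsTree) (hb : Branching T) {α β : s.Letter}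
    (h : s.Trans α β) :
    ∃ (L : Geodesic T) (γ : Γ), L ∈ s.cellUp α ∧ γ • L.shift 1 ∈ s.cellUp β := by
  obtain ⟨ℓ, hα⟩ := cellUp_nonempty hT hb α
  obtain ⟨ℓ', hβ⟩ := cellUp_nonempty hT hb β
  rcases trans_cases h with ⟨hu, hd, h1, h2⟩ | ⟨i, n, c, c', rfl, rfl, g, hg, hc, hc'⟩
  · by_cases hcore : α.base.t ∈ D.coreVert
    · exact exists_geodesic_of_core hT hα hβ hcore h1 h2
    · simp only [coreVert, Set.mem_ofPred_eq, not_forall, not_not] at hcore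
      obtain ⟨i, n, hin⟩ := hcore
      -- Inside a cusp there are only two edges at the junction, so the path continues its ascent or
      -- its descent. The letter higher in the cusp already contains the information of the lower
      -- one, and no gluing is needed.
      rcases D.glued i n β.base (h1.trans hin) with hb' | hb' <;>
        rcases D.glued i n α.base.rev hin with ha | ha
      · exact absurd (hb'.trans ha.symm) h2
      · have ha' : α = .edge (D.a i n) := by
          have ha := QEdge.rev_inj.1 ha
          cases α with
          | edge e => exact congrArg _ ha
          | up j m c => exact absurd rfl (hu j m c)
          | down j m c => exact absurd ha.symm (D.a_ne_rev _ _ _ _)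
        refine ⟨ℓ'.shift (-1), 1, ?_, by rwa [one_smul, shift_shift, neg_add_cancel, shift_zero]⟩
        rw [ha']
        refine shift_mem_of_ascends ?_
        have hq := qe_edge_zero hT hβ
        rw [hb'] at hq
        rcases cellUp_cases hT hβ with ⟨e, he, rfl, -⟩ | ⟨j, m, h0, -⟩ | ⟨j, m, h0, -⟩
        · exact absurd hb' (he _ _).1
        · have := h0.qe_eq
          rw [hq] at this
          obtain ⟨rfl, rfl⟩ := D.a_inj this
          exact h0
        · have := h0.qe_eq_rev
          rw [hq] at this
          exact absurd this (D.a_ne_rev _ _ _ _)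
      · have hb'' : β = .edge (D.a i n).rev := by
          cases β with
          | edge e => exact congrArg _ hb'
          | down j m c => exact absurd rfl (hd j m c)
          | up j m c => exact absurd hb' (D.a_ne_rev _ _ _ _)
        refine ⟨ℓ, 1, hα, ?_⟩
        rw [one_smul, hb'']
        refine shift_mem_of_ascends_rev ?_
        have hq := qe_edge_zero hT hα
        rw [← QEdge.rev_rev α.base, ha] at hq
        rcases cellUp_cases hT hα with ⟨e, he, rfl, -⟩ | ⟨j, m, h0, -⟩ | ⟨j, m, h0, -⟩
        · refine absurd ?_ (he i (n + 1)).2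
          rw [← ha]; exact (QEdge.rev_rev _).symm
        · have := h0.qe_eq
          rw [hq] at this
          exact absurd this.symm (D.a_ne_rev _ _ _ _)
        · have := h0.qe_eq_rev
          rw [hq] at this
          obtain ⟨rfl, rfl⟩ := D.a_inj (QEdge.rev_inj.1 this)
          exact h0
      · exact absurd (hb'.trans ha.symm) h2
  · obtain ⟨ℓ, h1, h2⟩ := exists_turning_geodesic hT hb hg
    have e0 := h1.edges (le_refl n)
    have e1 := h1.edges (Nat.zero_le n)
    rw [neg_add_cancel] at e0
    rw [Nat.cast_zero, add_zero] at e1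
    refine ⟨ℓ, g⁻¹, ⟨g, hc, e0, h2 0 (Nat.zero_le n), e1⟩, g, hc', ?_, ?_, ?_⟩
    · have := h2 0 (Nat.zero_le n)
      rw [smul_edge, shift_edge, inv_smul_eq_iff]
      exact this
    · rw [smul_edge, shift_edge, neg_add_cancel, e0]
    · have := h2 n le_rfl
      rw [Nat.sub_self] at this
      rw [smul_edge, shift_edge, inv_smul_eq_iff, ← this]
      congr 1
      push_cast
      ring

theorem trans_of_geodesic (hT : T.IsTree) (hD : D.IsFree) {α β : s.Letter} {ℓ : Geodesic T}
    {γ : Γ} (hα : ℓ ∈ s.cellUp α) (hβ : γ • ℓ.shift 1 ∈ s.cellUp β) : s.Trans α β := by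
  have h0 := qe_edge_zero hT hα
  have h1 : qe Γ (ℓ.edge 1) = β.base := by
    rw [← qe_edge_zero hT hβ, smul_edge, qe_smul, shift_edge, zero_add]
  -- The projected path backtracks exactly at turns in a cusp.
  by_cases hrev : qe Γ (ℓ.edge 1) = (qe Γ (ℓ.edge 0)).rev
  · obtain ⟨i, n, hin⟩ := hD.exists_turn hrev rfl (ℓ.edge_succ_ne 0)
    rw [hin] at hrev
    rcases cellUp_cases hT hα with ⟨e, he, rfl, -⟩ | ⟨j, m, ha, h2⟩ | ⟨j, m, ha, -⟩
    · exact absurd (h0.symm.trans hin) (he i n).1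
    · obtain ⟨rfl, rfl⟩ := D.a_inj (ha.qe_eq.symm.trans hin)
      rcases h2 with ⟨rfl, h2⟩ | ⟨c, rfl, -⟩
      · rw [h2, qe_aLift] at hrev
        exact absurd hrev (D.a_ne_rev _ _ _ _)
      -- The element normalising the descent is the inverse of a representative of the turn, and it
      -- is also the transition element between the two normalisations.
      · obtain ⟨γ', hγ'⟩ := s.descend hD (i := j) (n := m) (ℓ.posRay 1) hrev
        have hd : ∀ k ≤ m, γ' • ℓ.edge (1 + k : ℕ) = (s.aLift j (m - k)).symm := by
          intro k hk
          refine dart_ext ?_ ?_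
          · change _ = (s.aLift j (m - k)).snd
            rw [aLift_snd, show m - k + 1 = m + 1 - k by omega, ← hγ' k (by omega)]
            change γ' • ℓ.toFun _ = γ' • ℓ.toFun _
            congr 2
          · change _ = s.vx j (m - k)
            rw [show m - k = m + 1 - (k + 1) by omega, ← hγ' (k + 1) (by omega)]
            change γ' • ℓ.toFun _ = γ' • ℓ.toFun _
            congr 2
        have hd0 : ℓ.edge 1 = γ'⁻¹ • (s.aLift j m).symm :=
          eq_inv_smul_iff.2 (hd 0 (Nat.zero_le m))
        have e0 := ha.edges (le_refl m)
        have e1 := ha.edges (Nat.zero_le m)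
        rw [neg_add_cancel] at e0
        rw [Nat.cast_zero, add_zero] at e1
        have hturn := mem_turn_of_edge hD e0 hd0
        let c₁ : s.UpTurn j m := ⟨QuotientGroup.mk γ'⁻¹, γ'⁻¹, hturn, rfl⟩
        let c₂ : s.DownTurn j m :=
          ⟨Quotient.mk (QuotientGroup.rightRel (s.grp j m)) γ'⁻¹, γ'⁻¹, hturn, rfl⟩
        have hc₁ : ℓ ∈ s.cellUp (.up j m c₁) := ⟨γ'⁻¹, rfl, e0, hd0, e1⟩
        have hc₂ : γ' • ℓ.shift 1 ∈ s.cellUp (.down j m c₂) := by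
          refine ⟨γ'⁻¹, rfl, ?_, ?_, ?_⟩
          · rw [smul_edge, shift_edge]
            exact hd 0 (Nat.zero_le m)
          · rw [smul_edge, shift_edge, neg_add_cancel, e0, _root_.inv_inv]
          · rw [smul_edge, shift_edge, ← Nat.sub_self m, ← hd m le_rfl]
            congr 2
            push_cast
            ring
        have u1 := (code_unique hT hD (γ := 1) hα (by rwa [one_smul])
          : (1 : Γ) = 1 ∧ _ = Letter.up j m c₁).2
        have u2 := (code_unique hT hD (γ := γ * γ'⁻¹) hc₂ (by rwa [mul_smul, inv_smul_smul])).2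
        rw [u1, ← u2]
        exact ⟨⟨rfl, rfl⟩, γ'⁻¹, hturn, rfl, rfl⟩
    · exact absurd (hin.symm.trans ha.qe_eq_rev) (D.a_ne_rev _ _ _ _)
  · refine trans_of_base ?_ ?_ ?_ ?_
    · rintro i n c rfl
      obtain ⟨g, -, h2, h3, -⟩ := hα
      apply hrev
      rw [h3, h2, qe_smul, qe_symm]
    · rintro i n c rfl
      obtain ⟨g, -, h2, h3, -⟩ := hβ
      apply hrev
      rw [h1]
      rw [smul_edge, shift_edge, neg_add_cancel, smul_eq_iff_eq_inv_smul] at h3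
      rw [h3, qe_smul, qe_smul, qe_aLift]
      rfl
    · rw [← h0, ← h1, qe_o, qe_t]
      rfl
    · rwa [← h0, ← h1]

end CuspDecomposition.Lifts

/-! ### Consequences of uniformity: finitely many classes of edges. -/

section Lattice

variable {V : Type*} {T : SimpleGraph V}

theorem ncard_neighborSet_iso (φ : T ≃g T) (v : V) :
    (T.neighborSet (φ v)).ncard = (T.neighborSet v).ncard :=
  (Nat.card_congr (φ.mapNeighborSet v)).symm

theorem finite_dart_quotient (hlf : ∀ v, (T.neighborSet v).Finite) (Γ : Subgroup (T ≃g T))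
    [Finite (MulAction.orbitRel.Quotient Γ V)] : Finite (MulAction.orbitRel.Quotient Γ T.Dart) := by
  have : ∀ v, Finite (T.neighborSet v) := fun v => hlf v
  let f : (Σ x : QVert Γ, T.neighborSet x.out) → QEdge Γ :=
    fun p => qe Γ ⟨(p.1.out, p.2.1), p.2.2⟩
  refine Finite.of_surjective f fun e => ?_
  obtain ⟨d, rfl⟩ : ∃ d, qe Γ d = e := ⟨e.out, Quotient.out_eq e⟩
  obtain ⟨γ, hγ⟩ := qv_eq_iff.1
    (show qv Γ (qv Γ d.fst).out = qv Γ d.fst from Quotient.out_eq _)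
  refine ⟨⟨qv Γ d.fst, γ • d.snd, ?_⟩, ?_⟩
  · rw [← hγ]
    exact (γ : T ≃g T).map_rel_iff.2 d.adj
  · exact qe_eq_iff.2 ⟨γ, dart_ext hγ rfl⟩

theorem exists_iso_of_dart_classes (hlf : ∀ v, (T.neighborSet v).Finite) (hunif : IsUniform T) :
    ∃ F : ℕ, ∀ d : ℕ → T.Dart, ∃ a b, a < b ∧ b ≤ F ∧ ∃ φ : T ≃g T, φ • d a = d b := by
  obtain ⟨G, -, -, hG⟩ := hunif
  have := finite_dart_quotient hlf G
  refine ⟨Nat.card (QEdge G), fun d => ?_⟩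
  have hlt : Nat.card (QEdge G) < Nat.card (Fin (Nat.card (QEdge G) + 1)) := by simp
  obtain ⟨a, b, hab, h⟩ : ∃ a b : Fin (Nat.card (QEdge G) + 1), a ≠ b ∧
      qe G (d a) = qe G (d b) := by
    by_contra! hinj
    refine (Nat.card_le_card_of_injective (fun a : Fin (Nat.card (QEdge G) + 1) =>
      qe G (d a)) fun a b h => ?_).not_gt hlt
    by_contra hab
    exact hinj a b hab h
  rcases lt_or_gt_of_ne hab with hlt | hlt
  · obtain ⟨γ, hγ⟩ := qe_eq_iff.1 h.symm
    exact ⟨a, b, hlt, by omega, γ, hγ⟩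
  · obtain ⟨γ, hγ⟩ := qe_eq_iff.1 h
    exact ⟨b, a, hlt, by omega, γ, hγ⟩

end Lattice

/-! ### Growth and periodicity of the groups along a cusp. -/

namespace CuspDecomposition.Lifts

variable {V : Type*} {T : SimpleGraph V} {Γ : Subgroup (T ≃g T)} {D : CuspDecomposition Γ}
  (s : D.Lifts)

theorem grp_zero (hD : D.IsFree) (i : Fin D.r) : s.grp i 0 = ⊥ :=
  (Subgroup.eq_bot_iff_forall _).2 fun γ hγ => hD _ (s.qv_vx_zero i) γ hγ

theorem grp_le_succ (hD : D.IsFree) (i : Fin D.r) (n : ℕ) : s.grp i n ≤ s.grp i (n + 1) := by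
  rcases n with _ | n
  · rw [s.grp_zero hD]
    exact bot_le
  · intro γ hγ
    have := D.cuspidal i n (s.aLift i (n + 1)) (s.lift_mk _) γ hγ
    rw [aLift_snd] at this
    exact this

theorem grp_mono (hD : D.IsFree) (i : Fin D.r) : Monotone (s.grp i) :=
  monotone_nat_of_le_succ (s.grp_le_succ hD i)

theorem smul_vx_eq (hD : D.IsFree) {i : Fin D.r} {n m : ℕ} (hnm : n ≤ m) {γ : Γ}
    (h : γ ∈ s.grp i n) : γ • s.vx i m = s.vx i m :=
  s.grp_mono hD i hnm h

theorem adj_vx (i : Fin D.r) (n : ℕ) : T.Adj (s.vx i n) (s.vx i (n + 1)) := (s.vRay i).adj n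

theorem exists_grp_smul (hD : D.IsFree) {i : Fin D.r} {n : ℕ} {u : V}
    (h : T.Adj (s.vx i (n + 1)) u) (hu : u ≠ s.vx i (n + 2)) :
    ∃ g ∈ s.grp i (n + 1), g • s.vx i n = u := by
  let d : T.Dart := ⟨(s.vx i (n + 1), u), h⟩
  rcases D.glued i n (qe Γ d) (s.qv_vx i (n + 1)) with h1 | h1
  · refine absurd ?_ hu
    rw [← aLift_snd, ← s.dart_eq_aLift hD h1 rfl]
  · rw [← s.qe_aLift i n, ← qe_symm] at h1
    obtain ⟨γ, hγ⟩ := qe_eq_iff.1 h1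
    refine ⟨γ, ?_, congrArg (fun d : T.Dart => d.snd) hγ⟩
    have := congrArg (fun d : T.Dart => d.fst) hγ
    change γ • (s.aLift i n).snd = _ at this
    rwa [aLift_snd] at this

/-- Orbit–stabiliser: `Γ_{i,n+1}` acts transitively on the neighbours of `v_{i,n+1}` other than
`v_{i,n+2}`, with stabiliser `Γ_{i,n}` at `v_{i,n}`. -/
theorem card_grp_succ (hD : D.IsFree) (i : Fin D.r) (n : ℕ) :
    Nat.card (s.grp i (n + 1)) =
      Nat.card (s.grp i n) * ((T.neighborSet (s.vx i (n + 1))).ncard - 1) := by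
  have h1 := ((s.grp i n).subgroupOf (s.grp i (n + 1))).card_mul_index
  have h2 : MulAction.stabilizer (s.grp i (n + 1)) (s.vx i n) =
      (s.grp i n).subgroupOf (s.grp i (n + 1)) := rfl
  have h3 := MulAction.index_stabilizer (s.grp i (n + 1)) (s.vx i n)
  have h4 : MulAction.orbit (s.grp i (n + 1)) (s.vx i n) =
      T.neighborSet (s.vx i (n + 1)) \ {s.vx i (n + 2)} := by
    ext u
    constructor
    · rintro ⟨⟨g, hg⟩, rfl⟩
      have hg' : g • s.vx i (n + 1) = s.vx i (n + 1) := hg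
      change T.Adj (s.vx i (n + 1)) (g • s.vx i n) ∧ g • s.vx i n ≠ s.vx i (n + 2)
      constructor
      · rw [← hg']
        exact (g : T ≃g T).map_rel_iff.2 (s.adj_vx i n).symm
      · rw [← s.smul_vx_eq hD (Nat.le_succ _) hg]
        exact fun h => absurd (s.vx_injective i (smul_left_cancel g h)) (by omega)
    · rintro ⟨h, h'⟩
      obtain ⟨g, hg, rfl⟩ := s.exists_grp_smul hD h h'
      exact ⟨⟨g, hg⟩, rfl⟩
  have h5 : (T.neighborSet (s.vx i (n + 1)) \ {s.vx i (n + 2)}).ncard = _ :=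
    Set.ncard_sdiff_singleton_of_mem (s.adj_vx i (n + 1))
  rw [← h1, ← h2, h3, h4, h2, h5,
    Nat.card_congr (Subgroup.subgroupOfEquivOfLe (s.grp_le_succ hD i n)).toEquiv]

/-- An automorphism of `T` carrying an edge of the cusp ray to the one `p` steps higher can be
corrected, by transitivity of the cusp group on the lower neighbours, to do the same one level
below. Valences at heights `j` and `j + p` thus agree all the way down. -/
theorem exists_period (hlf : ∀ v, (T.neighborSet v).Finite) (hunif : IsUniform T)
    (hD : D.IsFree) (i : Fin D.r) :
    ∃ p, 1 ≤ p ∧ ∀ j, (T.neighborSet (s.vx i (j + p))).ncard =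
      (T.neighborSet (s.vx i j)).ncard := by
  have key : ∀ n p (φ : T ≃g T), 1 ≤ p → φ (s.vx i n) = s.vx i (n + p) →
      φ (s.vx i (n + 1)) = s.vx i (n + 1 + p) → ∀ j ≤ n,
      (T.neighborSet (s.vx i (j + p))).ncard = (T.neighborSet (s.vx i j)).ncard := by
    intro n p φ hp
    induction n generalizing φ with
    | zero =>
      intro h _ j hj
      obtain rfl := Nat.le_zero.1 hj
      rw [← h, ncard_neighborSet_iso]
    | succ n ih =>
      intro h h' j hj
      rcases Nat.of_le_succ hj with hj | rfl
      · obtain ⟨q, rfl⟩ : ∃ q, p = q + 1 := ⟨p - 1, by omega⟩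
        obtain ⟨g, hg, hgu⟩ := s.exists_grp_smul hD (i := i) (n := n + (q + 1))
          (u := φ (s.vx i n)) (by
            rw [show n + (q + 1) + 1 = n + 1 + (q + 1) by omega, ← h]
            exact φ.map_rel_iff.2 (s.adj_vx i n).symm) (by
            rw [show n + (q + 1) + 2 = n + 1 + 1 + (q + 1) by omega, ← h']
            exact fun e => absurd (s.vx_injective i (φ.injective e)) (by omega))
        refine ih (((g⁻¹ : Γ) : T ≃g T) * φ) ?_ ?_ j hj
        · change g⁻¹ • φ (s.vx i n) = _
          rw [← hgu, inv_smul_smul]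
        · change g⁻¹ • φ (s.vx i (n + 1)) = _
          rw [h, show n + 1 + (q + 1) = n + (q + 1) + 1 by omega]
          exact (s.grp i _).inv_mem hg
      · rw [← h, ncard_neighborSet_iso]
  obtain ⟨F, hF⟩ := exists_iso_of_dart_classes hlf hunif
  by_contra! hno
  choose! f hf using hno
  -- If every `p ≤ F` fails, it does so at some height `f p`. Beyond all these heights, the
  -- pigeonhole principle still produces an admissible translation length `b - a ≤ F`, a
  -- contradiction.
  let N := (Finset.range (F + 1)).sup f
  obtain ⟨a, b, hab, hbF, φ, hφ⟩ := hF fun n => s.aLift i (N + n)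
  have h1 : φ (s.vx i (N + a)) = s.vx i (N + b) := congrArg (fun d : T.Dart => d.fst) hφ
  have h2 : φ (s.aLift i (N + a)).snd = (s.aLift i (N + b)).snd :=
    congrArg (fun d : T.Dart => d.snd) hφ
  rw [aLift_snd, aLift_snd] at h2
  refine hf (b - a) (by omega) (key (N + a) (b - a) φ (by omega) ?_ ?_ _ ?_)
  · rw [h1]; congr 1; omega
  · rw [h2]; congr 1; omega
  · exact (Finset.le_sup (f := f) (Finset.mem_range.2 (by omega))).trans (Nat.le_add_right _ _)

theorem exists_card_grp_add (hlf : ∀ v, (T.neighborSet v).Finite) (hunif : IsUniform T)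
    (hD : D.IsFree) (i : Fin D.r) : ∃ p, 1 ≤ p ∧ ∀ k,
      Nat.card (s.grp i (k + p)) = Nat.card (s.grp i p) * Nat.card (s.grp i k) := by
  obtain ⟨p, hp, h⟩ := s.exists_period hlf hunif hD i
  refine ⟨p, hp, fun k => ?_⟩
  induction k with
  | zero => rw [s.grp_zero hD, zero_add]; simp
  | succ k ih =>
    rw [s.card_grp_succ hD i k, ← mul_assoc, ← ih, ← h (k + 1),
      show k + 1 + p = k + p + 1 by omega, s.card_grp_succ hD]

theorem two_mul_card_grp_le (hlf : ∀ v, (T.neighborSet v).Finite)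
    (hval : ∀ v, (T.neighborSet v).ncard ≠ 2) (hb : Branching T) (hD : D.IsFree) (i : Fin D.r)
    (n : ℕ) : 2 * Nat.card (s.grp i n) ≤ Nat.card (s.grp i (n + 1)) := by
  rw [s.card_grp_succ hD, mul_comm 2]
  refine Nat.mul_le_mul_left _ ?_
  have h1 : 1 < (T.neighborSet (s.vx i (n + 1))).ncard := by
    obtain ⟨w, hw, hadj⟩ := hb (s.vx i (n + 1)) (s.vx i n)
    exact (Set.one_lt_ncard (hlf _)).2 ⟨w, hadj, s.vx i n, (s.adj_vx i n).symm, hw⟩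
  have := hval (s.vx i (n + 1))
  omega

end CuspDecomposition.Lifts

/-- The factor `e^{-δ}`. -/
noncomputable def rate (δ : ℝ) : ℝ≥0∞ := ENNReal.ofReal (Real.exp (-δ))

theorem rate_pow (δ : ℝ) (n : ℕ) : rate δ ^ n = ENNReal.ofReal (Real.exp (-δ * n)) := by
  rw [rate, ← ENNReal.ofReal_pow (Real.exp_nonneg _), ← Real.exp_nat_mul, mul_comm]

theorem rate_ne_zero (δ : ℝ) : rate δ ≠ 0 := by simp [rate, Real.exp_pos]

theorem rate_ne_top (δ : ℝ) : rate δ ≠ ⊤ := ENNReal.ofReal_ne_top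

/-! ### Conformality and equivariance on shadows and points. -/

section Conformal

variable {V : Type*} {T : SimpleGraph V} {Γ : Subgroup (T ≃g T)} {δ : ℝ}
  {μ : V → Measure (Ends T)}

theorem IsPattersonSullivan.eq_rate_pow_mul (hT : T.IsTree) (hμ : IsPattersonSullivan Γ δ μ)
    {x y : V} {A : Set (Ends T)} (hA : MeasurableSet A) (h : A ⊆ shadow x y) :
    μ x A = rate δ ^ T.dist x y * μ y A := by
  rw [hμ.conformal x y, withDensity_apply _ hA, ← setLIntegral_const, rate_pow]
  refine setLIntegral_congr_fun hA fun ξ hξ => ?_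
  simp only [busemann_of_onRay hT (h hξ)]

theorem IsPattersonSullivan.rate_pow_mul_le (hT : T.IsTree) (hμ : IsPattersonSullivan Γ δ μ)
    (hδ : 0 ≤ δ) (x y : V) {A : Set (Ends T)} (hA : MeasurableSet A) :
    rate δ ^ T.dist x y * μ y A ≤ μ x A := by
  rw [hμ.conformal x y, withDensity_apply _ hA, ← setLIntegral_const, rate_pow]
  refine lintegral_mono fun ξ => ENNReal.ofReal_le_ofReal (Real.exp_le_exp.2 ?_)
  obtain ⟨z, hx, hy⟩ := exists_onRay_onRay hT x y ξ
  rw [busemann_eq hT hx hy]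
  have : (T.dist x z : ℝ) ≤ T.dist x y + T.dist y z := by
    exact_mod_cast hT.1.dist_triangle
  nlinarith

theorem IsPattersonSullivan.smul_shadow (hμ : IsPattersonSullivan Γ δ μ)
    (γ : Γ) (x a b : V) : μ (γ • x) (shadow (γ • a) (γ • b)) = μ x (shadow a b) := by
  rw [← hμ.equivariant γ x, Measure.map_apply (measurable_smul_ends γ) (measurableSet_shadow _ _)]
  congr 1
  ext ξ
  exact onRay_smul_iff γ

theorem measurableSingleton_ends [Countable V] (hT : T.IsTree) :
    MeasurableSingletonClass (Ends T) := by
  have := t0Space_ends hT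
  have : MeasurableSpace.CountablySeparated (Ends T) := inferInstance
  exact MeasurableSpace.measurableSingletonClass_of_countablySeparated

theorem IsPattersonSullivan.smul_singleton [Countable V] (hT : T.IsTree)
    (hμ : IsPattersonSullivan Γ δ μ) (γ : Γ) (x : V) (ξ : Ends T) :
    μ (γ • x) {γ • ξ} = μ x {ξ} := by
  have := measurableSingleton_ends hT
  rw [← hμ.equivariant γ x, Measure.map_apply (measurable_smul_ends γ)
    (measurableSet_singleton _)]
  congr 1
  ext η
  exact smul_left_cancel_iff γ

end Conformal

section Fibers

/-- Grouping indices by their point bounds the multiplicity by `w`; distinct points have disjoint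
singletons. It is applied to the translates of the end of a cusp. -/
theorem tsum_measure_singleton_le {ι E : Type*} [MeasurableSpace E]
    [MeasurableSingletonClass E] (m : Measure E) (f : ι → E) (w : ℕ∞)
    (hw : ∀ y, ENat.card {a // f a = y} ≤ w) : ∑' a, m {f a} ≤ w * m Set.univ := by
  rw [← (Equiv.sigmaFiberEquiv f).tsum_eq, ENNReal.tsum_sigma']
  calc ∑' (y : E) (b : {a // f a = y}), m {f b}
      ≤ ∑' y : E, (w : ℝ≥0∞) * m {y} := by
        refine ENNReal.tsum_le_tsum fun y => ?_
        have : ∀ b : {a // f a = y}, m {f b} = m {y} := fun b => by rw [b.2]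
        simp only [this, ENNReal.tsum_const]
        gcongr
        exact hw y
    _ = w * ∑' y : E, m {y} := ENNReal.tsum_mul_left
    _ ≤ w * m Set.univ := by
        gcongr
        refine tsum_measure_le_measure_univ
          (fun y => (measurableSet_singleton y).nullMeasurableSet) fun x y hxy => ?_
        exact Disjoint.aedisjoint (Set.disjoint_singleton.2 hxy)

end Fibers

/-! ### Excursions in the cusps and the measures of their shadows. -/

section Excursions

variable {V : Type*} {T : SimpleGraph V}

theorem Ray.exists_cons (hT : T.IsTree) (r : Ray T) {u : V} (h : T.Adj u (r.toFun 0))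
    (hu : u ≠ r.toFun 1) :
    ∃ r' : Ray T, r'.toEnd = r.toEnd ∧ r'.toFun 0 = u ∧ ∀ k, r'.toFun (k + 1) = r.toFun k := by
  let p : ℕ → V := fun k => Nat.casesOn k u r.toFun
  refine ⟨Ray.ofNB hT p (fun k => ?_) (fun k => ?_), ?_, rfl, fun k => rfl⟩
  · cases k with
    | zero => exact h
    | succ k => exact r.adj k
  · cases k with
    | zero => exact hu
    | succ k => exact r.nb k
  · refine Ray.toEnd_eq_iff.2 ⟨1, 0, fun k => ?_⟩
    rw [add_comm, zero_add]
    rfl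

theorem exists_ray_of_onRay_adj (hT : T.IsTree) {x y : V} {ξ : Ends T} (h : T.Adj x y)
    (hξ : OnRay x ξ y) : ∃ r : Ray T, r.toFun 0 = x ∧ r.toFun 1 = y ∧ r.toEnd = ξ := by
  have hξ' := hξ
  obtain ⟨r, h0, hr, -⟩ := hξ'
  subst h0
  refine ⟨r, rfl, ?_, hr⟩
  subst hr
  exact (OnRay.eq_of_dist hT hξ (k := 1) (SimpleGraph.dist_eq_one_iff_adj.2 h)).symm

end Excursions

namespace CuspDecomposition.Lifts

variable {V : Type*} {T : SimpleGraph V} {Γ : Subgroup (T ≃g T)} {D : CuspDecomposition Γ}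
  (s : D.Lifts)

/-- A ray entering a cusp either goes to its end or turns back and returns to the core. -/
theorem excursion (hD : D.IsFree) {i : Fin D.r} (r : Ray T)
    (h0 : r.toFun 0 = s.vx i 0) (h1 : r.toFun 1 = s.vx i 1) :
    (∀ k, r.toFun k = s.vx i k) ∨ ∃ n, ∃ g ∈ s.grp i (n + 1), (∀ k ≤ n + 1, r.toFun k = s.vx i k) ∧
      r.toFun (n + 2) ≠ s.vx i (n + 2) ∧
      ∀ k ≤ n + 1, r.toFun (n + 1 + k) = g • s.vx i (n + 1 - k) := by
  classical
  by_cases hall : ∀ k, r.toFun k = s.vx i k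
  · exact Or.inl hall
  right
  push Not at hall
  have hmin : ∀ k < Nat.find hall, r.toFun k = s.vx i k := fun k hk => by
    simpa using Nat.find_min hall hk
  have hne := Nat.find_spec hall
  obtain ⟨n, hn⟩ : ∃ n, Nat.find hall = n + 2 := by
    refine ⟨Nat.find hall - 2, ?_⟩
    have a0 : Nat.find hall ≠ 0 := fun h => hne (by rw [h]; exact h0)
    have a1 : Nat.find hall ≠ 1 := fun h => hne (by rw [h]; exact h1)
    omega
  rw [hn] at hmin hne
  have hq : qv Γ (r.toFun (n + 1)) = (D.a i (n + 1)).o := by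
    rw [hmin _ (by omega), qv_vx]
  rcases D.glued i n (qe Γ (r.edge (n + 1))) hq with h2 | h2
  · refine absurd ?_ hne
    have h3 := s.dart_eq_aLift hD h2 (hmin _ (by omega))
    rw [← aLift_snd, ← h3]
    rfl
  · obtain ⟨γ, hγ⟩ := s.descend hD (r.tail (n + 1)) h2
    refine ⟨n, γ⁻¹, (s.grp i (n + 1)).inv_mem ?_, fun k hk => hmin k (by omega), hne,
      fun k hk => ?_⟩
    · have := hγ 0 (by omega)
      change γ • r.toFun (n + 1) = _ at this
      rwa [hmin _ (by omega)] at this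
    · rw [← hγ k hk, inv_smul_smul]
      rfl

theorem exists_ray_of_turned_back (hT : T.IsTree) {i : Fin D.r} {ξ : Ends T}
    (hξ : ξ ∈ shadow (s.vx i 1) (s.vx i 0)) (N : ℕ) :
    ∃ r : Ray T, r.toEnd = ξ ∧ ∀ k ≤ N + 1, r.toFun k = s.vx i (N + 1 - k) := by
  induction N with
  | zero =>
    obtain ⟨r, h0, h1, hr⟩ := exists_ray_of_onRay_adj hT (s.adj_vx i 0).symm hξ
    refine ⟨r, hr, fun k hk => ?_⟩
    interval_cases k
    · exact h0
    · exact h1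
  | succ N ih =>
    obtain ⟨r, hr, hk⟩ := ih
    obtain ⟨r', hr', h0, hs⟩ := r.exists_cons hT (u := s.vx i (N + 2)) (by
      rw [hk 0 (by omega)]
      exact (s.adj_vx i (N + 1)).symm) (by
      rw [hk 1 (by omega)]
      exact fun h => absurd (s.vx_injective i h) (by omega))
    refine ⟨r', hr'.trans hr, fun k hk' => ?_⟩
    cases k with
    | zero => exact h0
    | succ k =>
      rw [hs, hk k (by omega)]
      congr 1
      omega

theorem dist_vx (hT : T.IsTree) (i : Fin D.r) (n : ℕ) : T.dist (s.vx i 0) (s.vx i n) = n :=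
  (s.vRay i).dist_zero hT n

theorem turned_back_subset (hT : T.IsTree) (i : Fin D.r) (n : ℕ) :
    (shadow (s.vx i 1) (s.vx i 0) : Set (Ends T)) ⊆ shadow (s.vx i (n + 1)) (s.vx i 0) := by
  intro ξ hξ
  obtain ⟨r, rfl, hr⟩ := s.exists_ray_of_turned_back hT hξ n
  exact ⟨r, hr 0 (by omega), rfl, n + 1, by rw [hr _ le_rfl, Nat.sub_self]⟩

/-- The ends whose ray from the end of the cusp enters the core at `g • v_0`. -/
def exitShadow (i : Fin D.r) (g : Γ) : Set (Ends T) := shadow (g • s.vx i 1) (g • s.vx i 0)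

theorem exitShadow_subset (hT : T.IsTree) (hD : D.IsFree) {i : Fin D.r} {n : ℕ} {g : Γ}
    (hg : g ∈ s.grp i (n + 1)) :
    s.exitShadow i g ⊆ shadow (s.vx i (n + 1)) (g • s.vx i 0) := by
  intro ξ hξ
  have h1 : OnRay (g • s.vx i 1) (g • g⁻¹ • ξ) (g • s.vx i 0) := by rwa [smul_inv_smul]
  have h2 := onRay_smul g (s.turned_back_subset hT i n ((onRay_smul_iff g).1 h1))
  rw [smul_inv_smul, s.smul_vx_eq hD le_rfl hg] at h2
  exact h2

/-- Seen from `v_{i,n+1}`, the exits `g v_0` and `h v_0` are equally far; on a common ray they would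
coincide, and `v_0` has trivial stabiliser. -/
theorem exitShadow_disjoint (hT : T.IsTree) (hD : D.IsFree) {i : Fin D.r} {n : ℕ} {g h : Γ}
    (hg : g ∈ s.grp i (n + 1)) (hh : h ∈ s.grp i (n + 1)) (hne : g ≠ h) :
    Disjoint (s.exitShadow i g) (s.exitShadow i h) := by
  rw [Set.disjoint_left]
  intro ξ h1 h2
  obtain ⟨r, h0, rfl⟩ := exists_ray_from hT (s.vx i (n + 1)) ξ
  have hd : ∀ k ∈ s.grp i (n + 1), T.dist (s.vx i (n + 1)) (k • s.vx i 0) = n + 1 := by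
    intro k hk
    rw [← s.smul_vx_eq hD le_rfl hk, dist_smul, SimpleGraph.dist_comm, s.dist_vx hT]
  have e1 := s.exitShadow_subset hT hD hg h1
  have e2 := s.exitShadow_subset hT hD hh h2
  have d1 := hd g hg
  have d2 := hd h hh
  rw [← h0] at e1 e2 d1 d2
  have e := (OnRay.eq_of_dist hT e1 d1).trans (OnRay.eq_of_dist hT e2 d2).symm
  refine hne (inv_mul_eq_one.1 (hD _ (s.qv_vx_zero i) _ ?_))
  rw [mul_smul, ← e, inv_smul_smul]

/-- A ray climbing exactly to height `n + 1` turns there and descends along a translate of the cusp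
ray by an element of `Γ_{i,n+1}`. -/
theorem shadow_diff_subset (hT : T.IsTree) (hD : D.IsFree) (i : Fin D.r) (n : ℕ) :
    (shadow (s.vx i 0) (s.vx i (n + 1)) \ shadow (s.vx i 0) (s.vx i (n + 2)) : Set (Ends T)) ⊆
      ⋃ g : s.grp i (n + 1), s.exitShadow i g := by
  rintro ξ ⟨h1, h2⟩
  obtain ⟨r, h0, rfl⟩ := exists_ray_from hT (s.vx i 0) ξ
  have hn : s.vx i (n + 1) = r.toFun (n + 1) := by
    rw [← h0] at h1
    refine OnRay.eq_of_dist hT h1 ?_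
    rw [h0, s.dist_vx hT]
  have hk : ∀ k ≤ n + 1, r.toFun k = s.vx i k := fun k hk =>
    Ray.eq_of_eq_at hT (r := r) (r' := s.vRay i) h0 hn.symm hk
  rcases s.excursion hD r h0 (hk 1 (by omega)) with hall | ⟨m, g, hg, hm, hm', hg'⟩
  · refine absurd ?_ h2
    rw [← hall 0, ← hall (n + 2)]
    exact r.onRay (n + 2)
  · obtain rfl : m = n := by
      rcases lt_trichotomy m n with h | h | h
      · exact absurd (hk (m + 2) (by omega)) hm'
      · exact h
      · refine absurd ?_ h2
        rw [← hm 0 (by omega), ← hm (n + 2) (by omega)]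
        exact r.onRay (n + 2)
    refine Set.mem_iUnion.2 ⟨⟨g, hg⟩, ?_⟩
    have e0 := hg' m (by omega)
    have e1 := hg' (m + 1) le_rfl
    rw [show m + 1 - m = 1 by omega] at e0
    rw [Nat.sub_self] at e1
    change OnRay (g • s.vx i 1) r.toEnd (g • s.vx i 0)
    rw [← e0, ← e1, ← Ray.toEnd_tail r (m + 1 + m)]
    exact (r.tail (m + 1 + m)).onRay 1

variable {δ : ℝ} {μ : V → Measure (Ends T)}

theorem measure_vx_exitShadow (hT : T.IsTree) (hD : D.IsFree) (hμ : IsPattersonSullivan Γ δ μ)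
    {i : Fin D.r} {n : ℕ} {g : Γ} (hg : g ∈ s.grp i (n + 1)) :
    μ (s.vx i (n + 1)) (s.exitShadow i g) =
      rate δ ^ (n + 1) * μ (s.vx i 0) (shadow (s.vx i 1) (s.vx i 0)) := by
  conv_lhs => rw [← s.smul_vx_eq hD le_rfl hg]
  rw [exitShadow, hμ.smul_shadow, hμ.eq_rate_pow_mul hT (measurableSet_shadow _ _)
    (s.turned_back_subset hT i n), SimpleGraph.dist_comm, s.dist_vx hT]

/-- Each of the `|Γ_{i,n+1}|` possible exits costs `n + 1` steps up and `n + 1` steps down, whence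
the exponent `2(n + 1)`. -/
theorem measure_shadow_diff_le (hT : T.IsTree) (hD : D.IsFree) (hdisc : IsDiscreteGroup Γ)
    (hμ : IsPattersonSullivan Γ δ μ) (i : Fin D.r) (n : ℕ) :
    μ (s.vx i 0) (shadow (s.vx i 0) (s.vx i (n + 1)) \ shadow (s.vx i 0) (s.vx i (n + 2))) ≤
      Nat.card (s.grp i (n + 1)) * rate δ ^ (2 * (n + 1)) *
        μ (s.vx i 0) (shadow (s.vx i 1) (s.vx i 0)) := by
  have hfin : Finite (s.grp i (n + 1)) := hdisc _
  rw [hμ.eq_rate_pow_mul hT (y := s.vx i (n + 1))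
    ((measurableSet_shadow _ _).diff (measurableSet_shadow _ _)) Set.sdiff_subset,
    s.dist_vx hT]
  calc _ ≤ rate δ ^ (n + 1) * ∑' g : s.grp i (n + 1),
        μ (s.vx i (n + 1)) (s.exitShadow i g) := by
        gcongr
        exact (measure_mono (s.shadow_diff_subset hT hD i n)).trans (measure_iUnion_le _)
    _ = _ := by
        simp only [fun g : s.grp i (n + 1) => s.measure_vx_exitShadow hT hD hμ g.2,
          ENNReal.tsum_const, ENat.card_eq_coe_natCard]
        rw [two_mul, pow_add]
        simp only [ENat.toENNReal_coe]
        ring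

theorem le_measure_exitShadow (hT : T.IsTree) (hD : D.IsFree)
    (hμ : IsPattersonSullivan Γ δ μ) (hδ : 0 ≤ δ) {i : Fin D.r} {n : ℕ} {g : Γ}
    (hg : g ∈ s.grp i (n + 1)) :
    rate δ ^ (2 * (n + 1)) * μ (s.vx i 0) (shadow (s.vx i 1) (s.vx i 0)) ≤
      μ (s.vx i 0) (s.exitShadow i g) := by
  refine le_trans (le_of_eq ?_) (hμ.rate_pow_mul_le hT hδ (s.vx i 0) (s.vx i (n + 1))
    (A := s.exitShadow i g) (measurableSet_shadow _ _))
  rw [s.dist_vx hT, s.measure_vx_exitShadow hT hD hμ hg, two_mul, pow_add, mul_assoc]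

end CuspDecomposition.Lifts

/-- Sorted by residues modulo `p`, the sum is a finite sum of geometric series of ratio `c`. -/
theorem tsum_ne_top_of_add_eq_mul {f : ℕ → ℝ≥0∞} {p : ℕ} (hp : 1 ≤ p) {c : ℝ≥0∞} (hc : c < 1)
    (hf : ∀ n, f n ≠ ⊤) (h : ∀ n, f (n + p) = c * f n) : ∑' n, f n ≠ ⊤ := by
  have : NeZero p := ⟨by omega⟩
  have hk : ∀ k r, f (k * p + r) = c ^ k * f r := by
    intro k r
    induction k with
    | zero => simp
    | succ k ih =>
      rw [show (k + 1) * p + r = k * p + r + p by ring, h, ih, pow_succ']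
      ring
  rw [← (Nat.divModEquiv p).symm.tsum_eq, ENNReal.tsum_prod', ENNReal.tsum_comm, tsum_fintype]
  refine (ENNReal.sum_lt_top.2 fun r _ => ?_).ne
  have : ∀ k, f ((Nat.divModEquiv p).symm (k, r)) = c ^ k * f r := fun k => by
    rw [← hk]; simp [Nat.divModEquiv, mul_comm]
  simp only [this]
  rw [ENNReal.tsum_mul_right, ENNReal.tsum_geometric]
  exact ENNReal.mul_lt_top (ENNReal.inv_lt_top.2 (tsub_pos_of_lt hc)) (hf _).lt_top

theorem rate_pow_injective {δ : ℝ} (h : rate δ < 1) : Function.Injective fun n => rate δ ^ n := by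
  have hδ : δ ≠ 0 := by
    rintro rfl
    simp [rate] at h
  intro a b hab
  simp only [rate_pow] at hab
  have := Real.exp_injective
    ((ENNReal.ofReal_eq_ofReal_iff (Real.exp_nonneg _) (Real.exp_nonneg _)).1 hab)
  simpa [hδ] using this

/-! ### Convergence of the cusp series, and the effect of an atom at a cusp. -/

namespace CuspDecomposition.Lifts

variable {V : Type*} {T : SimpleGraph V} {Γ : Subgroup (T ≃g T)} {D : CuspDecomposition Γ}
  (s : D.Lifts) {δ : ℝ} {μ : V → Measure (Ends T)}

theorem exists_turn_mem (hlf : ∀ v, (T.neighborSet v).Finite)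
    (hval : ∀ v, (T.neighborSet v).ncard ≠ 2) (hb : Branching T) (hD : D.IsFree)
    (hdisc : IsDiscreteGroup Γ) (i : Fin D.r) (n : ℕ) : ∃ g, g ∈ s.turn i n := by
  by_contra! hno
  have hle : s.grp i (n + 1) ≤ s.grp i n := fun g hg => by
    by_contra h
    exact hno g ⟨hg, h⟩
  have h1 := s.two_mul_card_grp_le hlf hval hb hD i n
  rw [le_antisymm hle (s.grp_le_succ hD i n)] at h1
  have hfin : Finite (s.grp i n) := hdisc _
  have : 0 < Nat.card (s.grp i n) := Nat.card_pos
  omega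

theorem measure_turned_back_ne_zero (hT : T.IsTree) (hb : Branching T)
    (hμ : IsPattersonSullivan Γ δ μ) (i : Fin D.r) :
    μ (s.vx i 0) (shadow (s.vx i 1) (s.vx i 0)) ≠ 0 := by
  obtain ⟨r, h0, h1⟩ := exists_ray_of_adj hT hb (s.adj_vx i 0).symm
  refine (hμ.pos_of_isOpen _ (isOpen_shadow _ _) ⟨r.toEnd, ?_⟩).ne'
  exact ⟨r, h0, rfl, 1, h1⟩

/-- At each level `n`, `|Γ_{i,n}|` exit shadows of mass at least a constant times `e^{-2δn}` are
found, disjoint over all levels, in a space of finite measure. -/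
theorem tsum_card_grp_ne_top (hT : T.IsTree) (hlf : ∀ v, (T.neighborSet v).Finite)
    (hval : ∀ v, (T.neighborSet v).ncard ≠ 2) (hb : Branching T) (hD : D.IsFree)
    (hdisc : IsDiscreteGroup Γ) (hμ : IsPattersonSullivan Γ δ μ) (hδ : 0 ≤ δ) (i : Fin D.r) :
    ∑' n, (Nat.card (s.grp i n) : ℝ≥0∞) * rate δ ^ (2 * n) ≠ ⊤ := by
  have := hμ.finite (s.vx i 0)
  have hcount : Countable V := countable_of_locallyFinite hT hlf
  have : Countable Γ := countable_of_isDiscreteGroup hT hdisc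
  choose t ht using s.exists_turn_mem hlf hval hb hD hdisc i
  set M := μ (s.vx i 0) (shadow (s.vx i 1) (s.vx i 0)) with hM
  -- Multiplying `Γ_{i,n}` by some `t_n ∈ Γ_{i,n+1} - Γ_{i,n}` moves it off `Γ_{i,n}`, so that
  -- different levels never share an element.
  let A : (Σ n, s.grp i n) → Set (Ends T) := fun p => s.exitShadow i (p.2 * t p.1)
  have hmem : ∀ p : Σ n, s.grp i n, (p.2 * t p.1 : Γ) ∈ s.grp i (p.1 + 1) := fun p =>
    mul_mem (s.grp_le_succ hD i p.1 p.2.2) (ht p.1).1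
  have hnot : ∀ p : Σ n, s.grp i n, (p.2 * t p.1 : Γ) ∉ s.grp i p.1 := fun p h =>
    (ht p.1).2 (((s.grp i p.1).mul_mem_cancel_left p.2.2).1 h)
  have hinj : ∀ p q : Σ n, s.grp i n, (p.2 * t p.1 : Γ) = q.2 * t q.1 → p = q := by
    rintro ⟨n, g⟩ ⟨m, h⟩ he
    have h1 : ∀ p q : Σ n, s.grp i n, (p.2 * t p.1 : Γ) = q.2 * t q.1 → p.1 ≤ q.1 := by
      intro p q he
      by_contra! hlt
      exact hnot p (he ▸ s.grp_mono hD i hlt (hmem q))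
    obtain rfl : n = m := le_antisymm (h1 _ _ he) (h1 _ _ he.symm)
    congr 1
    exact Subtype.ext (mul_right_cancel he)
  have hdisj : Pairwise (Function.onFun Disjoint A) := by
    intro p q hpq
    have h1 := s.grp_mono hD i (show p.1 + 1 ≤ max p.1 q.1 + 1 by omega) (hmem p)
    have h2 := s.grp_mono hD i (show q.1 + 1 ≤ max p.1 q.1 + 1 by omega) (hmem q)
    exact s.exitShadow_disjoint hT hD h1 h2 fun h => hpq (hinj _ _ h)
  have hle := (tsum_meas_le_meas_iUnion_of_disjoint (μ (s.vx i 0))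
    (fun p => measurableSet_shadow _ _) hdisj).trans (measure_mono (Set.subset_univ _))
  rw [ENNReal.tsum_sigma'] at hle
  have hlow : (∑' n, (Nat.card (s.grp i n) : ℝ≥0∞) * rate δ ^ (2 * n)) * (rate δ ^ 2 * M) ≤
      μ (s.vx i 0) Set.univ := by
    refine le_trans ?_ hle
    rw [← ENNReal.tsum_mul_right]
    refine ENNReal.tsum_le_tsum fun n => ?_
    have hfin : Finite (s.grp i n) := hdisc _
    calc _ = ∑' g : s.grp i n, rate δ ^ (2 * (n + 1)) * M := by
          rw [ENNReal.tsum_const, ENat.card_eq_coe_natCard, mul_add, pow_add]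
          simp only [ENat.toENNReal_coe]
          ring
      _ ≤ _ := ENNReal.tsum_le_tsum fun g => s.le_measure_exitShadow hT hD hμ hδ (hmem ⟨n, g⟩)
  intro htop
  rw [htop, ENNReal.top_mul] at hlow
  · exact measure_ne_top _ _ (top_le_iff.1 hlow)
  · exact mul_ne_zero (pow_ne_zero _ (rate_ne_zero δ)) (s.measure_turned_back_ne_zero hT hb hμ i)

theorem one_le_card_grp (hdisc : IsDiscreteGroup Γ) (i : Fin D.r) (n : ℕ) :
    (1 : ℝ≥0∞) ≤ Nat.card (s.grp i n) := by
  have hfin : Finite (s.grp i n) := hdisc _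
  exact_mod_cast (Nat.card_pos : 0 < Nat.card (s.grp i n))

theorem rate_lt_one_of_tsum (hdisc : IsDiscreteGroup Γ) {i : Fin D.r} {q : ℝ≥0∞}
    (h : ∑' n, (Nat.card (s.grp i n) : ℝ≥0∞) * q ^ (2 * n) ≠ ⊤) : q < 1 := by
  by_contra! hq
  refine h (top_le_iff.1 ?_)
  have : ∑' _ : ℕ, (1 : ℝ≥0∞) = ⊤ := by simp
  rw [← this]
  exact ENNReal.tsum_le_tsum fun n =>
    one_le_mul (s.one_le_card_grp hdisc i n) (one_le_pow_of_one_le' hq _)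

/-- By periodicity the terms repeat with ratio `|Γ_{i,p}| q^{2p}` every `p` steps, so convergence
amounts to this ratio being `< 1`, an open condition on `q`. -/
theorem eventually_tsum_card_grp_ne_top (hlf : ∀ v, (T.neighborSet v).Finite)
    (hunif : IsUniform T) (hD : D.IsFree) (hdisc : IsDiscreteGroup Γ) {i : Fin D.r} {q : ℝ≥0∞}
    (h : ∑' n, (Nat.card (s.grp i n) : ℝ≥0∞) * q ^ (2 * n) ≠ ⊤) :
    ∀ᶠ q' in 𝓝 q, ∑' n, (Nat.card (s.grp i n) : ℝ≥0∞) * q' ^ (2 * n) ≠ ⊤ := by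
  obtain ⟨p, hp, hw⟩ := s.exists_card_grp_add hlf hunif hD i
  have hrec : ∀ (x : ℝ≥0∞) n, (Nat.card (s.grp i (n + p)) : ℝ≥0∞) * x ^ (2 * (n + p)) =
      (Nat.card (s.grp i p) * x ^ (2 * p)) * (Nat.card (s.grp i n) * x ^ (2 * n)) := by
    intro x n
    rw [hw n, mul_add, pow_add]
    push_cast
    ring
  have hlt : (Nat.card (s.grp i p) : ℝ≥0∞) * q ^ (2 * p) < 1 := by
    by_contra! hge
    have h1 := ENNReal.tendsto_atTop_zero_of_tsum_ne_top h
    have h2 : ∀ k, 1 ≤ (Nat.card (s.grp i (k * p)) : ℝ≥0∞) * q ^ (2 * (k * p)) := by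
      intro k
      induction k with
      | zero => simpa using s.one_le_card_grp hdisc i 0
      | succ k ih =>
        rw [add_mul, one_mul, hrec]
        exact one_le_mul hge ih
    obtain ⟨N, hN⟩ := eventually_atTop.1 (h1.eventually (gt_mem_nhds one_pos))
    exact (hN (N * p) (Nat.le_mul_of_pos_right _ hp)).not_ge (h2 N)
  have hcont : Continuous fun x : ℝ≥0∞ => (Nat.card (s.grp i p) : ℝ≥0∞) * x ^ (2 * p) :=
    (ENNReal.continuous_const_mul (ENNReal.natCast_ne_top _)).comp (ENNReal.continuous_pow _)
  have hq : q < ⊤ := (s.rate_lt_one_of_tsum hdisc h).trans ENNReal.one_lt_top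
  filter_upwards [hcont.continuousAt.eventually (gt_mem_nhds hlt), gt_mem_nhds hq] with x hx hxt
  exact tsum_ne_top_of_add_eq_mul hp hx
    (fun n => ENNReal.mul_ne_top (ENNReal.natCast_ne_top _) (ENNReal.pow_ne_top hxt.ne)) (hrec x)

/-- The end of a cusp. -/
def cuspEnd (i : Fin D.r) : Ends T := (s.vRay i).toEnd

/-- The ray from `x` to the end of the cusp joins the lifted cusp ray at a first vertex `v_{i,n}`,
and the segment from `x` to `v_{i,0}` passes through it. -/
theorem exists_first_onRay (hT : T.IsTree) (i : Fin D.r) (x : V) :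
    ∃ n, OnRay x (s.cuspEnd i) (s.vx i n) ∧
      T.dist x (s.vx i 0) = T.dist x (s.vx i n) + n := by
  classical
  have hex : ∃ n, OnRay x (s.cuspEnd i) (s.vx i n) := by
    obtain ⟨z, h1, h2⟩ := exists_onRay_onRay hT x (s.vx i 0) (s.cuspEnd i)
    refine ⟨T.dist (s.vx i 0) z, ?_⟩
    have := OnRay.eq_of_dist hT (r := s.vRay i) h2 rfl
    rw [this] at h1
    exact h1
  refine ⟨Nat.find hex, Nat.find_spec hex, ?_⟩
  have hspec := Nat.find_spec hex
  set n := Nat.find hex with hn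
  have hfar : 1 ≤ n → T.dist x (s.vx i (n - 1)) = T.dist x (s.vx i n) + 1 := by
    intro h1
    have hadj : T.Adj (s.vx i n) (s.vx i (n - 1)) := by
      have := (s.adj_vx i (n - 1)).symm
      rwa [Nat.sub_add_cancel h1] at this
    refine (dist_step hT x hadj).resolve_right fun h2 => ?_
    refine Nat.find_min hex (show n - 1 < Nat.find hex by omega) ?_
    refine (onRay_iff_eventually hT _ _ _).2 ?_
    filter_upwards [(onRay_iff_eventually hT _ _ _).1 hspec, eventually_ge_atTop n] with k hk hnk
    have e1 : T.dist (s.vx i n) (s.vx i k) = k - n := by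
      have := (s.vRay i).dist_eq hT n (k - n)
      rwa [show n + (k - n) = k by omega] at this
    have e2 : T.dist (s.vx i (n - 1)) (s.vx i k) = k - (n - 1) := by
      have := (s.vRay i).dist_eq hT (n - 1) (k - (n - 1))
      rwa [show n - 1 + (k - (n - 1)) = k by omega] at this
    change T.dist x (s.vx i k) = T.dist x (s.vx i n) + T.dist (s.vx i n) (s.vx i k) at hk
    change T.dist x (s.vx i k) = T.dist x (s.vx i (n - 1)) + T.dist (s.vx i (n - 1)) (s.vx i k)
    omega
  have h := nb_dist hT x (fun k => s.vx i (n - k)) n (fun k hk => by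
    have := (s.adj_vx i (n - (k + 1))).symm
    rwa [show n - (k + 1) + 1 = n - k by omega] at this) (fun k hk he => by
    have := s.vx_injective i he
    omega) hfar n le_rfl
  rwa [Nat.sub_self] at h

/-- With `ξ` the end of the cusp, `c` its mass and `N(γ)` the height at which the rays merge,
conformality gives `c e^{-δ d(v_0, γ v_0)} = e^{-2δN(γ)} μ{γξ}`. At most `|Γ_{i,n}|` elements with
`N(γ) = n` have the same `γξ`, so the Poincaré series is dominated by the cusp series times the
total mass. -/
theorem tsum_dist_ne_top_of_atom [Countable V] (hT : T.IsTree) (hdisc : IsDiscreteGroup Γ)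
    (hμ : IsPattersonSullivan Γ δ μ) {i : Fin D.r}
    (hsum : ∑' n, (Nat.card (s.grp i n) : ℝ≥0∞) * rate δ ^ (2 * n) ≠ ⊤)
    (hc : μ (s.vx i 0) {s.cuspEnd i} ≠ 0) :
    ∑' γ : Γ, rate δ ^ T.dist (s.vx i 0) (γ • s.vx i 0) ≠ ⊤ := by
  have := hμ.finite
  have hsing := measurableSingleton_ends hT
  set ξ := s.cuspEnd i
  set c := μ (s.vx i 0) {ξ} with hcdef
  have hq0 := rate_ne_zero δ
  have hqt := rate_ne_top δ
  have hq1 := s.rate_lt_one_of_tsum hdisc hsum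
  have hray : ∀ n, OnRay (s.vx i 0) ξ (s.vx i n) := fun n => (s.vRay i).onRay n
  choose N hN hNd using fun γ : Γ => s.exists_first_onRay hT i (γ⁻¹ • s.vx i 0)
  have hmass : ∀ γ : Γ, rate δ ^ T.dist (γ⁻¹ • s.vx i 0) (s.vx i (N γ)) * c =
      rate δ ^ N γ * μ (s.vx i 0) {γ • ξ} := by
    intro γ
    have h1 := hμ.eq_rate_pow_mul hT (measurableSet_singleton ξ)
      (Set.singleton_subset_iff.2 (hN γ))
    have h2 := hμ.eq_rate_pow_mul hT (measurableSet_singleton ξ)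
      (Set.singleton_subset_iff.2 (hray (N γ)))
    have h3 := hμ.smul_singleton hT γ (γ⁻¹ • s.vx i 0) ξ
    rw [smul_inv_smul] at h3
    rw [s.dist_vx hT] at h2
    rw [h3, h1, hcdef, h2]
    ring
  have hterm : ∀ γ : Γ, rate δ ^ T.dist (s.vx i 0) (γ • s.vx i 0) * c =
      rate δ ^ (2 * N γ) * μ (s.vx i 0) {γ • ξ} := by
    intro γ
    rw [← dist_smul γ⁻¹, inv_smul_smul, hNd, pow_add, mul_right_comm, hmass, two_mul, pow_add]
    ring
  have hfib : ∀ n, ∑' γ : {γ : Γ // N γ = n}, μ (s.vx i 0) {γ.1 • ξ} ≤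
      Nat.card (s.grp i n) * μ (s.vx i 0) Set.univ := by
    intro n
    have hfin : Finite (s.grp i n) := hdisc _
    refine tsum_measure_singleton_le _ (fun γ : {γ : Γ // N γ = n} => γ.1 • ξ)
      (Nat.card (s.grp i n)) fun η => ?_
    by_cases hemp : Nonempty {γ : {γ : Γ // N γ = n} // γ.1 • ξ = η}
    · obtain ⟨⟨⟨γ₀, h0⟩, rfl⟩⟩ := hemp
      rw [← ENat.card_eq_coe_natCard]
      -- Same image and same height force the same distance, by comparing masses (here `c ≠ 0` and
      -- `q < 1` matter). Then `γ v_n` and `γ₀ v_n` are at the same place on one ray.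
      have hmem : ∀ γ : {γ : {γ : Γ // N γ = n} // γ.1 • ξ = γ₀ • ξ},
          γ₀⁻¹ * γ.1.1 ∈ s.grp i n := by
        rintro ⟨⟨γ, hγ⟩, he⟩
        change γ • ξ = γ₀ • ξ at he
        have e1 := hmass γ
        have e2 := hmass γ₀
        rw [he, hγ, ← h0, ← e2, ENNReal.mul_left_inj hc (measure_ne_top _ _)] at e1
        have e3 : T.dist (γ⁻¹ • s.vx i 0) (s.vx i (N γ₀)) =
            T.dist (γ₀⁻¹ • s.vx i 0) (s.vx i (N γ₀)) :=
          rate_pow_injective hq1 e1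
        have o1 : OnRay (s.vx i 0) (γ • ξ) (γ • s.vx i n) := by
          have := onRay_smul γ (hN γ)
          rwa [smul_inv_smul, hγ] at this
        have o2 : OnRay (s.vx i 0) (γ • ξ) (γ₀ • s.vx i n) := by
          have := onRay_smul γ₀ (hN γ₀)
          rwa [smul_inv_smul, h0, ← he] at this
        rw [← dist_smul γ, smul_inv_smul, ← dist_smul γ₀ (γ₀⁻¹ • _), smul_inv_smul, h0] at e3
        obtain ⟨r, hr0, hr⟩ := exists_ray_from hT (s.vx i 0) (γ • ξ)
        rw [← hr, ← hr0] at o1 o2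
        rw [← hr0] at e3
        change (γ₀⁻¹ * γ) • s.vx i n = s.vx i n
        rw [mul_smul, OnRay.eq_of_dist hT o1 rfl, e3, ← OnRay.eq_of_dist hT o2 rfl,
          inv_smul_smul]
      refine ENat.card_le_card_of_injective (f := fun γ => ⟨_, hmem γ⟩) fun γ γ' h => ?_
      exact Subtype.ext (Subtype.ext (mul_left_cancel (congrArg Subtype.val h)))
    · rw [not_nonempty_iff] at hemp
      rw [(ENat.card_eq_zero_iff_empty _).2 hemp]
      exact zero_le
  have hbound : (∑' γ : Γ, rate δ ^ T.dist (s.vx i 0) (γ • s.vx i 0)) * c ≤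
      (∑' n, (Nat.card (s.grp i n) : ℝ≥0∞) * rate δ ^ (2 * n)) * μ (s.vx i 0) Set.univ := by
    rw [← ENNReal.tsum_mul_right, ← ENNReal.tsum_mul_right]
    simp only [hterm]
    rw [← (Equiv.sigmaFiberEquiv N).tsum_eq, ENNReal.tsum_sigma']
    refine ENNReal.tsum_le_tsum fun n => ?_
    have : ∀ γ : {γ : Γ // N γ = n},
        rate δ ^ (2 * N γ.1) * μ (s.vx i 0) {γ.1 • ξ} =
          rate δ ^ (2 * n) * μ (s.vx i 0) {γ.1 • ξ} := fun γ => by rw [γ.2]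
    calc _ = rate δ ^ (2 * n) * ∑' γ : {γ : Γ // N γ = n}, μ (s.vx i 0) {γ.1 • ξ} := by
          rw [← ENNReal.tsum_mul_left]
          exact tsum_congr this
      _ ≤ rate δ ^ (2 * n) * (Nat.card (s.grp i n) * μ (s.vx i 0) Set.univ) := by
          gcongr
          exact hfib n
      _ = _ := by ring
  intro htop
  rw [htop, ENNReal.top_mul hc] at hbound
  exact ENNReal.mul_ne_top hsum (measure_ne_top _ _) (top_le_iff.1 hbound)

end CuspDecomposition.Lifts

/-! ### Sums over the core vertices and their decomposition along excursions. -/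

section Sums

theorem tsum_le_tsum_of_cover {ι κ : Type*} {A : Set κ} {h : κ → ℝ≥0∞} (f : ι → κ)
    {k : ι → ℝ≥0∞} (hA : ∀ z ∈ A, ∃ p, f p = z ∧ h z ≤ k p) : ∑' z : A, h z ≤ ∑' p, k p := by
  choose p hp hk using fun z : A => hA z z.2
  have hinj : Function.Injective p := fun a b hab => Subtype.ext (by rw [← hp a, ← hp b, hab])
  exact (ENNReal.tsum_le_tsum hk).trans (ENNReal.tsum_comp_le_tsum_of_injective hinj k)

theorem add_pow_le_of_convex {a b x y : ℝ≥0∞} (hab : a + b = 1) (k : ℕ) :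
    (a * x + b * y) ^ k ≤ a * x ^ k + b * y ^ k := by
  rcases Nat.eq_zero_or_pos k with rfl | hk
  · simp [hab]
  · have := ENNReal.rpow_arith_mean_le_arith_mean2_rpow a b x y hab
      (p := k) (by exact_mod_cast hk)
    simpa only [ENNReal.rpow_natCast] using this

end Sums

section Tree

variable {V : Type*} {T : SimpleGraph V}

theorem exists_ray_through (hT : T.IsTree) (hb : Branching T) {z : V} (n : ℕ) (u : V)
    (h : T.dist u z = n + 1) : ∃ r : Ray T, r.toFun 0 = u ∧ r.toFun (n + 1) = z := by
  induction n generalizing u with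
  | zero => exact exists_ray_of_adj hT hb (SimpleGraph.dist_eq_one_iff_adj.1 h)
  | succ n ih =>
    rw [SimpleGraph.dist_comm] at h
    obtain ⟨w, hw, hd⟩ := exists_closer hT h
    rw [SimpleGraph.dist_comm] at hd
    obtain ⟨r, rfl, rfl⟩ := ih w hd
    obtain ⟨r', -, h0, hs⟩ := r.exists_cons hT (u := u) hw.symm (by
      rintro rfl
      have := r.dist_eq hT 1 n
      rw [SimpleGraph.dist_comm, add_comm n 1, this] at h
      omega)
    exact ⟨r', h0, hs _⟩

theorem Btw.trans_right {x y z w : V} (hT : T.IsTree) (h : Btw T x z w) (h' : Btw T x y z) :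
    Btw T x y w := by
  have h1 := hT.1.dist_triangle (u := x) (v := y) (w := w)
  have h2 := hT.1.dist_triangle (u := y) (v := z) (w := w)
  unfold Btw at *
  omega

theorem Btw.symm {x y z : V} (h : Btw T x y z) : Btw T z y x := by
  unfold Btw at *
  rw [SimpleGraph.dist_comm, h, add_comm, SimpleGraph.dist_comm, SimpleGraph.dist_comm (u := x)]

theorem btw_refl_right (x y : V) : Btw T x y y := by simp [Btw]

variable {Γ : Subgroup (T ≃g T)} (D : CuspDecomposition Γ)

namespace CuspDecomposition

/-- The vertices of `T` lying over the core of the quotient graph. -/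
def core : Set V := {v | qv Γ v ∈ D.coreVert}

/-- The vertices of the core next to `u`, either adjacent or reached by an excursion in a cusp. -/
def nextCore (u : V) : Set V :=
  {z | z ∈ D.core ∧ z ≠ u ∧ ∀ c ∈ D.core, Btw T u c z → c = u ∨ c = z}

/-- The first vertices of the core at distance at least `R` from `v`. -/
def firstCore (R : ℕ) (v : V) : Set V :=
  {z | z ∈ D.core ∧ R ≤ T.dist v z ∧ ∀ c ∈ D.core, Btw T v c z → R ≤ T.dist v c → c = z}

variable {D}

theorem smul_mem_core {γ : Γ} {v : V} : γ • v ∈ D.core ↔ v ∈ D.core := by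
  change qv Γ (γ • v) ∈ D.coreVert ↔ qv Γ v ∈ D.coreVert
  rw [qv_smul]

theorem btw_smul {γ : Γ} {x y z : V} : Btw T (γ • x) (γ • y) (γ • z) ↔ Btw T x y z := by
  simp only [Btw, dist_smul]

variable (D) in
theorem exists_finite_core : ∃ C : Set V, C.Finite ∧ C ⊆ D.core ∧
    ∀ v ∈ D.core, ∃ c ∈ C, ∃ γ : Γ, γ • c = v := by
  refine ⟨Quotient.out '' D.coreVert, D.finite_vert.image _, ?_, fun v hv => ?_⟩
  · rintro _ ⟨x, hx, rfl⟩
    change qv Γ x.out ∈ D.coreVert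
    rwa [show qv Γ x.out = x from Quotient.out_eq _]
  · exact ⟨_, ⟨_, hv, rfl⟩, qv_eq_iff.1 (Quotient.out_eq _).symm⟩

theorem tsum_smul_le {A : V → Set V} (hA : ∀ (γ : Γ) v z, z ∈ A v → γ • z ∈ A (γ • v))
    (q : ℝ≥0∞) (γ : Γ) (v : V) :
    ∑' z : A (γ • v), q ^ T.dist (γ • v) z ≤ ∑' z : A v, q ^ T.dist v z := by
  refine tsum_le_tsum_of_cover (h := fun z => q ^ T.dist (γ • v) z) (fun z : A v => γ • z.1)
    fun z hz => ?_
  have hz' := hA γ⁻¹ _ _ hz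
  rw [inv_smul_smul] at hz'
  refine ⟨⟨γ⁻¹ • z, hz'⟩, smul_inv_smul _ _, ?_⟩
  change q ^ T.dist (γ • v) z ≤ q ^ T.dist v (γ⁻¹ • z)
  rw [← dist_smul γ v, smul_inv_smul]

theorem smul_mem_firstCore (R : ℕ) (γ : Γ) (v z : V) (h : z ∈ D.firstCore R v) :
    γ • z ∈ D.firstCore R (γ • v) := by
  obtain ⟨h1, h2, h3⟩ := h
  refine ⟨smul_mem_core.2 h1, by rwa [dist_smul], fun c hc hb hR => ?_⟩
  have e := h3 (γ⁻¹ • c) (smul_mem_core.2 hc)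
    (btw_smul (γ := γ).1 (by rwa [smul_inv_smul])) (by rwa [← dist_smul γ, smul_inv_smul])
  rw [← e, smul_inv_smul]

theorem exists_nextCore (hT : T.IsTree) {R : ℕ} (hR : 1 ≤ R) {v z : V} (hv : v ∈ D.core)
    (hz : z ∈ D.firstCore R v) :
    ∃ u ∈ D.core, T.dist v u < R ∧ Btw T v u z ∧ z ∈ D.nextCore u := by
  classical
  obtain ⟨h1, h2, h3⟩ := hz
  have hvz : v ≠ z := by
    rintro rfl
    rw [SimpleGraph.dist_self] at h2
    omega
  -- The vertex wanted is the last core vertex before `z`; by the choice of `z` it is at distance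
  -- less than `R` from `v`.
  have hex : ∃ k, ∃ u ∈ D.core, Btw T v u z ∧ u ≠ z ∧ T.dist u z = k :=
    ⟨_, v, hv, by simp [Btw], hvz, rfl⟩
  obtain ⟨u, hu, hb, hne, hk⟩ := Nat.find_spec hex
  refine ⟨u, hu, ?_, hb, h1, hne.symm, fun c hc hcb => ?_⟩
  · by_contra! hR'
    exact hne (h3 u hu hb hR')
  · by_contra! hcon
    have hmin := Nat.find_min' hex ⟨c, hc,
      (Btw.trans_right hT hb.symm hcb.symm).symm, hcon.2, rfl⟩
    have : T.dist u c ≠ 0 := fun h => hcon.1 (hT.1.dist_eq_zero_iff.1 h).symm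
    unfold Btw at hcb
    omega

theorem exists_firstCore (hT : T.IsTree) {R : ℕ} {v c : V} (hc : c ∈ D.core)
    (hR : R ≤ T.dist v c) : ∃ z ∈ D.firstCore R v, Btw T v z c := by
  classical
  have hex : ∃ k, ∃ z ∈ D.core, Btw T v z c ∧ R ≤ T.dist v z ∧ T.dist v z = k :=
    ⟨_, c, hc, btw_refl_right _ _, hR, rfl⟩
  obtain ⟨z, hz, hb, hzR, hk⟩ := Nat.find_spec hex
  refine ⟨z, ⟨hz, hzR, fun c' hc' hb' hR' => ?_⟩, hb⟩
  have hmin := Nat.find_min' hex ⟨c', hc', hb.trans_right hT hb', hR', rfl⟩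
  have : T.dist c' z = 0 := by
    unfold Btw at hb'
    omega
  exact hT.1.dist_eq_zero_iff.1 this

namespace Lifts

variable (s : D.Lifts)

theorem vx_zero_mem_core (i : Fin D.r) : s.vx i 0 ∈ D.core := s.qv_vx_zero i

theorem vx_succ_notMem_core (i : Fin D.r) (n : ℕ) : s.vx i (n + 1) ∉ D.core := s.qv_vx_succ i n

/-- A segment between core vertices with no core vertex inside is an edge or one full excursion in a
cusp, and an excursion to height `n + 1` has length `2(n + 1)`. -/
theorem nextCore_cases (hT : T.IsTree) (hb : Branching T) (hD : D.IsFree) {u z : V}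
    (hu : u ∈ D.core) (hz : z ∈ D.nextCore u) :
    T.Adj u z ∨ ∃ i n, ∃ γ : Γ, ∃ g ∈ s.grp i (n + 1),
      γ • s.vx i 0 = u ∧ γ • g • s.vx i 0 = z ∧ T.dist u z = 2 * (n + 1) := by
  obtain ⟨hzc, hzu, hbtw⟩ := hz
  obtain ⟨N, hN⟩ : ∃ N, T.dist u z = N + 1 := Nat.exists_eq_succ_of_ne_zero fun h =>
    hzu (hT.1.dist_eq_zero_iff.1 h).symm
  obtain ⟨r, h0, rfl⟩ := exists_ray_through hT hb N u hN
  have hnc : ∀ k, 0 < k → k < N + 1 → r.toFun k ∉ D.core := by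
    intro k hk hk' hc
    have hbt := r.btw hT (Nat.zero_le k) hk'.le
    rw [h0] at hbt
    rcases hbtw _ hc hbt with h | h
    · have := r.inj (h.trans h0.symm)
      omega
    · have := r.inj h
      omega
  rcases Nat.eq_zero_or_pos N with rfl | hNpos
  · left
    exact SimpleGraph.dist_eq_one_iff_adj.1 hN
  right
  have h1 := hnc 1 one_pos (by omega)
  have ho : (qe Γ (r.edge 0)).o ∈ D.coreVert := by
    rw [qe_o]
    change qv Γ (r.toFun 0) ∈ _
    rw [h0]
    exact hu
  have ht : (qe Γ (r.edge 0)).t ∉ D.coreVert := by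
    rw [qe_t]
    exact h1
  obtain ⟨i, hi⟩ : ∃ i, qe Γ (r.edge 0) = D.a i 0 := by
    rcases D.edge_cases (qe Γ (r.edge 0)) with h | ⟨i, n, h | h⟩
    · exact absurd (D.t_mem_coreVert h) ht
    · rcases n with _ | n
      · exact ⟨i, h⟩
      · rw [h] at ho
        exact absurd ho (D.o_succ_notMem_coreVert i n)
    · rw [h, QEdge.rev_o, D.consecutive] at ho
      exact absurd ho (D.o_succ_notMem_coreVert i n)
  rw [← s.qe_aLift i 0] at hi
  obtain ⟨γ, hγ⟩ := qe_eq_iff.1 hi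
  have g0 : γ • s.vx i 0 = r.toFun 0 := congrArg (fun d : T.Dart => d.fst) hγ
  have g1 : γ • s.vx i 1 = r.toFun 1 := by
    have : γ • (s.aLift i 0).snd = r.toFun 1 := congrArg (fun d : T.Dart => d.snd) hγ
    rwa [aLift_snd] at this
  have hr : ∀ k, (Ray.map (γ⁻¹ : Γ) r).toFun k = γ⁻¹ • r.toFun k := fun k => rfl
  rcases s.excursion hD (i := i) (Ray.map (γ⁻¹ : Γ) r) (by rw [hr, ← g0, inv_smul_smul])
    (by rw [hr, ← g1, inv_smul_smul]) with hall | ⟨n, g, hg, hup, -, hdown⟩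
  · have := hall (N + 1)
    rw [hr] at this
    have h2 := s.vx_succ_notMem_core i N
    rw [← this, smul_mem_core] at h2
    exact absurd hzc h2
  · have hend : γ • g • s.vx i 0 = r.toFun (2 * (n + 1)) := by
      have := hdown (n + 1) le_rfl
      rw [hr, Nat.sub_self, ← two_mul] at this
      rw [← this, smul_inv_smul]
    have hendc : r.toFun (2 * (n + 1)) ∈ D.core := by
      rw [← hend, smul_mem_core, smul_mem_core]
      exact s.vx_zero_mem_core i
    have hNn : N + 1 = 2 * (n + 1) := by
      rcases lt_trichotomy (N + 1) (2 * (n + 1)) with hlt | h | h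
      · exfalso
        rcases Nat.lt_or_ge (N + 1) (n + 2) with hle | hle
        · have := hup (N + 1) (by omega)
          rw [hr] at this
          have h2 := s.vx_succ_notMem_core i N
          rw [← this, smul_mem_core] at h2
          exact h2 hzc
        · have := hdown (N - n) (by omega)
          rw [hr, show n + 1 + (N - n) = N + 1 by omega,
            show n + 1 - (N - n) = (2 * n - N) + 1 by omega] at this
          have h2 := s.vx_succ_notMem_core i (2 * n - N)
          rw [← smul_mem_core (γ := g), ← this, smul_mem_core] at h2
          exact h2 hzc
      · exact h
      · exact absurd hendc (hnc _ (by omega) h)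
    exact ⟨i, n, γ, g, hg, g0.trans h0, by rw [hend, hNn], by rw [hN, hNn]⟩

theorem tsum_nextCore_ne_top (hT : T.IsTree) (hlf : ∀ v, (T.neighborSet v).Finite)
    (hb : Branching T) (hD : D.IsFree) (hdisc : IsDiscreteGroup Γ) {q : ℝ≥0∞} (hq : q ≠ ⊤)
    (hB : ∀ i, ∑' n, (Nat.card (s.grp i n) : ℝ≥0∞) * q ^ (2 * n) ≠ ⊤) {u : V}
    (hu : u ∈ D.core) : ∑' z : D.nextCore u, q ^ T.dist u z ≠ ⊤ := by
  classical
  have hfin : Finite (T.neighborSet u) := hlf u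
  have := Fintype.ofFinite (T.neighborSet u)
  let f : T.neighborSet u ⊕ (Σ i : Fin D.r, Σ n : ℕ, s.grp i (n + 1)) → V :=
    Sum.elim (fun w => w.1) fun p =>
      -- The chosen `γ` is the only one, stabilisers of core vertices being trivial; the value `u`
      -- in the other case is never used to cover anything.
      if h : ∃ γ : Γ, γ • s.vx p.1 0 = u then h.choose • p.2.2.1 • s.vx p.1 0 else u
  let k : T.neighborSet u ⊕ (Σ i : Fin D.r, Σ n : ℕ, s.grp i (n + 1)) → ℝ≥0∞ :=
    Sum.elim (fun _ => q) fun p => q ^ (2 * (p.2.1 + 1))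
  have hle : ∑' z : D.nextCore u, q ^ T.dist u z ≤ ∑' p, k p := by
    refine tsum_le_tsum_of_cover (h := fun z => q ^ T.dist u z) f fun z hz => ?_
    rcases s.nextCore_cases hT hb hD hu hz with h | ⟨i, n, γ, g, hg, h1, h2, h3⟩
    · refine ⟨Sum.inl ⟨z, h⟩, rfl, ?_⟩
      change q ^ T.dist u z ≤ q
      rw [SimpleGraph.dist_eq_one_iff_adj.2 h, pow_one]
    · refine ⟨Sum.inr ⟨i, n, g, hg⟩, ?_, ?_⟩
      · have hex : ∃ γ : Γ, γ • s.vx i 0 = u := ⟨γ, h1⟩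
        have : hex.choose = γ := by
          refine (inv_mul_eq_one.1 (hD _ (s.qv_vx_zero i) (γ⁻¹ * hex.choose) ?_)).symm
          rw [mul_smul, hex.choose_spec, ← h1, inv_smul_smul]
        change dite _ _ _ = _
        rw [dif_pos hex, this, h2]
      · change q ^ T.dist u z ≤ q ^ (2 * (n + 1))
        rw [h3]
  refine ne_top_of_le_ne_top ?_ hle
  rw [Summable.tsum_sum ENNReal.summable ENNReal.summable]
  refine ENNReal.add_ne_top.2 ⟨?_, ?_⟩
  · rw [tsum_fintype]
    exact (ENNReal.sum_lt_top.2 fun _ _ => hq.lt_top).ne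
  · rw [ENNReal.tsum_sigma', tsum_fintype]
    refine (ENNReal.sum_lt_top.2 fun i _ => lt_of_le_of_lt ?_ (hB i).lt_top).ne
    rw [ENNReal.tsum_sigma']
    have hterm : ∀ n, ∑' g : s.grp i (n + 1), k (Sum.inr ⟨i, n, g⟩) =
        (Nat.card (s.grp i (n + 1)) : ℝ≥0∞) * q ^ (2 * (n + 1)) := by
      intro n
      have hfin : Finite (s.grp i (n + 1)) := hdisc _
      change ∑' _ : s.grp i (n + 1), q ^ (2 * (n + 1)) = _
      rw [ENNReal.tsum_const, ENat.card_eq_coe_natCard, ENat.toENNReal_coe]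
    simp only [hterm]
    exact ENNReal.tsum_comp_le_tsum_of_injective (add_left_injective 1)
      fun n => (Nat.card (s.grp i n) : ℝ≥0∞) * q ^ (2 * n)

theorem tsum_firstCore_ne_top (hT : T.IsTree) (hlf : ∀ v, (T.neighborSet v).Finite)
    (hb : Branching T) (hD : D.IsFree) (hdisc : IsDiscreteGroup Γ) {q : ℝ≥0∞} (hq : q ≠ ⊤)
    (hB : ∀ i, ∑' n, (Nat.card (s.grp i n) : ℝ≥0∞) * q ^ (2 * n) ≠ ⊤) {R : ℕ} (hR : 1 ≤ R)
    {v : V} (hv : v ∈ D.core) : ∑' z : D.firstCore R v, q ^ T.dist v z ≠ ⊤ := by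
  have hfin : Finite {u : V // u ∈ D.core ∧ T.dist v u < R} :=
    ((finite_ball hT hlf v R).subset fun u hu => hu.2.le : {u | u ∈ D.core ∧ T.dist v u < R}.Finite)
  have := Fintype.ofFinite {u : V // u ∈ D.core ∧ T.dist v u < R}
  let k : (Σ u : {u : V // u ∈ D.core ∧ T.dist v u < R}, D.nextCore u.1) → ℝ≥0∞ :=
    fun p => q ^ T.dist v p.1 * q ^ T.dist p.1.1 p.2
  have hle : ∑' z : D.firstCore R v, q ^ T.dist v z ≤ ∑' p, k p := by
    refine tsum_le_tsum_of_cover (h := fun z => q ^ T.dist v z) (fun p => p.2.1) fun z hz => ?_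
    obtain ⟨u, hu, huR, hbt, hn⟩ := exists_nextCore hT hR hv hz
    refine ⟨⟨⟨u, hu, huR⟩, z, hn⟩, rfl, ?_⟩
    change q ^ T.dist v z ≤ q ^ T.dist v u * q ^ T.dist u z
    rw [← pow_add, ← hbt]
  refine ne_top_of_le_ne_top ?_ hle
  rw [ENNReal.tsum_sigma', tsum_fintype]
  refine (ENNReal.sum_lt_top.2 fun u _ => ?_).ne
  change ∑' z : D.nextCore u.1, q ^ T.dist v u * q ^ T.dist u.1 z < ⊤
  rw [ENNReal.tsum_mul_left]
  exact ENNReal.mul_lt_top (ENNReal.pow_lt_top hq.lt_top)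
    (s.tsum_nextCore_ne_top hT hlf hb hD hdisc hq hB u.2.1).lt_top

end Lifts

end CuspDecomposition

end Tree

/-! ### Renewal argument: convergence at `q` persists slightly above `q`. -/

namespace CuspDecomposition

variable {V : Type*} {T : SimpleGraph V} {Γ : Subgroup (T ≃g T)} {D : CuspDecomposition Γ}

variable (D) in
/-- The vertices of the core at distance at most `N` from `v`. -/
def coreBall (N : ℕ) (v : V) : Set V := {c | c ∈ D.core ∧ T.dist v c ≤ N}

theorem smul_mem_coreBall (N : ℕ) (γ : Γ) (v z : V) (h : z ∈ D.coreBall N v) :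
    γ • z ∈ D.coreBall N (γ • v) :=
  ⟨smul_mem_core.2 h.1, by rw [dist_smul]; exact h.2⟩

theorem tsum_coreBall_ne_top (hT : T.IsTree) (hlf : ∀ v, (T.neighborSet v).Finite) {q : ℝ≥0∞}
    (hq : q ≠ ⊤) (N : ℕ) (v : V) : ∑' z : D.coreBall N v, q ^ T.dist v z ≠ ⊤ := by
  have : Finite (D.coreBall N v) := (finite_ball hT hlf v N).subset fun z hz => hz.2
  have := Fintype.ofFinite (D.coreBall N v)
  rw [tsum_fintype]
  exact (ENNReal.sum_lt_top.2 fun _ _ => ENNReal.pow_lt_top hq.lt_top).ne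

/-- The sums are invariant under `Γ`, and the core has finitely many orbits of vertices. -/
theorem iSup_tsum_ne_top {A : V → Set V}
    (hA : ∀ (γ : Γ) v z, z ∈ A v → γ • z ∈ A (γ • v)) {q : ℝ≥0∞}
    (h : ∀ v ∈ D.core, ∑' z : A v, q ^ T.dist v z ≠ ⊤) :
    ⨆ v : D.core, ∑' z : A v, q ^ T.dist v.1 z ≠ ⊤ := by
  obtain ⟨C, hC, hCc, hrep⟩ := D.exists_finite_core
  refine ne_top_of_le_ne_top (b := ∑ v ∈ hC.toFinset, ∑' z : A v, q ^ T.dist v z)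
    (ENNReal.sum_lt_top.2 fun v hv => (h v (hCc (hC.mem_toFinset.1 hv))).lt_top).ne
    (iSup_le ?_)
  rintro ⟨v, hv⟩
  obtain ⟨c, hc, γ, rfl⟩ := hrep v hv
  exact (tsum_smul_le hA q γ c).trans (Finset.single_le_sum
    (f := fun v => ∑' z : A v, q ^ T.dist v z) (fun _ _ => zero_le) (hC.mem_toFinset.2 hc))

/-- Renewal inequality: a segment to a core vertex beyond distance `R` is cut at its first core
vertex at distance at least `R`. -/
theorem tsum_coreBall_le (hT : T.IsTree) (q : ℝ≥0∞) (R N : ℕ) (v : V) :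
    ∑' z : D.coreBall N v, q ^ T.dist v z ≤ ∑' z : D.coreBall R v, q ^ T.dist v z +
      ∑' z : D.firstCore R v, q ^ T.dist v z * ∑' c : D.coreBall N z, q ^ T.dist z.1 c := by
  have h1 : ∑' z : D.coreBall N v, q ^ T.dist v z ≤
      ∑' p : D.coreBall R v ⊕ (Σ z : D.firstCore R v, D.coreBall N z.1),
        Sum.elim (fun c : D.coreBall R v => q ^ T.dist v c) (fun p => q ^ T.dist v p.1 *
          q ^ T.dist p.1.1 p.2) p := by
    refine tsum_le_tsum_of_cover (h := fun z => q ^ T.dist v z)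
      (Sum.elim (fun c => c.1) fun p => p.2.1) fun c hc => ?_
    rcases Nat.lt_or_ge (T.dist v c) R with h | h
    · exact ⟨Sum.inl ⟨c, hc.1, h.le⟩, rfl, le_rfl⟩
    · obtain ⟨z, hz, hb⟩ := exists_firstCore hT hc.1 h
      have hN := hc.2
      unfold Btw at hb
      refine ⟨Sum.inr ⟨⟨z, hz⟩, c, hc.1, show T.dist z c ≤ N by omega⟩, rfl, ?_⟩
      change q ^ T.dist v c ≤ q ^ T.dist v z * q ^ T.dist z c
      rw [hb, pow_add]
  refine h1.trans_eq ?_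
  rw [Summable.tsum_sum ENNReal.summable ENNReal.summable, ENNReal.tsum_sigma']
  simp only [Sum.elim_inl, Sum.elim_inr, ENNReal.tsum_mul_left]

/-- First core vertices beyond `R` avoid any given finite set once `R` is large, so their sum is
bounded by a tail of a convergent series. -/
theorem exists_tsum_firstCore_le {q : ℝ≥0∞}
    (hP : ∀ v ∈ D.core, ∑' c : D.core, q ^ T.dist v c ≠ ⊤) {C : Set V} (hC : C.Finite)
    (hCc : C ⊆ D.core) :
    ∃ R, 1 ≤ R ∧ ∀ v ∈ C, ∑' z : D.firstCore R v, q ^ T.dist v z ≤ 4⁻¹ := by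
  have hF : ∀ v ∈ C, ∃ F : Finset D.core,
      ∑' c : {c : D.core // c ∉ F}, q ^ T.dist v c.1 < 4⁻¹ := fun v hv =>
    ((ENNReal.tendsto_tsum_compl_atTop_zero (hP v (hCc hv))).eventually
      (gt_mem_nhds (by simp))).exists
  choose! F hF using hF
  refine ⟨hC.toFinset.sup (fun v => (F v).sup fun c => T.dist v c) + 1, by omega, fun v hv => ?_⟩
  refine le_trans ?_ (hF v hv).le
  refine tsum_le_tsum_of_cover (h := fun z => q ^ T.dist v z) (fun c => c.1.1) fun z hz => ?_
  refine ⟨⟨⟨z, hz.1⟩, fun hmem => ?_⟩, rfl, le_rfl⟩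
  have h1 := Finset.le_sup (f := fun c : D.core => T.dist v c) hmem
  have h2 := Finset.le_sup (f := fun v => (F v).sup fun c : D.core => T.dist v c)
    (hC.mem_toFinset.2 hv)
  have h3 := hz.2.1
  simp only at h1 h2
  omega

/-- With `X N` the supremum over the core of the sums on balls of radius `N`, renewal gives `X N ≤ X
R + X N / 2`. As `X N` is finite a priori, `X N ≤ 2 X R` for all `N`. -/
theorem tsum_core_ne_top_of_firstCore (hT : T.IsTree) (hlf : ∀ v, (T.neighborSet v).Finite)
    {q : ℝ≥0∞} (hq : q ≠ ⊤) {R : ℕ}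
    (h : ∀ v ∈ D.core, ∑' z : D.firstCore R v, q ^ T.dist v z ≤ 2⁻¹) {v : V} (hv : v ∈ D.core) :
    ∑' c : D.core, q ^ T.dist v c ≠ ⊤ := by
  let X : ℕ → ℝ≥0∞ := fun N => ⨆ v : D.core, ∑' z : D.coreBall N v, q ^ T.dist v.1 z
  have hX : ∀ N, X N ≠ ⊤ := fun N => iSup_tsum_ne_top (smul_mem_coreBall N)
    fun v _ => tsum_coreBall_ne_top hT hlf hq N v
  have hle : ∀ N v, v ∈ D.core → ∑' z : D.coreBall N v, q ^ T.dist v z ≤ X N := fun N v hv =>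
    le_iSup (fun v : D.core => ∑' z : D.coreBall N v, q ^ T.dist v.1 z) ⟨v, hv⟩
  have hrec : ∀ N, X N ≤ 2 * X R := by
    intro N
    have h1 : X N ≤ X R + X N / 2 := by
      refine iSup_le fun w => (tsum_coreBall_le hT q R N w.1).trans ?_
      gcongr
      · exact hle R w.1 w.2
      · calc _ ≤ ∑' z : D.firstCore R w.1, q ^ T.dist w.1 z * X N := by
              gcongr with z
              exact hle N z.1 z.2.1
          _ ≤ 2⁻¹ * X N := by
              rw [ENNReal.tsum_mul_right]
              gcongr
              exact h w.1 w.2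
          _ = X N / 2 := by rw [ENNReal.div_eq_inv_mul]
    have h2 : X N / 2 ≤ X R := by
      refine (ENNReal.add_le_add_iff_right
        (ENNReal.div_ne_top (hX N) two_ne_zero)).1 ((ENNReal.add_halves (X N)).trans_le h1)
    calc X N = 2 * (X N / 2) := by rw [two_mul, ENNReal.add_halves]
      _ ≤ 2 * X R := by gcongr
  refine ne_top_of_le_ne_top (ENNReal.mul_ne_top (ENNReal.ofNat_ne_top (n := 2)) (hX R)) ?_
  rw [ENNReal.tsum_eq_iSup_sum]
  refine iSup_le fun F => ?_
  refine le_trans ?_ ((hle (F.sup fun c => T.dist v c) v hv).trans (hrec _))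
  rw [← Finset.tsum_subtype F fun c : D.core => q ^ T.dist v c]
  let j : F → D.coreBall (F.sup fun c => T.dist v c) v := fun c =>
    ⟨c.1.1, c.1.2, Finset.le_sup (f := fun c : D.core => T.dist v c) c.2⟩
  exact ENNReal.tsum_comp_le_tsum_of_injective
    (f := j) (fun a b hab => Subtype.ext (Subtype.ext (congrArg (fun z => z.1) hab)))
    fun z => q ^ T.dist v z

/-- By convexity of powers, at `q' = (1 - t) q + t q₁` the sum over first core vertices is at most
`1/4 + tK`, where `K` controls the same sums at `q₁`; a small `t` brings it below `1/2`. -/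
theorem exists_gt_tsum_core_ne_top (s : D.Lifts) (hT : T.IsTree)
    (hlf : ∀ v, (T.neighborSet v).Finite) (hb : Branching T) (hD : D.IsFree)
    (hdisc : IsDiscreteGroup Γ) {q q₁ : ℝ≥0∞} (hlt : q < q₁) (hq₁ : q₁ ≠ ⊤)
    (hB : ∀ i, ∑' n, (Nat.card (s.grp i n) : ℝ≥0∞) * q₁ ^ (2 * n) ≠ ⊤)
    (hP : ∀ v ∈ D.core, ∑' c : D.core, q ^ T.dist v c ≠ ⊤) :
    ∃ q', q < q' ∧ ∀ v ∈ D.core, ∑' c : D.core, q' ^ T.dist v c ≠ ⊤ := by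
  obtain ⟨C, hC, hCc, hrep⟩ := D.exists_finite_core
  obtain ⟨R, hR, hR'⟩ := exists_tsum_firstCore_le hP hC hCc
  set K := ∑ v ∈ hC.toFinset, ∑' z : D.firstCore R v, q₁ ^ T.dist v z with hKdef
  have hK : K ≠ ⊤ := (ENNReal.sum_lt_top.2 fun v hv =>
    (s.tsum_firstCore_ne_top hT hlf hb hD hdisc hq₁ hB hR (hCc (hC.mem_toFinset.1 hv))).lt_top).ne
  -- `K + 1` instead of `K` keeps `t` finite when `K = 0`, and gives both `t ≤ 1` and `tK ≤ 1/4`.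
  set t : ℝ≥0∞ := (4 * (K + 1))⁻¹ with ht
  have hK1 : K + 1 ≠ ⊤ := ENNReal.add_ne_top.2 ⟨hK, ENNReal.one_ne_top⟩
  have hK0 : K + 1 ≠ 0 := by simp
  have ht4 : t * (K + 1) = 4⁻¹ := by
    rw [ht, ENNReal.mul_inv (Or.inl (by simp)) (Or.inl (by simp)), mul_assoc,
      ENNReal.inv_mul_cancel hK0 hK1, mul_one]
  have ht0 : t ≠ 0 := ENNReal.inv_ne_zero.2 (ENNReal.mul_ne_top (by simp) hK1)
  have htK : t * K ≤ 4⁻¹ := by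
    rw [← ht4]
    gcongr
    exact le_self_add
  have ht1 : t ≤ 1 := by
    refine le_trans ?_ (show (4 : ℝ≥0∞)⁻¹ ≤ 1 by simp)
    rw [← ht4]
    exact le_mul_of_one_le_right' le_add_self
  have htt : t ≠ ⊤ := ne_top_of_le_ne_top ENNReal.one_ne_top ht1
  have hab : 1 - t + t = 1 := tsub_add_cancel_of_le ht1
  have hqt : q ≠ ⊤ := hlt.ne_top
  have h1t : 1 - t ≠ ⊤ := ne_top_of_le_ne_top ENNReal.one_ne_top tsub_le_self
  refine ⟨(1 - t) * q + t * q₁, ?_, fun v hv => ?_⟩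
  · calc q = (1 - t) * q + t * q := by rw [← add_mul, hab, one_mul]
      _ < _ := ENNReal.add_lt_add_left (ENNReal.mul_ne_top h1t hqt)
          ((ENNReal.mul_lt_mul_iff_right ht0 htt).2 hlt)
  · refine tsum_core_ne_top_of_firstCore (R := R) hT hlf
      (ENNReal.add_ne_top.2 ⟨ENNReal.mul_ne_top h1t hqt, ENNReal.mul_ne_top htt hq₁⟩) ?_ hv
    intro v hv
    obtain ⟨c, hc, γ, rfl⟩ := hrep v hv
    refine (tsum_smul_le (smul_mem_firstCore R) _ γ c).trans ?_
    calc _ ≤ ∑' z : D.firstCore R c, ((1 - t) * q ^ T.dist c z + t * q₁ ^ T.dist c z) :=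
          ENNReal.tsum_le_tsum fun z => add_pow_le_of_convex hab _
      _ ≤ 1 * 4⁻¹ + t * K := by
          rw [ENNReal.tsum_add, ENNReal.tsum_mul_left, ENNReal.tsum_mul_left]
          gcongr
          · exact tsub_le_self
          · exact hR' c hc
          · exact Finset.single_le_sum
              (f := fun v => ∑' z : D.firstCore R v, q₁ ^ T.dist v z) (fun _ _ => zero_le)
              (hC.mem_toFinset.2 hc)
      _ ≤ 1 * 4⁻¹ + 4⁻¹ := by gcongr
      _ = 2⁻¹ := by
          rw [one_mul, ← two_mul, show (4 : ℝ≥0∞) = 2 * 2 by norm_num,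
            ENNReal.mul_inv (by simp) (by simp), ← mul_assoc,
            ENNReal.mul_inv_cancel (by simp) (by simp), one_mul]

end CuspDecomposition

/-! ### Cusps carry no atom, and their shadows have summable masses. -/

namespace CuspDecomposition.Lifts

variable {V : Type*} {T : SimpleGraph V} {Γ : Subgroup (T ≃g T)} {D : CuspDecomposition Γ}
  (s : D.Lifts) {δ : ℝ} {μ : V → Measure (Ends T)}

theorem tsum_core_ne_top_of_orbit (hT : T.IsTree) {q : ℝ≥0∞} (hq0 : q ≠ 0) (hq1 : q ≤ 1) (v₀ : V)
    (h : ∑' γ : Γ, q ^ T.dist v₀ (γ • v₀) ≠ ⊤) (v : V) : ∑' c : D.core, q ^ T.dist v c ≠ ⊤ := by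
  obtain ⟨C, hC, hCc, hrep⟩ := D.exists_finite_core
  have : Finite C := hC
  have := Fintype.ofFinite C
  have hqt : q ≠ ⊤ := ne_top_of_le_ne_top ENNReal.one_ne_top hq1
  have hle : ∑' c : D.core, q ^ T.dist v c ≤ ∑' p : C × Γ,
      (q ^ (T.dist v₀ v + T.dist p.1.1 v₀))⁻¹ * q ^ T.dist v₀ (p.2 • v₀) := by
    refine tsum_le_tsum_of_cover (h := fun z => q ^ T.dist v z)
      (fun p : C × Γ => p.2 • p.1.1) fun z hz => ?_
    obtain ⟨c, hc, γ, rfl⟩ := hrep z hz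
    refine ⟨⟨⟨c, hc⟩, γ⟩, rfl, ?_⟩
    rw [mul_comm, ← div_eq_mul_inv, ENNReal.le_div_iff_mul_le
      (Or.inl (pow_ne_zero _ hq0)) (Or.inl (ENNReal.pow_ne_top hqt)), ← pow_add]
    refine pow_le_pow_right_of_le_one' hq1 ?_
    have h1 := hT.1.dist_triangle (u := v₀) (v := v) (w := γ • v₀)
    have h2 := hT.1.dist_triangle (u := v) (v := γ • c) (w := γ • v₀)
    rw [dist_smul] at h2
    change T.dist v₀ (γ • v₀) ≤ T.dist v (γ • c) + (T.dist v₀ v + T.dist c v₀)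
    omega
  refine ne_top_of_le_ne_top ?_ hle
  rw [ENNReal.tsum_prod', tsum_fintype]
  refine (ENNReal.sum_lt_top.2 fun c _ => ?_).ne
  simp only [ENNReal.tsum_mul_left]
  exact ENNReal.mul_lt_top (ENNReal.inv_lt_top.2 (ENNReal.pow_pos (pos_of_ne_zero hq0) _))
    h.lt_top

theorem criticalExponent_le_of_tsum (hT : T.IsTree) {t : ℝ} (ht : 0 ≤ t)
    (v₀ x₀ : V) (h : ∑' γ : Γ, rate t ^ T.dist v₀ (γ • v₀) ≠ ⊤) :
    (criticalExponent Γ x₀).toReal ≤ t := by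
  have hle : rate t ≤ 1 := by
    rw [rate, ← ENNReal.ofReal_one]
    exact ENNReal.ofReal_le_ofReal (Real.exp_le_one_iff.2 (by linarith))
  have hfin : ∑' γ : Γ, rate t ^ T.dist x₀ (γ • x₀) ≠ ⊤ := by
    refine ne_top_of_le_ne_top (b := ∑' γ : Γ, (rate t ^ (2 * T.dist v₀ x₀))⁻¹ *
      rate t ^ T.dist v₀ (γ • v₀)) ?_ (ENNReal.tsum_le_tsum fun γ => ?_)
    · rw [ENNReal.tsum_mul_left]
      exact ENNReal.mul_ne_top (ENNReal.inv_ne_top.2 (pow_ne_zero _ (rate_ne_zero t))) h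
    · rw [mul_comm, ← div_eq_mul_inv, ENNReal.le_div_iff_mul_le
        (Or.inl (pow_ne_zero _ (rate_ne_zero t))) (Or.inl (ENNReal.pow_ne_top (rate_ne_top t))),
        ← pow_add]
      refine pow_le_pow_right_of_le_one' hle ?_
      have h1 := hT.1.dist_triangle (u := v₀) (v := x₀) (w := γ • v₀)
      have h2 := hT.1.dist_triangle (u := x₀) (v := γ • x₀) (w := γ • v₀)
      rw [dist_smul, T.dist_comm (u := x₀) (v := v₀)] at h2
      omega
  have hmem : (t.toNNReal : ℝ≥0∞) ∈ (fun s : ℝ≥0 => (s : ℝ≥0∞)) ''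
      {s | Summable fun γ : Γ => Real.exp (-(s : ℝ) * (T.dist x₀ (γ • x₀) : ℝ))} := by
    refine ⟨t.toNNReal, ?_, rfl⟩
    change Summable _
    refine (ENNReal.summable_toReal hfin).congr fun γ => ?_
    rw [rate_pow, ENNReal.toReal_ofReal (Real.exp_nonneg _), Real.coe_toNNReal _ ht]
  calc (criticalExponent Γ x₀).toReal ≤ (t.toNNReal : ℝ≥0∞).toReal :=
        ENNReal.toReal_mono ENNReal.coe_ne_top (sInf_le hmem)
    _ = t := by simp [ht]

/-- An atom makes the Poincaré series converge at `δ`. The renewal argument yields convergence for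
some `q' > e^{-δ}`, hence at an exponent `t < δ`, which contradicts the definition of `δ`. -/
theorem measure_cuspEnd_eq_zero (hT : T.IsTree) (hlf : ∀ v, (T.neighborSet v).Finite)
    (hval : ∀ v, (T.neighborSet v).ncard ≠ 2) (hunif : IsUniform T) (hb : Branching T)
    (hD : D.IsFree) (hdisc : IsDiscreteGroup Γ) {x₀ : V}
    (hδ : δ = (criticalExponent Γ x₀).toReal) (hμ : IsPattersonSullivan Γ δ μ) (i : Fin D.r) :
    μ (s.vx i 0) {s.cuspEnd i} = 0 := by
  by_contra hc
  have hcount : Countable V := countable_of_locallyFinite hT hlf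
  have hδ0 : 0 ≤ δ := hδ ▸ ENNReal.toReal_nonneg
  have hsum := s.tsum_card_grp_ne_top hT hlf hval hb hD hdisc hμ hδ0
  have hq1 := s.rate_lt_one_of_tsum hdisc (hsum i)
  have horb := s.tsum_dist_ne_top_of_atom hT hdisc hμ (hsum i) hc
  have hev : ∀ᶠ q' in 𝓝 (rate δ), ∀ j, ∑' n, (Nat.card (s.grp j n) : ℝ≥0∞) * q' ^ (2 * n) ≠ ⊤ :=
    eventually_all.2 fun j =>
      s.eventually_tsum_card_grp_ne_top hlf hunif hD hdisc (hsum j)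
  have hgt : (𝓝[>] rate δ).NeBot := nhdsGT_neBot_of_exists_gt ⟨1, hq1⟩
  obtain ⟨q₁, ⟨hB, hq₁t⟩, hlt⟩ := (((hev.and (gt_mem_nhds (rate_ne_top δ).lt_top)).filter_mono
    nhdsWithin_le_nhds).and (self_mem_nhdsWithin (s := Set.Ioi (rate δ)))).exists
  obtain ⟨q', hq', hP⟩ := exists_gt_tsum_core_ne_top s hT hlf hb hD hdisc hlt hq₁t.ne hB
    fun v _ => tsum_core_ne_top_of_orbit hT (rate_ne_zero δ) hq1.le _ horb v
  have hδpos : 0 < δ := by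
    refine hδ0.lt_of_ne ?_
    rintro rfl
    simp [rate] at hq1
  have hcont : Continuous rate := by
    unfold rate
    exact ENNReal.continuous_ofReal.comp (Real.continuous_exp.comp continuous_neg)
  obtain ⟨t, ⟨ht, ht0⟩, htδ⟩ := ((((hcont.continuousAt.eventually (gt_mem_nhds hq')).and
    (lt_mem_nhds hδpos)).filter_mono nhdsWithin_le_nhds).and
    (self_mem_nhdsWithin (s := Set.Iio δ))).exists
  have hle := criticalExponent_le_of_tsum (Γ := Γ) hT ht0.le (s.vx i 0) x₀ (by
    refine ne_top_of_le_ne_top (hP _ (s.vx_zero_mem_core i)) ?_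
    let j : Γ → D.core := fun γ => ⟨γ • s.vx i 0, smul_mem_core.2 (s.vx_zero_mem_core i)⟩
    have hj : Function.Injective j := fun a b hab => by
      refine (inv_mul_eq_one.1 (hD _ (s.qv_vx_zero i) (a⁻¹ * b) ?_))
      have : a • s.vx i 0 = b • s.vx i 0 := congrArg Subtype.val hab
      rw [mul_smul, ← this, inv_smul_smul]
    refine le_trans (ENNReal.tsum_le_tsum fun γ => ?_)
      (ENNReal.tsum_comp_le_tsum_of_injective hj fun c => q' ^ T.dist (s.vx i 0) c)
    exact pow_le_pow_left' ht.le _)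
  rw [← hδ] at hle
  exact absurd htδ hle.not_gt

theorem iInter_shadow_subset (hT : T.IsTree) (i : Fin D.r) :
    (⋂ n, shadow (s.vx i 0) (s.vx i n) : Set (Ends T)) ⊆ {s.cuspEnd i} := by
  intro ξ hξ
  obtain ⟨r, h0, rfl⟩ := exists_ray_from hT (s.vx i 0) ξ
  refine Ray.toEnd_eq_iff.2 ⟨0, 0, fun k => ?_⟩
  have := Set.mem_iInter.1 hξ (0 + k)
  change OnRay _ _ _ at this
  rw [← h0] at this
  refine (OnRay.eq_of_dist hT this ?_).symm
  rw [h0, s.dist_vx hT]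

/-- Without an atom, the shadow of `v_{i,n+1}` is exhausted up to a null set by the excursions of
height at least `n + 1`. Comparison with the cusp series at some `q₁ > e^{-δ}` gains a geometric
factor. -/
theorem tsum_measure_shadow_ne_top (hT : T.IsTree) (hlf : ∀ v, (T.neighborSet v).Finite)
    (hval : ∀ v, (T.neighborSet v).ncard ≠ 2) (hunif : IsUniform T) (hb : Branching T)
    (hD : D.IsFree) (hdisc : IsDiscreteGroup Γ) {x₀ : V}
    (hδ : δ = (criticalExponent Γ x₀).toReal) (hμ : IsPattersonSullivan Γ δ μ) (i : Fin D.r) :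
    ∑' n, μ (s.vx i 0) (shadow (s.vx i 0) (s.vx i (n + 1))) ≠ ⊤ := by
  have := hμ.finite
  have hδ0 : 0 ≤ δ := hδ ▸ ENNReal.toReal_nonneg
  have hsum := s.tsum_card_grp_ne_top hT hlf hval hb hD hdisc hμ hδ0 i
  have hq1 := s.rate_lt_one_of_tsum hdisc hsum
  have hgt : (𝓝[>] rate δ).NeBot := nhdsGT_neBot_of_exists_gt ⟨1, hq1⟩
  obtain ⟨q₁, ⟨hB, hq₁t⟩, hlt⟩ := ((((s.eventually_tsum_card_grp_ne_top hlf hunif hD hdisc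
    hsum).and (gt_mem_nhds (rate_ne_top δ).lt_top)).filter_mono
    nhdsWithin_le_nhds).and (self_mem_nhdsWithin (s := Set.Ioi (rate δ)))).exists
  set v := s.vx i 0
  set S : ℕ → Set (Ends T) := fun n => shadow v (s.vx i n) with hS
  set M := μ v (shadow (s.vx i 1) v)
  set B := ∑' n, (Nat.card (s.grp i n) : ℝ≥0∞) * q₁ ^ (2 * n)
  have hq₁0 : q₁ ≠ 0 := (zero_le.trans_lt hlt).ne'
  -- The ratio of the decay: exponents in the cusp series are `2n`, whence the square.
  set x := (rate δ / q₁) ^ 2 with hx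
  have hx1 : x < 1 := by
    refine pow_lt_one₀ zero_le ?_ two_ne_zero
    exact (ENNReal.div_lt_iff (Or.inl hq₁0) (Or.inl hq₁t.ne)).2 (by rwa [one_mul])
  have hxpow : ∀ n, rate δ ^ (2 * n) = x ^ n * q₁ ^ (2 * n) := by
    intro n
    rw [hx, ← pow_mul, ← mul_pow, ENNReal.div_mul_cancel hq₁0 hq₁t.ne]
  have hmono : ∀ n, S (n + 1) ⊆ (⋃ k, S (n + k + 1) \ S (n + k + 2)) ∪ ⋂ k, S k := by
    intro n ξ hξ
    by_cases hall : ∀ k, ξ ∈ S (n + k + 1)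
    · refine Or.inr (Set.mem_iInter.2 fun k => ?_)
      exact shadow_subset_shadow hT (s.vRay i) (show k ≤ n + k + 1 by omega) (hall k)
    · left
      classical
      push Not at hall
      obtain ⟨k, hk⟩ : ∃ k, Nat.find hall = k + 1 :=
        Nat.exists_eq_succ_of_ne_zero fun h => Nat.find_spec hall (by rw [h]; exact hξ)
      refine Set.mem_iUnion.2 ⟨k, ?_, ?_⟩
      · have := Nat.find_min hall (show k < Nat.find hall by omega)
        simpa using this
      · have := Nat.find_spec hall
        rwa [hk] at this
  have hbound : ∀ n, μ v (S (n + 1)) ≤ x ^ n * (B * M) := by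
    intro n
    have h0 : μ v (⋂ k, S k) = 0 := le_antisymm ((measure_mono (s.iInter_shadow_subset hT i)).trans
      (s.measure_cuspEnd_eq_zero hT hlf hval hunif hb hD hdisc hδ hμ i).le) zero_le
    calc μ v (S (n + 1)) ≤ ∑' k, μ v (S (n + k + 1) \ S (n + k + 2)) + 0 := by
          rw [← h0]
          exact (measure_mono (hmono n)).trans ((measure_union_le _ _).trans
            (add_le_add_left (measure_iUnion_le _) _))
      _ ≤ ∑' k, x ^ n * ((Nat.card (s.grp i (n + k + 1)) : ℝ≥0∞) *
            q₁ ^ (2 * (n + k + 1)) * M) := by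
          rw [add_zero]
          refine ENNReal.tsum_le_tsum fun k => ?_
          refine (s.measure_shadow_diff_le hT hD hdisc hμ i (n + k)).trans ?_
          rw [hxpow]
          have : x ^ (n + k + 1) ≤ x ^ n := pow_le_pow_right_of_le_one' hx1.le (by omega)
          calc _ = x ^ (n + k + 1) * ((Nat.card (s.grp i (n + k + 1)) : ℝ≥0∞) *
                  q₁ ^ (2 * (n + k + 1)) * M) := by ring
            _ ≤ _ := by gcongr
      _ ≤ x ^ n * (B * M) := by
          rw [ENNReal.tsum_mul_left, ENNReal.tsum_mul_right]
          gcongr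
          exact ENNReal.tsum_comp_le_tsum_of_injective (f := fun k => n + k + 1)
            (fun a b hab => by simpa using hab)
            fun n => (Nat.card (s.grp i n) : ℝ≥0∞) * q₁ ^ (2 * n)
  refine ne_top_of_le_ne_top ?_ (ENNReal.tsum_le_tsum hbound)
  rw [ENNReal.tsum_mul_right, ENNReal.tsum_geometric]
  exact ENNReal.mul_ne_top (ENNReal.inv_ne_top.2 (tsub_pos_of_lt hx1).ne')
    (ENNReal.mul_ne_top hB (measure_ne_top _ _))

end CuspDecomposition.Lifts

/-! ### Countability of the alphabet. -/

section Counting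

variable {V : Type*} {T : SimpleGraph V} {Γ : Subgroup (T ≃g T)} {D : CuspDecomposition Γ}

theorem countable_letter [Countable V] [Countable Γ] (s : D.Lifts) : Countable s.Letter := by
  have : Countable T.Dart := SimpleGraph.Dart.toProd_injective.countable
  have : Countable (QEdge Γ) := Quotient.countable
  have h1 : ∀ i n, Countable (s.UpTurn i n) := fun i n => by
    have : Countable (Γ ⧸ s.grp i n) := Quotient.countable
    unfold CuspDecomposition.Lifts.UpTurn
    infer_instance
  have h2 : ∀ i n, Countable (s.DownTurn i n) := fun i n => by
    unfold CuspDecomposition.Lifts.DownTurn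
    infer_instance
  let f : QEdge Γ ⊕ (Σ i : Fin D.r, Σ n : ℕ, s.UpTurn i n) ⊕
      (Σ i : Fin D.r, Σ n : ℕ, s.DownTurn i n) → s.Letter :=
    Sum.elim .edge (Sum.elim (fun p => .up p.1 p.2.1 p.2.2) fun p => .down p.1 p.2.1 p.2.2)
  refine Function.Surjective.countable (f := f) fun β => ?_
  cases β with
  | edge e => exact ⟨Sum.inl e, rfl⟩
  | up i n c => exact ⟨Sum.inr (Sum.inl ⟨i, n, c⟩), rfl⟩
  | down i n c => exact ⟨Sum.inr (Sum.inr ⟨i, n, c⟩), rfl⟩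

end Counting

/-! ### The fundamental domain: finite mass, and invariance on the quotient. -/

namespace CuspDecomposition.Lifts

variable {V : Type*} {T : SimpleGraph V} {Γ : Subgroup (T ≃g T)} {D : CuspDecomposition Γ}
  (s : D.Lifts) {δ : ℝ} {μ : V → Measure (Ends T)}

open Geodesic

/-- A strict fundamental domain for the action of `Γ` on the geodesics. -/
def fundDomain : Set (Geodesic T) := ⋃ β, s.cellUp β

theorem isOpen_fundDomain : IsOpen s.fundDomain := isOpen_iUnion fun β => isOpen_cellUp β

theorem existsUnique_smul_mem (hT : T.IsTree) (hD : D.IsFree) (ℓ : Geodesic T) :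
    ∃! γ : Γ, γ • ℓ ∈ s.fundDomain := by
  obtain ⟨γ, β, h⟩ := exists_code (s := s) hD ℓ
  refine ⟨γ, Set.mem_iUnion.2 ⟨β, h⟩, fun γ' h' => ?_⟩
  obtain ⟨β', h'⟩ := Set.mem_iUnion.1 h'
  exact mul_inv_eq_one.1 (code_unique hT hD (γ := γ' * γ⁻¹) h
    (by rwa [mul_smul, inv_smul_smul])).1

theorem isFundamentalDomain_shift (hT : T.IsTree) (hD : D.IsFree) (m : Measure (Geodesic T))
    (k : ℤ) : IsFundamentalDomain Γ (Geodesic.shift k ⁻¹' s.fundDomain) m :=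
  IsFundamentalDomain.mk' (s.isOpen_fundDomain.preimage (continuous_shift k)).nullMeasurableSet
    fun ℓ => s.existsUnique_smul_mem hT hD (ℓ.shift k)

theorem isFundamentalDomain (hT : T.IsTree) (hD : D.IsFree) (m : Measure (Geodesic T)) :
    IsFundamentalDomain Γ s.fundDomain m :=
  IsFundamentalDomain.mk' s.isOpen_fundDomain.nullMeasurableSet (s.existsUnique_smul_mem hT hD)

theorem bowenMargulisUp_coord_le [Countable V] (hT : T.IsTree) (hμ : IsPattersonSullivan Γ δ μ)
    (x y : V) (k : ℤ) {A B : Set (Ends T)} (hA : MeasurableSet A) (hB : MeasurableSet B) :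
    bowenMargulisUp δ μ x {ℓ | ℓ.toFun k = y ∧ ℓ.ends ∈ A ×ˢ B} ≤ μ y A * μ y B := by
  have := hμ.finite y
  rw [bowenMargulisUp_coord hT hμ x y k (hA.prod hB), ← Measure.prod_prod]
  exact measure_mono Set.inter_subset_left

/-- All cells of height `n` in a cusp, turns included, are covered at once by a condition at the
core vertex `v_{i,0}`, met at time `-n` in an ascent and at time `n + 1` in a descent. Each piece is
bounded by the mass of a shadow, which is summable in `n`. -/
theorem fundDomain_subset (hT : T.IsTree) : s.fundDomain ⊆
    (⋃ e : D.coreEdge, {ℓ | ℓ.toFun 0 = (s.lift e).fst ∧ ℓ.ends ∈ Set.univ ×ˢ Set.univ}) ∪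
    ⋃ p : Fin D.r × ℕ,
      ({ℓ | ℓ.toFun (-p.2) = s.vx p.1 0 ∧
        ℓ.ends ∈ Set.univ ×ˢ shadow (s.vx p.1 0) (s.vx p.1 (p.2 + 1))} ∪
      {ℓ | ℓ.toFun (p.2 + 1) = s.vx p.1 0 ∧
        ℓ.ends ∈ shadow (s.vx p.1 0) (s.vx p.1 (p.2 + 1)) ×ˢ Set.univ}) := by
  have key : ∀ {ℓ : Geodesic T} {i n}, Ascends s ℓ i n → ℓ.toFun (-n) = s.vx i 0 ∧
      ℓ.endPlus ∈ shadow (s.vx i 0) (s.vx i (n + 1)) := by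
    intro ℓ i n h
    have h0 : ℓ.toFun (-n) = s.vx i 0 := by
      have := h 0 (by omega)
      simpa using this
    have h1 := h (n + 1) le_rfl
    refine ⟨h0, ℓ.posRay (-n), ?_, ℓ.toEnd_posRay _, n + 1, ?_⟩
    · rw [← h0]
      change ℓ.toFun (-n + (0 : ℕ)) = _
      simp
    · rw [← h1]
      rfl
  intro ℓ hℓ
  obtain ⟨β, hβ⟩ := Set.mem_iUnion.1 hℓ
  rcases cellUp_cases hT hβ with ⟨e, he, -, h⟩ | ⟨i, n, h, -⟩ | ⟨i, n, h, -⟩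
  · exact Or.inl (Set.mem_iUnion.2 ⟨⟨e, he⟩, congrArg (fun d : T.Dart => d.fst) h, trivial, trivial⟩)
  · obtain ⟨h1, h2⟩ := key h
    exact Or.inr (Set.mem_iUnion.2 ⟨(i, n), Or.inl ⟨h1, trivial, h2⟩⟩)
  · obtain ⟨h1, h2⟩ := key h
    refine Or.inr (Set.mem_iUnion.2 ⟨(i, n), Or.inr ⟨?_, ?_, trivial⟩⟩)
    · change ℓ.toFun (n + 1) = _
      rw [← h1]
      change _ = ℓ.toFun (1 - -n)
      congr 1
      ring
    · have : ℓ.rev.endPlus = ℓ.endMinus := by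
        rw [← ℓ.toEnd_negRay 1]
        rfl
      change ℓ.endMinus ∈ _
      rwa [← this]

theorem bowenMargulisUp_fundDomain_ne_top (hT : T.IsTree)
    (hlf : ∀ v, (T.neighborSet v).Finite)
    (hval : ∀ v, (T.neighborSet v).ncard ≠ 2) (hunif : IsUniform T) (hb : Branching T)
    (hD : D.IsFree) (hdisc : IsDiscreteGroup Γ) {x₀ : V}
    (hδ : δ = (criticalExponent Γ x₀).toReal) (hμ : IsPattersonSullivan Γ δ μ) (x : V) :
    bowenMargulisUp δ μ x s.fundDomain ≠ ⊤ := by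
  have := hμ.finite
  have hcount : Countable V := countable_of_locallyFinite hT hlf
  have hfin : Finite D.coreEdge := D.finite_edge
  have := Fintype.ofFinite D.coreEdge
  refine ne_top_of_le_ne_top ?_ ((measure_mono (s.fundDomain_subset hT)).trans
    ((measure_union_le _ _).trans (add_le_add (measure_iUnion_le _) (measure_iUnion_le _))))
  refine ENNReal.add_ne_top.2 ⟨?_, ?_⟩
  · rw [tsum_fintype]
    refine (ENNReal.sum_lt_top.2 fun e _ => ?_).ne
    exact (bowenMargulisUp_coord_le hT hμ x _ 0 MeasurableSet.univ MeasurableSet.univ).trans_lt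
      (ENNReal.mul_lt_top (measure_lt_top _ _) (measure_lt_top _ _))
  · rw [ENNReal.tsum_prod', tsum_fintype]
    refine (ENNReal.sum_lt_top.2 fun i _ => ?_).ne
    set S : ℕ → ℝ≥0∞ := fun n => μ (s.vx i 0) (shadow (s.vx i 0) (s.vx i (n + 1))) with hS
    refine (ENNReal.tsum_le_tsum (g := fun n => 2 * μ (s.vx i 0) Set.univ * S n)
      fun n => ?_).trans_lt ?_
    · refine (measure_union_le _ _).trans ?_
      have h1 := bowenMargulisUp_coord_le hT hμ x (s.vx i 0) (-n) MeasurableSet.univ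
        (measurableSet_shadow (s.vx i 0) (s.vx i (n + 1)))
      have h2 := bowenMargulisUp_coord_le hT hμ x (s.vx i 0) (n + 1)
        (measurableSet_shadow (s.vx i 0) (s.vx i (n + 1))) MeasurableSet.univ
      refine (add_le_add h1 h2).trans_eq ?_
      rw [hS]
      ring
    · rw [ENNReal.tsum_mul_left]
      exact ENNReal.mul_lt_top (ENNReal.mul_lt_top (by simp) (measure_lt_top _ _))
        (s.tsum_measure_shadow_ne_top hT hlf hval hunif hb hD hdisc hδ hμ i).lt_top

theorem bowenMargulisUp_fundDomain_pos [Countable V] (hT : T.IsTree) (hb : Branching T)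
    (hD : D.IsFree) (hμ : IsPattersonSullivan Γ δ μ) (x : V) :
    bowenMargulisUp δ μ x s.fundDomain ≠ 0 := by
  refine (bowenMargulisUp_pos_of_isOpen hT hμ x s.isOpen_fundDomain ?_).ne'
  obtain ⟨w, -, hw⟩ := hb x x
  obtain ⟨ℓ, -⟩ := exists_geodesic_edge hT hb ⟨(x, w), hw⟩
  obtain ⟨γ, hγ, -⟩ := s.existsUnique_smul_mem hT hD ℓ
  exact ⟨_, hγ⟩

theorem bowenMargulis_apply [Countable V] [Countable Γ] (hT : T.IsTree) (hD : D.IsFree)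
    (hμ : IsPattersonSullivan Γ δ μ) (x : V) {A : Set (GeodQuot Γ)} (hA : MeasurableSet A) :
    bowenMargulis Γ δ μ x A = (bowenMargulisUp δ μ x s.fundDomain)⁻¹ *
      bowenMargulisUp δ μ x (GeodQuot.proj Γ ⁻¹' A ∩ s.fundDomain) := by
  have := smulInvariant_bowenMargulisUp hT hμ x
  have hi := inducedMeasure_eq (s.isFundamentalDomain hT hD (bowenMargulisUp δ μ x))
  have hm : Measurable (fun ℓ : Geodesic T => (Quotient.mk _ ℓ : GeodQuot Γ)) :=
    GeodQuot.measurable_proj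
  have happ : ∀ B : Set (GeodQuot Γ), MeasurableSet B →
      inducedMeasure Γ (bowenMargulisUp δ μ x) B =
        bowenMargulisUp δ μ x (GeodQuot.proj Γ ⁻¹' B ∩ s.fundDomain) := by
    intro B hB
    rw [hi, Measure.map_apply hm hB, Measure.restrict_apply (hm hB)]
    rfl
  rw [bowenMargulis, Measure.smul_apply, happ _ MeasurableSet.univ, happ _ hA, Set.preimage_univ,
    Set.univ_inter, smul_eq_mul]

theorem measurable_flow (k : ℤ) : Measurable (GeodQuot.flow Γ k) := fun _ hA =>
  (continuous_shift (T := T) k).measurable (GeodQuot.measurable_proj hA)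

/-- A translate in time of the fundamental domain is again one, and `Γ`-invariant sets have the same
measure in both. -/
theorem bowenMargulis_map_flow [Countable V] [Countable Γ] (s : D.Lifts) (hT : T.IsTree)
    (hD : D.IsFree) (hμ : IsPattersonSullivan Γ δ μ) (x : V) (k : ℤ) :
    (bowenMargulis Γ δ μ x).map (GeodQuot.flow Γ k) = bowenMargulis Γ δ μ x := by
  have := smulInvariant_bowenMargulisUp hT hμ x
  ext A hA
  have hF := measurable_flow (Γ := Γ) k hA
  rw [Measure.map_apply (measurable_flow k) hA, s.bowenMargulis_apply hT hD hμ x hF,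
    s.bowenMargulis_apply hT hD hμ x hA]
  congr 1
  have hpA : MeasurableSet (GeodQuot.proj Γ ⁻¹' A) := GeodQuot.measurable_proj hA
  rw [(s.isFundamentalDomain hT hD _).measure_set_eq
    (s.isFundamentalDomain_shift hT hD (bowenMargulisUp δ μ x) (-k)) hpA fun γ => ?_]
  · rw [← bowenMargulisUp_shift hT hμ x k,
      Measure.map_apply (continuous_shift k).measurable (hpA.inter
        (s.isOpen_fundDomain.preimage (continuous_shift (-k))).measurableSet),
      bowenMargulisUp_shift hT hμ x k]
    congr 1
    ext ℓ
    change _ ∧ _ ↔ _ ∧ (ℓ.shift k).shift (-k) ∈ s.fundDomain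
    rw [shift_shift, add_neg_cancel, shift_zero]
    rfl
  · ext ℓ
    change GeodQuot.proj Γ (γ • ℓ) ∈ A ↔ GeodQuot.proj Γ ℓ ∈ A
    have : GeodQuot.proj Γ (γ • ℓ) = GeodQuot.proj Γ ℓ := Quotient.sound ⟨γ, rfl⟩
    rw [this]

end CuspDecomposition.Lifts

/-! ### Markov measures on two-sided sequences. -/

section MarkovShift

variable {A : Type*}

/-- The cylinder of the sequences with prescribed values on `a, …, a + k`. -/
def cyl (a : ℤ) (k : ℕ) (α : ℕ → A) : Set (ℤ → A) := {x | ∀ j ≤ k, x (a + j) = α j}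

theorem cyl_zero (k : ℕ) (α : ℕ → A) : cyl 0 k α = {x | ∀ j ≤ k, x (j : ℤ) = α j} := by
  simp [cyl]

variable [MeasurableSpace A]

theorem measurable_seqShift : Measurable (seqShift : (ℤ → A) → ℤ → A) :=
  measurable_pi_lambda _ fun i => measurable_pi_apply (i + 1)

/-- The law of the coordinate at time `0`. -/
noncomputable def initialLaw (μ : Measure (ℤ → A)) (α : A) : ℝ≥0∞ := μ {x | x 0 = α}

/-- The conditional law of the coordinate at time `1` given the one at time `0`. -/
noncomputable def transitionLaw (μ : Measure (ℤ → A)) (α β : A) : ℝ≥0∞ :=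
  μ {x | x 0 = α ∧ x 1 = β} / initialLaw μ α

/-- The hypothesis is conditional independence of past and next letter given the present, written
without division; the cylinder formula follows by induction on the length. -/
theorem isMarkovMeasure_of_independence {μ : Measure (ℤ → A)} [IsProbabilityMeasure μ]
    (hinv : μ.map seqShift = μ) (hp : ∀ α, initialLaw μ α ≠ 0)
    (hind : ∀ (k : ℕ) (α : ℕ → A), μ {x | ∀ j ≤ k + 1, x (j : ℤ) = α j} * initialLaw μ (α k) =
      μ {x | ∀ j ≤ k, x (j : ℤ) = α j} * μ {x | x 0 = α k ∧ x 1 = α (k + 1)}) :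
    IsMarkovMeasure (initialLaw μ) (transitionLaw μ) μ where
  prob := inferInstance
  invariant := hinv
  cylinder k α := by
    induction k with
    | zero => simp [initialLaw]
    | succ k ih =>
      have h := hind k α
      rw [Finset.prod_range_succ, ← mul_assoc, ← ih, transitionLaw, ← mul_div_assoc, ← h,
        ENNReal.mul_div_cancel_right (hp _) (measure_ne_top _ _)]

variable [DiscreteMeasurableSpace A]

theorem measurableSet_coord_eq (i : ℤ) (a : A) : MeasurableSet {x : ℤ → A | x i = a} :=
  measurable_pi_apply (X := fun _ : ℤ => A) i (measurableSet_singleton a)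

theorem measurableSet_cyl (a : ℤ) (k : ℕ) (α : ℕ → A) : MeasurableSet (cyl a k α) := by
  have : cyl a k α = ⋂ j : ℕ, ⋂ _ : j ≤ k, {x : ℤ → A | x (a + j) = α j} := by
    ext x
    simp [cyl]
  rw [this]
  exact MeasurableSet.iInter fun j => MeasurableSet.iInter fun _ => measurableSet_coord_eq _ _

theorem measure_cyl {μ : Measure (ℤ → A)} (hinv : μ.map seqShift = μ) (a : ℤ) (k : ℕ)
    (α : ℕ → A) : μ (cyl a k α) = μ {x | ∀ j ≤ k, x (j : ℤ) = α j} := by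
  have hstep : ∀ b, μ (cyl (b + 1) k α) = μ (cyl b k α) := by
    intro b
    conv_rhs => rw [← hinv, Measure.map_apply measurable_seqShift (measurableSet_cyl _ _ _)]
    congr 1
    ext x
    refine forall₂_congr fun j _ => ?_
    change x (b + 1 + j) = _ ↔ x (b + j + 1) = _
    rw [add_right_comm]
  rw [← cyl_zero]
  induction a using Int.induction_on with
  | zero => rfl
  | succ n ih => rw [hstep, ih]
  | pred n ih => rw [← hstep, sub_add_cancel, ih]

theorem initialLaw_one {μ : Measure (ℤ → A)} (hinv : μ.map seqShift = μ) (α : A) :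
    μ {x | x 1 = α} = initialLaw μ α := by
  have h1 := measure_cyl hinv 1 0 fun _ => α
  simpa [cyl, initialLaw] using h1

theorem tsum_measure_inter_coord [Countable A] (μ : Measure (ℤ → A)) {E : Set (ℤ → A)}
    (hE : MeasurableSet E) (i : ℤ) : ∑' α, μ (E ∩ {x | x i = α}) = μ E := by
  rw [← measure_iUnion]
  · congr 1
    ext x
    simp
  · intro α β hαβ
    rw [Function.onFun, Set.disjoint_left]
    rintro x ⟨-, h⟩ ⟨-, h'⟩
    exact hαβ (Eq.trans (Eq.symm h) h')
  · exact fun α => hE.inter (measurableSet_coord_eq _ _)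

theorem isStationaryChain_of_invariant [Countable A] {μ : Measure (ℤ → A)}
    [IsProbabilityMeasure μ] (hinv : μ.map seqShift = μ) (hp : ∀ α, initialLaw μ α ≠ 0) :
    IsStationaryChain (initialLaw μ) (transitionLaw μ) where
  mass := by
    have := tsum_measure_inter_coord μ MeasurableSet.univ 0
    simp only [Set.univ_inter, measure_univ] at this
    exact this
  stochastic α := by
    have := tsum_measure_inter_coord μ (measurableSet_coord_eq 0 α) 1
    simp only [transitionLaw, div_eq_mul_inv]
    rw [ENNReal.tsum_mul_right]
    change (∑' β, μ ({x | x 0 = α} ∩ {x | x 1 = β})) * _ = 1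
    rw [this]
    exact ENNReal.mul_inv_cancel (hp α) (measure_ne_top _ _)
  stationary β := by
    have := tsum_measure_inter_coord μ (measurableSet_coord_eq 1 β) 0
    rw [initialLaw_one hinv] at this
    rw [← this]
    refine tsum_congr fun α => ?_
    rw [transitionLaw, ENNReal.mul_div_cancel (hp α) (measure_ne_top _ _), Set.inter_comm]
    rfl

/-- Invariance and the cylinder formula give the laws of all windows `[-n, n]`, determined by points
since the alphabet is countable. These give all finite marginals, hence the measure as a projective
limit. -/
theorem IsMarkovMeasure.unique [Countable A] {p : A → ℝ≥0∞} {P : A → A → ℝ≥0∞}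
    {μ μ' : Measure (ℤ → A)} (h : IsMarkovMeasure p P μ) (h' : IsMarkovMeasure p P μ') :
    μ = μ' := by
  have := h.prob
  have := h'.prob
  let w : (n : ℕ) → (ℤ → A) → Fin (2 * n + 1) → A := fun n x j => x (-n + (j : ℕ))
  have hw : ∀ n, Measurable (w n) := fun n =>
    measurable_pi_lambda _ fun j => measurable_pi_apply _
  have hmap : ∀ n, μ.map (w n) = μ'.map (w n) := by
    intro n
    refine Measure.ext_of_singleton fun y => ?_
    rw [Measure.map_apply (hw n) (measurableSet_singleton _),
      Measure.map_apply (hw n) (measurableSet_singleton _)]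
    -- Values at `j > 2n` wrap around but are never read by the cylinder.
    let α : ℕ → A := fun j => y (Fin.ofNat (2 * n + 1) j)
    have hset : w n ⁻¹' {y} = cyl (-n) (2 * n) α := by
      ext x
      constructor
      · rintro rfl j hj
        change _ = x (-n + ((Fin.ofNat (2 * n + 1) j : Fin (2 * n + 1)) : ℕ))
        rw [Fin.val_ofNat, Nat.mod_eq_of_lt (by omega)]
      · intro hx
        refine funext fun j => ?_
        have := hx j (by omega)
        change x (-n + (j : ℕ)) = _
        rw [this]
        change y _ = y j
        congr 1
        exact Fin.ext (by rw [Fin.val_ofNat, Nat.mod_eq_of_lt j.2])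
    rw [hset, measure_cyl h.invariant, measure_cyl h'.invariant, h.cylinder, h'.cylinder]
  have hproj : IsProjectiveLimit μ fun I : Finset ℤ => μ'.map I.restrict := by
    intro I
    let n := I.sup Int.natAbs
    have hn : ∀ i ∈ I, i.natAbs ≤ n := fun i hi => Finset.le_sup (f := Int.natAbs) hi
    let g : (Fin (2 * n + 1) → A) → I → A := fun y i =>
      y (Fin.ofNat (2 * n + 1) (i.1 + n).toNat)
    have hg : Measurable g := measurable_of_countable g
    have hres : (I.restrict : (ℤ → A) → I → A) = g ∘ w n := by
      refine funext fun x => funext fun i => ?_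
      change x i = x (-n + ((Fin.ofNat (2 * n + 1) (i.1 + n).toNat : Fin (2 * n + 1)) : ℕ))
      have := hn i i.2
      rw [Fin.val_ofNat, Nat.mod_eq_of_lt (by omega)]
      congr 1
      omega
    change μ.map I.restrict = μ'.map I.restrict
    rw [hres, ← Measure.map_map hg (hw n), ← Measure.map_map hg (hw n), hmap n]
  have : ∀ I : Finset ℤ, IsFiniteMeasure (μ'.map (I.restrict : (ℤ → A) → I → A)) :=
    fun I => inferInstance
  exact hproj.unique fun I => rfl

/-- A sequence with a forbidden transition has a null cylinder neighbourhood; around an admissible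
sequence every cylinder has positive mass, as a product of nonzero factors. -/
theorem IsMarkovMeasure.support_eq [TopologicalSpace A] [DiscreteTopology A] {p : A → ℝ≥0∞}
    {P : A → A → ℝ≥0∞} {μ : Measure (ℤ → A)} (h : IsMarkovMeasure p P μ) (hp : ∀ α, p α ≠ 0)
    {R : A → A → Prop} (hR : ∀ α β, R α β → P α β ≠ 0)
    (hμ : μ {x | ∀ i, R (x i) (x (i + 1))}ᶜ = 0) :
    μ.support = {x | ∀ i, R (x i) (x (i + 1))} := by
  ext x
  rw [Measure.mem_support_iff_forall]
  constructor
  · intro hx i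
    by_contra hno
    have hU : {y : ℤ → A | y i = x i ∧ y (i + 1) = x (i + 1)} ∈ 𝓝 x := by
      refine IsOpen.mem_nhds ?_ ⟨rfl, rfl⟩
      exact ((isOpen_discrete {x i}).preimage (continuous_apply (A := fun _ => A) i)).inter
        ((isOpen_discrete {x (i + 1)}).preimage (continuous_apply (A := fun _ => A) (i + 1)))
    refine (hx _ hU).ne' (measure_mono_null ?_ hμ)
    rintro y ⟨h1, h2⟩ hy
    have := hy i
    rw [h1, h2] at this
    exact hno this
  · intro hx U hU
    rw [nhds_pi, Filter.mem_pi] at hU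
    obtain ⟨I, hI, t, ht, hsub⟩ := hU
    let n := hI.toFinset.sup Int.natAbs
    have hn : ∀ i ∈ I, i.natAbs ≤ n := fun i hi =>
      Finset.le_sup (f := Int.natAbs) (hI.mem_toFinset.2 hi)
    let α : ℕ → A := fun j => x (-n + j)
    have hcyl : cyl (-n) (2 * n) α ⊆ U := by
      refine fun y hy => hsub fun i hi => ?_
      have hi' := hn i hi
      have := hy (i + n).toNat (by omega)
      change y (-n + ((i + n).toNat : ℕ)) = x (-n + ((i + n).toNat : ℕ)) at this
      rw [show (-(n : ℤ) + ((i + n).toNat : ℕ)) = i by omega] at this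
      rw [this]
      exact mem_of_mem_nhds (ht i)
    refine lt_of_lt_of_le ?_ (measure_mono hcyl)
    rw [measure_cyl h.invariant, h.cylinder]
    refine pos_of_ne_zero (mul_ne_zero (hp _) (Finset.prod_ne_zero_iff.2 fun j _ => hR _ _ ?_))
    have := hx (-n + j)
    rwa [add_assoc, ← Nat.cast_succ] at this

end MarkovShift

/-! ### Markov labels: from rectangles of geodesics to Markov measures. -/

namespace CuspDecomposition.Lifts

variable {V : Type*} {T : SimpleGraph V} {Γ : Subgroup (T ≃g T)} {D : CuspDecomposition Γ}
  {s : D.Lifts} {δ : ℝ} {μ : V → Measure (Ends T)}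

open Geodesic

/-- The part of the fundamental domain where the function `f` takes the value `a`. -/
def labelCell (s : D.Lifts) {A : Type*} (f : Geodesic T → A) (a : A) : Set (Geodesic T) :=
  {ℓ | ℓ ∈ s.fundDomain ∧ f ℓ = a}

/-- An invariant function on the geodesics whose successive values along the orbits of the geodesic
transformation form a Markov chain: future and past are independent given the present. -/
structure IsMarkovLabel (s : D.Lifts) {A : Type*} (f : Geodesic T → A) : Prop where
  smul : ∀ (γ : Γ) ℓ, f (γ • ℓ) = f ℓ
  surjective : Function.Surjective f
  isOpen : ∀ a, IsOpen (s.labelCell f a)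
  rect : ∀ a, IsRect (s.labelCell f a)
  future : ∀ a, ∀ ℓ ∈ s.labelCell f a, ∀ ℓ' ∈ s.labelCell f a,
    (∀ k, 0 ≤ k → ℓ'.toFun k = ℓ.toFun k) → ∀ j : ℕ, f (ℓ'.shift j) = f (ℓ.shift j)
  past : ∀ a, ∀ ℓ ∈ s.labelCell f a, ∀ ℓ' ∈ s.labelCell f a,
    (∀ k ≤ 1, ℓ'.toFun k = ℓ.toFun k) → ∀ j : ℕ, f (ℓ'.shift (-j)) = f (ℓ.shift (-j))

namespace IsMarkovLabel

variable {A : Type*} {f : Geodesic T → A} (hf : IsMarkovLabel s f)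

/-- The function induced on the quotient. -/
def desc (hf : IsMarkovLabel s f) : GeodQuot Γ → A :=
  Quotient.lift f fun a b ⟨γ, h⟩ => by rw [← h]; exact hf.smul γ b

/-- The sequence of values along an orbit of the geodesic transformation. -/
def code (hf : IsMarkovLabel s f) (x : GeodQuot Γ) (i : ℤ) : A := hf.desc (GeodQuot.flow Γ i x)

theorem code_flow (x : GeodQuot Γ) : hf.code (GeodQuot.flow Γ 1 x) = seqShift (hf.code x) := by
  induction x using Quotient.inductionOn with
  | h ℓ =>
    refine funext fun i => ?_
    change f ((ℓ.shift 1).shift i) = f (ℓ.shift (i + 1))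
    rw [shift_shift, add_comm]

theorem isOpen_preimage (hT : T.IsTree) (hD : D.IsFree) (hf : IsMarkovLabel s f) (S : Set A) :
    IsOpen (f ⁻¹' S) := by
  have : f ⁻¹' S = ⋃ γ : Γ, (fun ℓ : Geodesic T => γ • ℓ) ⁻¹' ⋃ a ∈ S, s.labelCell f a := by
    ext ℓ
    simp only [Set.mem_preimage, Set.mem_iUnion, exists_prop]
    constructor
    · intro h
      obtain ⟨γ, hγ, -⟩ := s.existsUnique_smul_mem hT hD ℓ
      exact ⟨γ, f ℓ, h, hγ, hf.smul γ ℓ⟩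
    · rintro ⟨γ, a, ha, -, h⟩
      rwa [← hf.smul γ, h]
  rw [this]
  exact isOpen_iUnion fun γ => (isOpen_biUnion fun a _ => hf.isOpen a).preimage
    (continuous_smul γ)

theorem measurable_code [MeasurableSpace A] (hT : T.IsTree) (hD : D.IsFree)
    (hf : IsMarkovLabel s f) : Measurable hf.code := by
  refine measurable_pi_lambda _ fun i => ?_
  have h : Measurable hf.desc := fun S _ => by
    refine measurableSet_quotient.2 ?_
    exact (isOpen_preimage hT hD hf S).measurableSet
  exact h.comp (measurable_flow i)

variable [Countable V] [Countable Γ] [MeasurableSpace A]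

theorem map_code_apply (hT : T.IsTree) (hD : D.IsFree) (hμ : IsPattersonSullivan Γ δ μ) (x : V)
    (hf : IsMarkovLabel s f) {E : Set (ℤ → A)} (hE : MeasurableSet E) :
    (bowenMargulis Γ δ μ x).map hf.code E = (bowenMargulisUp δ μ x s.fundDomain)⁻¹ *
      bowenMargulisUp δ μ x {ℓ | ℓ ∈ s.fundDomain ∧ (fun i => f (ℓ.shift i)) ∈ E} := by
  rw [Measure.map_apply (measurable_code hT hD hf) hE,
    s.bowenMargulis_apply hT hD hμ x (measurable_code hT hD hf hE)]
  congr 2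
  ext ℓ
  exact and_comm

theorem map_code_invariant (hT : T.IsTree) (hD : D.IsFree) (hμ : IsPattersonSullivan Γ δ μ) (x : V)
    (hf : IsMarkovLabel s f) :
    ((bowenMargulis Γ δ μ x).map hf.code).map seqShift = (bowenMargulis Γ δ μ x).map hf.code := by
  conv_rhs => rw [← bowenMargulis_map_flow s hT hD hμ x 1]
  rw [Measure.map_map measurable_seqShift (measurable_code hT hD hf),
    Measure.map_map (measurable_code hT hD hf) (measurable_flow 1)]
  congr 1
  exact funext fun y => (hf.code_flow y).symm

theorem initialLaw_map_code [DiscreteMeasurableSpace A] (hT : T.IsTree) (hD : D.IsFree)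
    (hμ : IsPattersonSullivan Γ δ μ) (x : V) (hf : IsMarkovLabel s f) (a : A) :
    initialLaw ((bowenMargulis Γ δ μ x).map hf.code) a =
      (bowenMargulisUp δ μ x s.fundDomain)⁻¹ * bowenMargulisUp δ μ x (s.labelCell f a) := by
  rw [initialLaw, map_code_apply hT hD hμ x hf (measurableSet_coord_eq 0 a)]
  congr 2
  ext ℓ
  change _ ∧ f (ℓ.shift 0) = a ↔ _
  rw [shift_zero]
  rfl

theorem initialLaw_map_code_ne_zero [DiscreteMeasurableSpace A] (hT : T.IsTree) (hD : D.IsFree)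
    (hμ : IsPattersonSullivan Γ δ μ) (x : V)
    (htop : bowenMargulisUp δ μ x s.fundDomain ≠ ⊤) (hf : IsMarkovLabel s f) (a : A) :
    initialLaw ((bowenMargulis Γ δ μ x).map hf.code) a ≠ 0 := by
  rw [initialLaw_map_code hT hD hμ x hf]
  refine mul_ne_zero (ENNReal.inv_ne_zero.2 htop) ?_
  refine (bowenMargulisUp_pos_of_isOpen hT hμ x (hf.isOpen a) ?_).ne'
  obtain ⟨ℓ, rfl⟩ := hf.surjective a
  obtain ⟨γ, hγ, -⟩ := s.existsUnique_smul_mem hT hD ℓ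
  exact ⟨γ • ℓ, hγ, hf.smul γ ℓ⟩

theorem isMarkovMeasure_map_code [DiscreteMeasurableSpace A] (hT : T.IsTree) (hD : D.IsFree)
    (hμ : IsPattersonSullivan Γ δ μ) (x : V)
    (htop : bowenMargulisUp δ μ x s.fundDomain ≠ ⊤)
    [IsProbabilityMeasure (bowenMargulis Γ δ μ x)] (hf : IsMarkovLabel s f) :
    IsMarkovMeasure (initialLaw ((bowenMargulis Γ δ μ x).map hf.code))
      (transitionLaw ((bowenMargulis Γ δ μ x).map hf.code))
      ((bowenMargulis Γ δ μ x).map hf.code) := by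
  have hinv := map_code_invariant hT hD hμ x hf
  have := Measure.isProbabilityMeasure_map (μ := bowenMargulis Γ δ μ x)
    (measurable_code hT hD hf).aemeasurable
  refine isMarkovMeasure_of_independence hinv
    (initialLaw_map_code_ne_zero hT hD hμ x htop hf) fun k α => ?_
  -- The cylinders are moved to start at `-k`, so that the present letter `α k` sits at time `0`,
  -- where the label cell is a rectangle. `S₂` is then a past event and `S₁` a future event.
  rw [← measure_cyl hinv (-k), ← measure_cyl hinv (-k) k, initialLaw_map_code hT hD hμ x hf,
    map_code_apply hT hD hμ x hf (measurableSet_cyl _ _ _),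
    map_code_apply hT hD hμ x hf (measurableSet_cyl _ _ _),
    map_code_apply hT hD hμ x hf (E := {x | x 0 = α k ∧ x 1 = α (k + 1)})
      ((measurableSet_coord_eq 0 _).inter (measurableSet_coord_eq 1 _))]
  set C := s.labelCell f (α k) with hC
  set S₁ : Set (Geodesic T) := {ℓ | ℓ ∈ C ∧ f (ℓ.shift 1) = α (k + 1)} with hS₁
  set S₂ : Set (Geodesic T) := {ℓ | ℓ ∈ C ∧ ∀ j ≤ k, f (ℓ.shift (-j)) = α (k - j)} with hS₂
  have hmf : ∀ i a, MeasurableSet {ℓ : Geodesic T | f (ℓ.shift i) = a} := fun i a =>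
    ((isOpen_preimage hT hD hf {a}).preimage (continuous_shift i)).measurableSet
  have hCm : MeasurableSet C := (hf.isOpen _).measurableSet
  have hpast : ∀ ℓ : Geodesic T, (∀ j ≤ k, f (ℓ.shift (-k + j)) = α j) ↔
      ∀ j ≤ k, f (ℓ.shift (-j)) = α (k - j) := by
    intro ℓ
    constructor
    · intro h j hj
      rw [← h (k - j) (by omega)]
      congr 2
      omega
    · intro h j hj
      have := h (k - j) (by omega)
      rw [show k - (k - j) = j by omega] at this
      rw [← this]
      congr 2
      omega
  have e2 : {ℓ | ℓ ∈ s.fundDomain ∧ (fun i => f (ℓ.shift i)) ∈ cyl (-k) k α} = S₂ := by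
    ext ℓ
    change ℓ ∈ s.fundDomain ∧ (∀ j ≤ k, f (ℓ.shift (-k + j)) = α j) ↔ _
    rw [hpast]
    refine ⟨fun h => ⟨⟨h.1, ?_⟩, h.2⟩, fun h => ⟨h.1.1, h.2⟩⟩
    have := h.2 0 (Nat.zero_le _)
    rwa [Nat.cast_zero, neg_zero, shift_zero, Nat.sub_zero] at this
  have e1 : {ℓ | ℓ ∈ s.fundDomain ∧ (fun i => f (ℓ.shift i)) ∈
      {x | x 0 = α k ∧ x 1 = α (k + 1)}} = S₁ := by
    ext ℓ
    change ℓ ∈ s.fundDomain ∧ f (ℓ.shift 0) = α k ∧ f (ℓ.shift 1) = α (k + 1) ↔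
      (ℓ ∈ s.fundDomain ∧ f ℓ = α k) ∧ f (ℓ.shift 1) = α (k + 1)
    rw [shift_zero, and_assoc]
  have e12 : {ℓ | ℓ ∈ s.fundDomain ∧ (fun i => f (ℓ.shift i)) ∈ cyl (-k) (k + 1) α} =
      S₂ ∩ S₁ := by
    rw [← e2, ← e1]
    ext ℓ
    change ℓ ∈ s.fundDomain ∧ (∀ j ≤ k + 1, f (ℓ.shift (-k + j)) = α j) ↔
      (ℓ ∈ s.fundDomain ∧ ∀ j ≤ k, f (ℓ.shift (-k + j)) = α j) ∧
      (ℓ ∈ s.fundDomain ∧ f (ℓ.shift 0) = α k ∧ f (ℓ.shift 1) = α (k + 1))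
    constructor
    · rintro ⟨h, h'⟩
      refine ⟨⟨h, fun j hj => h' j (by omega)⟩, h, ?_, ?_⟩
      · rw [← h' k (by omega), neg_add_cancel]
      · rw [← h' (k + 1) le_rfl]
        congr 2
        push_cast
        ring
    · rintro ⟨⟨h, h'⟩, -, -, h1⟩
      refine ⟨h, fun j hj => ?_⟩
      rcases Nat.of_le_succ hj with hj | rfl
      · exact h' j hj
      · rw [← h1]
        congr 2
        push_cast
        ring
  have hm₁ : MeasurableSet S₁ := hCm.inter (hmf _ _)
  have hm₂ : MeasurableSet S₂ := by
    have : S₂ = C ∩ ⋂ j : ℕ, ⋂ _ : j ≤ k, {ℓ | f (ℓ.shift (-j)) = α (k - j)} := by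
      ext ℓ
      simp [hS₂]
    rw [this]
    exact hCm.inter (MeasurableSet.iInter fun j => MeasurableSet.iInter fun _ => hmf _ _)
  have hind := (hf.rect (α k)).independence hT hμ x hCm hm₁ hm₂
    (fun ℓ h => h.1) (fun ℓ h => h.1)
    (fun ℓ h ℓ' h' hag => ⟨h', (hf.future _ ℓ h.1 ℓ' h' hag 1).trans h.2⟩)
    (fun ℓ h ℓ' h' hag => ⟨h', fun j hj => (hf.past _ ℓ h.1 ℓ' h' hag j).trans (h.2 j hj)⟩)
  rw [e12, e2, e1, mul_mul_mul_comm, hind, mul_mul_mul_comm]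

end IsMarkovLabel

end CuspDecomposition.Lifts

/-! ### Normalisation of geodesics and the refined code. -/

namespace CuspDecomposition.Lifts

variable {V : Type*} {T : SimpleGraph V} {Γ : Subgroup (T ≃g T)} {D : CuspDecomposition Γ}
  {s : D.Lifts} {δ : ℝ} {μ : V → Measure (Ends T)}

open Geodesic

/-- `N ℓ` is the element of `Γ` moving `ℓ` into the fundamental domain, and `L ℓ` the letter of the
cell it is moved to. -/
def IsNormaliser (s : D.Lifts) (N : Geodesic T → Γ) (L : Geodesic T → s.Letter) : Prop :=
  ∀ ℓ γ β, γ • ℓ ∈ s.cellUp β ↔ γ = N ℓ ∧ β = L ℓ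

theorem exists_isNormaliser (hT : T.IsTree) (hD : D.IsFree) (s : D.Lifts) :
    ∃ N L, IsNormaliser s N L := by
  choose N L h using exists_code (s := s) hD
  refine ⟨N, L, fun ℓ γ β => ⟨fun hγ => ?_, ?_⟩⟩
  · have := code_unique hT hD (γ := γ * (N ℓ)⁻¹) (h ℓ) (by rwa [mul_smul, inv_smul_smul])
    exact ⟨mul_inv_eq_one.1 this.1, this.2.symm⟩
  · rintro ⟨rfl, rfl⟩
    exact h ℓ

namespace IsNormaliser

variable {N : Geodesic T → Γ} {L : Geodesic T → s.Letter} (h : IsNormaliser s N L)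

theorem mem (h : IsNormaliser s N L) (ℓ : Geodesic T) : N ℓ • ℓ ∈ s.cellUp (L ℓ) :=
  (h ℓ _ _).2 ⟨rfl, rfl⟩

theorem mem_cellUp (h : IsNormaliser s N L) {ℓ : Geodesic T} {β : s.Letter} :
    ℓ ∈ s.cellUp β ↔ N ℓ = 1 ∧ L ℓ = β := by
  have := h ℓ 1 β
  rw [one_smul] at this
  rw [this, eq_comm, eq_comm (a := β)]

theorem mem_fundDomain (h : IsNormaliser s N L) {ℓ : Geodesic T} :
    ℓ ∈ s.fundDomain ↔ N ℓ = 1 := by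
  rw [fundDomain, Set.mem_iUnion]
  exact ⟨fun ⟨β, hβ⟩ => (h.mem_cellUp.1 hβ).1, fun hN => ⟨L ℓ, h.mem_cellUp.2 ⟨hN, rfl⟩⟩⟩

theorem smul (h : IsNormaliser s N L) (γ : Γ) (ℓ : Geodesic T) :
    N (γ • ℓ) = N ℓ * γ⁻¹ ∧ L (γ • ℓ) = L ℓ := by
  have := (h (γ • ℓ) (N ℓ * γ⁻¹) (L ℓ)).1 (by rw [mul_smul, inv_smul_smul]; exact h.mem ℓ)
  exact ⟨this.1.symm, this.2.symm⟩

theorem labelCell_letter (h : IsNormaliser s N L) (β : s.Letter) :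
    s.labelCell L β = s.cellUp β := by
  ext ℓ
  rw [h.mem_cellUp, ← h.mem_fundDomain]
  rfl

theorem future (hT : T.IsTree) (hD : D.IsFree) (h : IsNormaliser s N L) {α : s.Letter}
    {ℓ ℓ' : Geodesic T} (hα : ℓ ∈ s.cellUp α) (hα' : ℓ' ∈ s.cellUp α)
    (hag : ∀ k, 0 ≤ k → ℓ'.toFun k = ℓ.toFun k) (j : ℕ) :
    N (ℓ'.shift j) = N (ℓ.shift j) ∧ L (ℓ'.shift j) = L (ℓ.shift j) := by
  have := (h _ _ _).1 (future_determined hT hD hα hα' hag j (h.mem _))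
  exact ⟨this.1.symm, this.2.symm⟩

theorem past (hT : T.IsTree) (hD : D.IsFree) (h : IsNormaliser s N L) {α : s.Letter}
    {ℓ ℓ' : Geodesic T} (hα : ℓ ∈ s.cellUp α) (hα' : ℓ' ∈ s.cellUp α)
    (hag : ∀ k ≤ 1, ℓ'.toFun k = ℓ.toFun k) (j : ℕ) :
    N (ℓ'.shift (-j)) = N (ℓ.shift (-j)) ∧ L (ℓ'.shift (-j)) = L (ℓ.shift (-j)) := by
  have := (h _ _ _).1 (past_determined hT hD hα hα' hag j (h.mem _))
  exact ⟨this.1.symm, this.2.symm⟩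

theorem isMarkovLabel_letter (hT : T.IsTree) (hb : Branching T) (hD : D.IsFree)
    (h : IsNormaliser s N L) : IsMarkovLabel s L where
  smul γ ℓ := (h.smul γ ℓ).2
  surjective β := by
    obtain ⟨ℓ, hℓ⟩ := cellUp_nonempty hT hb β
    exact ⟨ℓ, (h.mem_cellUp.1 hℓ).2⟩
  isOpen β := by
    rw [h.labelCell_letter]
    exact isOpen_cellUp β
  rect β := by
    rw [h.labelCell_letter]
    exact isRect_cellUp β
  future β ℓ hℓ ℓ' hℓ' hag j := by
    rw [h.labelCell_letter] at hℓ hℓ'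
    exact (h.future hT hD hℓ hℓ' hag j).2
  past β ℓ hℓ ℓ' hℓ' hag j := by
    rw [h.labelCell_letter] at hℓ hℓ'
    exact (h.past hT hD hℓ hℓ' hag j).2

/-- The letter of a geodesic together with the element of `Γ` relating the normalisations of the
geodesic at the times `0` and `1`. -/
def refined (_ : IsNormaliser s N L) (ℓ : Geodesic T) : s.Letter × Γ :=
  (L ℓ, N (ℓ.shift 1) * (N ℓ)⁻¹)

theorem refined_smul (γ : Γ) (ℓ : Geodesic T) : h.refined (γ • ℓ) = h.refined ℓ := by
  refine Prod.ext (h.smul γ ℓ).2 ?_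
  change N (γ • ℓ.shift 1) * (N (γ • ℓ))⁻¹ = _
  rw [(h.smul γ _).1, (h.smul γ _).1, mul_inv_rev, inv_inv, mul_assoc, inv_mul_cancel_left]
  rfl

theorem mem_labelCell_refined {B : Type*} {f : Geodesic T → B}
    (hf : ∀ ℓ ℓ', f ℓ = f ℓ' ↔ h.refined ℓ = h.refined ℓ') {ℓ₀ ℓ : Geodesic T} :
    ℓ ∈ s.labelCell f (f ℓ₀) ↔ ℓ ∈ s.cellUp (L ℓ₀) ∧ N (ℓ.shift 1) = (h.refined ℓ₀).2 := by
  change ℓ ∈ s.fundDomain ∧ _ ↔ _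
  rw [hf, h.mem_fundDomain, h.mem_cellUp, and_assoc]
  refine and_congr_right fun h1 => ?_
  rw [Prod.ext_iff]
  refine and_congr_right fun _ => ?_
  change N (ℓ.shift 1) * (N ℓ)⁻¹ = _ ↔ _
  rw [h1, inv_one, mul_one]

/-- Allowing any `f` with the same fibres as `refined` lets the alphabet be relabelled later. A
refined label only involves letters and normalising elements at two successive times, all determined
one-sidedly. -/
theorem isMarkovLabel_refined (hT : T.IsTree) (hD : D.IsFree) (h : IsNormaliser s N L)
    {B : Type*} {f : Geodesic T → B} (hsurj : Function.Surjective f)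
    (hf : ∀ ℓ ℓ', f ℓ = f ℓ' ↔ h.refined ℓ = h.refined ℓ') : IsMarkovLabel s f where
  smul γ ℓ := (hf _ _).2 (h.refined_smul γ ℓ)
  surjective := hsurj
  isOpen b := by
    obtain ⟨ℓ₀, rfl⟩ := hsurj b
    have : s.labelCell f (f ℓ₀) = s.cellUp (L ℓ₀) ∩
        (fun ℓ : Geodesic T => (h.refined ℓ₀).2 • ℓ.shift 1) ⁻¹' s.fundDomain := by
      ext ℓ
      rw [h.mem_labelCell_refined hf, Set.mem_inter_iff, Set.mem_preimage, h.mem_fundDomain,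
        (h.smul _ _).1, mul_inv_eq_one]
    rw [this]
    exact (isOpen_cellUp _).inter (s.isOpen_fundDomain.preimage
      ((continuous_smul _).comp (continuous_shift 1)))
  rect b := by
    obtain ⟨ℓ₀, rfl⟩ := hsurj b
    have hr := isRect_cellUp (L ℓ₀)
    have hc := fun ℓ => h.mem_labelCell_refined hf (ℓ₀ := ℓ₀) (ℓ := ℓ)
    refine ⟨fun ℓ hℓ ℓ' hℓ' => hr.zero ℓ ((hc ℓ).1 hℓ).1 ℓ' ((hc ℓ').1 hℓ').1,
      fun ℓ hℓ ℓ' hℓ' => hr.one ℓ ((hc ℓ).1 hℓ).1 ℓ' ((hc ℓ').1 hℓ').1,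
      fun ℓ hℓ ℓ' hℓ' ℓ'' h1 h2 => (hc ℓ'').2 ?_⟩
    rw [hc] at hℓ hℓ'
    have hmem := hr.glue ℓ hℓ.1 ℓ' hℓ'.1 ℓ'' h1 h2
    exact ⟨hmem, ((h.future hT hD hℓ'.1 hmem h2 1).1).trans hℓ'.2⟩
  future b ℓ hℓ ℓ' hℓ' hag j := by
    obtain ⟨ℓ₀, rfl⟩ := hsurj b
    have h1 := ((h.mem_labelCell_refined hf).1 hℓ).1
    have h1' := ((h.mem_labelCell_refined hf).1 hℓ').1
    have e0 := h.future hT hD h1 h1' hag j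
    have e1 := h.future hT hD h1 h1' hag (j + 1)
    rw [hf]
    refine Prod.ext e0.2 ?_
    change N ((ℓ'.shift j).shift 1) * _ = N ((ℓ.shift j).shift 1) * _
    rw [shift_shift, shift_shift, e0.1]
    push_cast at e1
    rw [e1.1]
  past b ℓ hℓ ℓ' hℓ' hag j := by
    -- For `j = 0` the label looks at time `1`, which is not covered by `past`, but both geodesics
    -- lie in the same label cell. For `j ≥ 1` both times involved are `≤ 0`.
    rcases j with _ | j
    · rw [Nat.cast_zero, neg_zero, shift_zero, shift_zero]
      exact hℓ'.2.trans hℓ.2.symm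
    obtain ⟨ℓ₀, rfl⟩ := hsurj b
    have h1 := ((h.mem_labelCell_refined hf).1 hℓ).1
    have h1' := ((h.mem_labelCell_refined hf).1 hℓ').1
    have e0 := h.past hT hD h1 h1' hag (j + 1)
    have e1 := h.past hT hD h1 h1' hag j
    rw [hf]
    refine Prod.ext e0.2 ?_
    change N ((ℓ'.shift _).shift 1) * _ = N ((ℓ.shift _).shift 1) * _
    rw [shift_shift, shift_shift, e0.1, show -((j + 1 : ℕ) : ℤ) + 1 = -j by push_cast; ring, e1.1]

/-- Starting from `N = 1` at time `0`, the recorded increments give the normalising element at every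
time `i`. It carries `ℓ(i)` to the common origin of the edges at time `0` in the cell, so `ℓ(i)` is
known. -/
theorem eq_of_refined {ℓ ℓ' : Geodesic T} (hℓ : ℓ ∈ s.fundDomain) (hℓ' : ℓ' ∈ s.fundDomain)
    (he : ∀ i : ℤ, h.refined (ℓ.shift i) = h.refined (ℓ'.shift i)) : ℓ = ℓ' := by
  have hstep : ∀ i : ℤ, N (ℓ.shift (i + 1)) * (N (ℓ.shift i))⁻¹ =
      N (ℓ'.shift (i + 1)) * (N (ℓ'.shift i))⁻¹ := by
    intro i
    have := congrArg Prod.snd (he i)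
    change N ((ℓ.shift i).shift 1) * _ = N ((ℓ'.shift i).shift 1) * _ at this
    rwa [shift_shift, shift_shift] at this
  have hN : ∀ i : ℤ, N (ℓ.shift i) = N (ℓ'.shift i) := by
    intro i
    induction i using Int.induction_on with
    | zero => rw [shift_zero, shift_zero, h.mem_fundDomain.1 hℓ, h.mem_fundDomain.1 hℓ']
    | succ n ih =>
      have := hstep n
      rw [ih] at this
      exact mul_right_cancel this
    | pred n ih =>
      have := hstep (-n - 1)
      rw [sub_add_cancel, ih] at this
      exact inv_injective (mul_left_cancel this)
  refine Geodesic.ext' fun i => ?_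
  have h1 := h.mem (ℓ.shift i)
  have h2 := h.mem (ℓ'.shift i)
  rw [← hN i, ← show L (ℓ.shift i) = L (ℓ'.shift i) from congrArg Prod.fst (he i)] at h2
  have h3 := (isRect_cellUp _).zero _ h1 _ h2
  change N (ℓ.shift i) • ℓ.toFun (0 + i) = N (ℓ.shift i) • ℓ'.toFun (0 + i) at h3
  rw [zero_add] at h3
  exact smul_left_cancel _ h3

/-- The letters at times `0` and `1` give the images of `ℓ(1)` under the two normalisations. All
vertices being in the core, only one element of `Γ` sends one image to the other. -/
theorem refined_eq_of_letter (hD : D.IsFree) (hr : D.r = 0) {ℓ ℓ' : Geodesic T}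
    (h0 : L ℓ = L ℓ') (h1 : L (ℓ.shift 1) = L (ℓ'.shift 1)) : h.refined ℓ = h.refined ℓ' := by
  refine Prod.ext h0 ?_
  have hcore : ∀ v : V, qv Γ v ∈ D.coreVert := fun v i => (Fin.cast hr i).elim0
  have e1 := h.mem ℓ
  have e1' := h.mem ℓ'
  have e2 := h.mem (ℓ.shift 1)
  have e2' := h.mem (ℓ'.shift 1)
  rw [← h0] at e1'
  rw [← h1] at e2'
  have a1 : N ℓ • ℓ.toFun 1 = N ℓ' • ℓ'.toFun 1 := (isRect_cellUp _).one _ e1 _ e1'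
  have a2 := (isRect_cellUp _).zero _ e2 _ e2'
  change N (ℓ.shift 1) • ℓ.toFun (0 + 1) = N (ℓ'.shift 1) • ℓ'.toFun (0 + 1) at a2
  rw [zero_add] at a2
  change N (ℓ.shift 1) * (N ℓ)⁻¹ = N (ℓ'.shift 1) * (N ℓ')⁻¹
  refine inv_mul_eq_one.1 (hD (N ℓ' • ℓ'.toFun 1) (hcore _) _ ?_)
  rw [mul_smul, mul_smul, inv_smul_smul, ← a2, ← a1, mul_inv_rev, _root_.inv_inv, mul_smul,
    inv_smul_smul]

end IsNormaliser

/-- On the fundamental domain, a standard Borel space, the coding is measurable and injective, hence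
a measurable embedding by Lusin–Souslin; its inverse on the range extends to a measurable map. -/
theorem isMeasurableConjugacy_code [Countable V] [Countable Γ] (hT : T.IsTree) (hb : Branching T)
    (hD : D.IsFree) {A : Type*} [Countable A] [MeasurableSpace A] [DiscreteMeasurableSpace A]
    {f : Geodesic T → A} (hf : IsMarkovLabel s f)
    (hinj : ∀ ℓ ∈ s.fundDomain, ∀ ℓ' ∈ s.fundDomain,
      (∀ i : ℤ, f (ℓ.shift i) = f (ℓ'.shift i)) → ℓ = ℓ') (m : Measure (GeodQuot Γ)) :
    IsMeasurableConjugacy m (GeodQuot.flow Γ 1) (m.map hf.code) seqShift hf.code := by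
  have hmeas := IsMarkovLabel.measurable_code hT hD hf
  have := Geodesic.standardBorelSpace (T := T)
  have hstd : StandardBorelSpace s.fundDomain := s.isOpen_fundDomain.measurableSet.standardBorel
  let g : s.fundDomain → GeodQuot Γ := fun ℓ => GeodQuot.proj Γ ℓ.1
  have hg : Measurable g := GeodQuot.measurable_proj.comp measurable_subtype_coe
  have hsurj : Function.Surjective g := by
    intro x
    induction x using Quotient.inductionOn with
    | h ℓ =>
      obtain ⟨γ, hγ, -⟩ := s.existsUnique_smul_mem hT hD ℓ
      exact ⟨⟨γ • ℓ, hγ⟩, Quotient.sound ⟨γ, rfl⟩⟩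
  have hemb : MeasurableEmbedding (hf.code ∘ g) := by
    refine (hmeas.comp hg).measurableEmbedding fun a b hab => ?_
    exact Subtype.ext (hinj _ a.2 _ b.2 fun i => congrFun hab i)
  have hne : Nonempty (GeodQuot Γ) := by
    obtain ⟨v⟩ := hT.1.nonempty
    obtain ⟨w, -, hw⟩ := hb v v
    obtain ⟨ℓ, -⟩ := exists_geodesic_edge hT hb ⟨(v, w), hw⟩
    exact ⟨GeodQuot.proj Γ ℓ⟩
  obtain ⟨G, hG, hGg⟩ := hemb.exists_measurable_extend hg fun _ => hne
  have hleft : ∀ x, G (hf.code x) = x := by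
    intro x
    obtain ⟨ℓ, rfl⟩ := hsurj x
    exact congrFun hGg ℓ
  refine ⟨hmeas, rfl, Eventually.of_forall hf.code_flow, G, hG, Eventually.of_forall hleft, ?_⟩
  have hmem : ∀ᵐ y ∂m.map hf.code, y ∈ Set.range (hf.code ∘ g) := by
    refine (ae_map_iff (p := fun y => y ∈ Set.range (hf.code ∘ g)) hmeas.aemeasurable
      hemb.measurableSet_range).2 (Eventually.of_forall fun x => ?_)
    obtain ⟨ℓ, rfl⟩ := hsurj x
    exact ⟨ℓ, rfl⟩
  filter_upwards [hmem]
  rintro _ ⟨ℓ, rfl⟩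
  exact congrArg hf.code (hleft _)

end CuspDecomposition.Lifts

/-! ### The itinerary map, its Markov measure and the refined conjugacy. -/

namespace CuspDecomposition.Lifts

variable {V : Type*} {T : SimpleGraph V} {Γ : Subgroup (T ≃g T)} {D : CuspDecomposition Γ}
  {s : D.Lifts} {δ : ℝ} {μ : V → Measure (Ends T)}

open Geodesic

theorem isProbabilityMeasure_bowenMargulis [Countable V] [Countable Γ] (s : D.Lifts)
    (hT : T.IsTree) (hb : Branching T) (hD : D.IsFree) (hμ : IsPattersonSullivan Γ δ μ) (x : V)
    (htop : bowenMargulisUp δ μ x s.fundDomain ≠ ⊤) :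
    IsProbabilityMeasure (bowenMargulis Γ δ μ x) where
  measure_univ := by
    rw [s.bowenMargulis_apply hT hD hμ x MeasurableSet.univ, Set.preimage_univ, Set.univ_inter]
    exact ENNReal.inv_mul_cancel (s.bowenMargulisUp_fundDomain_pos hT hb hD hμ x) htop

theorem flow_zero (x : GeodQuot Γ) : GeodQuot.flow Γ 0 x = x := by
  induction x using Quotient.inductionOn with
  | h ℓ => exact congrArg (GeodQuot.proj Γ) ℓ.shift_zero

namespace IsNormaliser

variable {N : Geodesic T → Γ} {L : Geodesic T → s.Letter}

theorem code_eq_iff (h : IsNormaliser s N L) (hL : IsMarkovLabel s L) (x : GeodQuot Γ) (i : ℤ)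
    (β : s.Letter) : hL.code x i = β ↔ GeodQuot.flow Γ i x ∈ s.cell β := by
  induction x using Quotient.inductionOn with
  | h ℓ =>
    change L (ℓ.shift i) = β ↔ GeodQuot.proj Γ (ℓ.shift i) ∈ GeodQuot.proj Γ '' s.cellUp β
    constructor
    · rintro rfl
      exact ⟨N (ℓ.shift i) • ℓ.shift i, h.mem _, Quotient.sound ⟨_, rfl⟩⟩
    · rintro ⟨ℓ', hℓ', he⟩
      obtain ⟨γ, rfl⟩ := Quotient.exact he
      exact ((h _ γ β).1 hℓ').2.symm

theorem code_mem_subshift (hT : T.IsTree) (hD : D.IsFree) (h : IsNormaliser s N L)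
    (hL : IsMarkovLabel s L) (x : GeodQuot Γ) : hL.code x ∈ s.subshift := by
  induction x using Quotient.inductionOn with
  | h ℓ =>
    intro i
    refine trans_of_geodesic hT hD (γ := N (ℓ.shift (i + 1)) * (N (ℓ.shift i))⁻¹)
      (h.mem (ℓ.shift i)) ?_
    change _ • (N (ℓ.shift i) • (ℓ.shift i).shift 1) ∈ s.cellUp (L (ℓ.shift (i + 1)))
    rw [mul_smul, inv_smul_smul, shift_shift]
    exact h.mem _

theorem initialLaw_code_eq_nu (hT : T.IsTree) (hD : D.IsFree) (h : IsNormaliser s N L)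
    (hL : IsMarkovLabel s L) (m : Measure (GeodQuot Γ)) : initialLaw (m.map hL.code) = nu s m := by
  refine funext fun α => ?_
  rw [initialLaw, Measure.map_apply (IsMarkovLabel.measurable_code hT hD hL)
    (measurableSet_coord_eq 0 α), nu]
  congr 1
  ext x
  change hL.code x 0 = α ↔ _
  rw [h.code_eq_iff hL, flow_zero]

theorem transitionLaw_code_eq_transProb (hT : T.IsTree) (hD : D.IsFree) (h : IsNormaliser s N L)
    (hL : IsMarkovLabel s L) (m : Measure (GeodQuot Γ)) :
    transitionLaw (m.map hL.code) = transProb s m := by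
  refine funext fun α => funext fun β => ?_
  rw [transitionLaw, transProb, h.initialLaw_code_eq_nu hT hD hL,
    Measure.map_apply (s := {x | x 0 = α ∧ x 1 = β}) (IsMarkovLabel.measurable_code hT hD hL)
      ((measurableSet_coord_eq 0 α).inter (measurableSet_coord_eq 1 β))]
  congr 2
  ext x
  change hL.code x 0 = α ∧ hL.code x 1 = β ↔ _
  rw [h.code_eq_iff hL, h.code_eq_iff hL, flow_zero, and_comm]
  rfl

theorem transitionLaw_code_ne_zero [Countable V] [Countable Γ] (hT : T.IsTree) (hb : Branching T)
    (hD : D.IsFree) (hμ : IsPattersonSullivan Γ δ μ) (x : V)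
    (htop : bowenMargulisUp δ μ x s.fundDomain ≠ ⊤)
    [IsProbabilityMeasure (bowenMargulis Γ δ μ x)] (h : IsNormaliser s N L)
    (hL : IsMarkovLabel s L) {α β : s.Letter} (hαβ : s.Trans α β) :
    transitionLaw ((bowenMargulis Γ δ μ x).map hL.code) α β ≠ 0 := by
  have := Measure.isProbabilityMeasure_map (μ := bowenMargulis Γ δ μ x)
    (IsMarkovLabel.measurable_code hT hD hL).aemeasurable
  refine (ENNReal.div_pos ?_ (measure_ne_top _ _)).ne'
  rw [IsMarkovLabel.map_code_apply hT hD hμ x hL (E := {x | x 0 = α ∧ x 1 = β})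
    ((measurableSet_coord_eq 0 α).inter (measurableSet_coord_eq 1 β))]
  refine mul_ne_zero (ENNReal.inv_ne_zero.2 htop)
    (bowenMargulisUp_pos_of_isOpen hT hμ x (s.isOpen_fundDomain.inter
      (((IsMarkovLabel.isOpen_preimage hT hD hL {α}).preimage (continuous_shift 0)).inter
        ((IsMarkovLabel.isOpen_preimage hT hD hL {β}).preimage (continuous_shift 1)))) ?_).ne'
  obtain ⟨ℓ, γ, h1, h2⟩ := exists_geodesic_of_trans hT hb hαβ
  refine ⟨ℓ, Set.mem_iUnion.2 ⟨α, h1⟩, ?_, ((h _ _ _).1 h2).2.symm⟩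
  change L (ℓ.shift 0) = α
  rw [shift_zero]
  exact (h.mem_cellUp.1 h1).2

theorem support_map_code [Countable V] [Countable Γ] (hT : T.IsTree) (hb : Branching T)
    (hD : D.IsFree) (hμ : IsPattersonSullivan Γ δ μ) (x : V)
    (htop : bowenMargulisUp δ μ x s.fundDomain ≠ ⊤)
    [IsProbabilityMeasure (bowenMargulis Γ δ μ x)] (h : IsNormaliser s N L)
    (hL : IsMarkovLabel s L) :
    ((bowenMargulis Γ δ μ x).map hL.code).support = s.subshift := by
  have := countable_letter s
  have hmeas := IsMarkovLabel.measurable_code hT hD hL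
  refine (IsMarkovLabel.isMarkovMeasure_map_code hT hD hμ x htop hL).support_eq
    (IsMarkovLabel.initialLaw_map_code_ne_zero hT hD hμ x htop hL) (R := s.Trans)
    (fun α β => h.transitionLaw_code_ne_zero hT hb hD hμ x htop hL) ?_
  have hsub : ∀ᵐ y ∂(bowenMargulis Γ δ μ x).map hL.code, ∀ i, s.Trans (y i) (y (i + 1)) := by
    refine ae_all_iff.2 fun i => ?_
    have hm : MeasurableSet {y : ℤ → s.Letter | s.Trans (y i) (y (i + 1))} :=
      ((measurable_pi_apply (X := fun _ : ℤ => s.Letter) i).prodMk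
        (measurable_pi_apply (i + 1)))
        (Set.to_countable {p : s.Letter × s.Letter | s.Trans p.1 p.2}).measurableSet
    exact (ae_map_iff hmeas.aemeasurable hm).2
      (Eventually.of_forall fun y => h.code_mem_subshift hT hD hL y i)
  exact hsub

end IsNormaliser

/-- A countable-state Markov coding conjugate to the geodesic transformation, and refining the
coding by letters. -/
theorem exists_markov_conjugacy [Countable V] [Countable Γ] (hT : T.IsTree) (hb : Branching T)
    (hD : D.IsFree) (hμ : IsPattersonSullivan Γ δ μ) (x : V)
    (htop : bowenMargulisUp δ μ x s.fundDomain ≠ ⊤)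
    [IsProbabilityMeasure (bowenMargulis Γ δ μ x)] {N : Geodesic T → Γ}
    {L : Geodesic T → s.Letter} (h : IsNormaliser s N L) (hL : IsMarkovLabel s L) :
    ∃ (B : Type) (_ : Countable B) (_ : MeasurableSpace B) (_ : DiscreteMeasurableSpace B)
      (p : B → ENNReal) (P : B → B → ENNReal) (μB : Measure (ℤ → B))
      (F : GeodQuot Γ → ℤ → B) (q : B → s.Letter),
      IsStationaryChain p P ∧ IsMarkovMeasure p P μB ∧
      IsMeasurableConjugacy (bowenMargulis Γ δ μ x) (GeodQuot.flow Γ 1) μB seqShift F ∧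
      ∀ y i, q (F y i) = hL.code y i := by
  have := countable_letter s
  -- The refined alphabet is countable, hence has a copy in `Type`. Restricting to the range makes
  -- every label occur, so that all initial probabilities are nonzero.
  have hsmall : Small.{0} (Set.range h.refined) := Countable.toSmall _
  let e := equivShrink.{0} (Set.range h.refined)
  let f : Geodesic T → Shrink.{0} (Set.range h.refined) := fun ℓ => e ⟨h.refined ℓ, ℓ, rfl⟩
  have hcB : Countable (Shrink.{0} (Set.range h.refined)) := e.symm.injective.countable
  have hsurj : Function.Surjective f := fun b => by
    obtain ⟨⟨-, ℓ, rfl⟩, rfl⟩ := e.surjective b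
    exact ⟨ℓ, rfl⟩
  have hff : ∀ ℓ ℓ', f ℓ = f ℓ' ↔ h.refined ℓ = h.refined ℓ' := fun ℓ ℓ' =>
    e.injective.eq_iff.trans Subtype.mk_eq_mk
  have hf := h.isMarkovLabel_refined hT hD hsurj hff
  let mB : MeasurableSpace (Shrink.{0} (Set.range h.refined)) := ⊤
  have hdB : DiscreteMeasurableSpace (Shrink.{0} (Set.range h.refined)) := ⟨fun _ => trivial⟩
  have := Measure.isProbabilityMeasure_map (μ := bowenMargulis Γ δ μ x)
    (IsMarkovLabel.measurable_code hT hD hf).aemeasurable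
  refine ⟨_, hcB, mB, hdB, _, _, _, hf.code, fun b => (e.symm b).1.1,
    isStationaryChain_of_invariant (IsMarkovLabel.map_code_invariant hT hD hμ x hf)
      (IsMarkovLabel.initialLaw_map_code_ne_zero hT hD hμ x htop hf),
    IsMarkovLabel.isMarkovMeasure_map_code hT hD hμ x htop hf,
    isMeasurableConjugacy_code hT hb hD hf (fun ℓ hℓ ℓ' hℓ' he =>
      h.eq_of_refined hℓ hℓ' fun i => (hff _ _).1 (he i)) _, fun y i => ?_⟩
  induction y using Quotient.inductionOn with
  | h ℓ =>
    change (e.symm (e ⟨h.refined (ℓ.shift i), ℓ.shift i, rfl⟩)).1.1 = L (ℓ.shift i)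
    rw [e.symm_apply_apply]
    rfl

end CuspDecomposition.Lifts

end TreeCoding

theorem mainTheorem9 {V : Type*} (T : SimpleGraph V) (hT : T.IsTree)
    (hlf : ∀ v, (T.neighborSet v).Finite)
    (hval : ∀ v, (T.neighborSet v).ncard ≠ 2)
    (hunif : IsUniform T)
    (Γ : Subgroup (T ≃g T)) (hinv : NoInversion Γ) (hdisc : IsDiscreteGroup Γ)
    (hne : IsNonElementary Γ) (hmin : IsMinimal Γ)
    (D : CuspDecomposition Γ)
    (hfree : ∀ v : V, (Quotient.mk _ v : QVert Γ) ∈ D.coreVert → ∀ γ : Γ, γ • v = v → γ = 1)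
    (s : D.Lifts) (x₀ : V)
    (μ : V → Measure (Ends T)) (δ : ℝ) (hδ : δ = (criticalExponent Γ x₀).toReal)
    (hμ : IsPattersonSullivan Γ δ μ)
    (m : Measure (GeodQuot Γ)) (hm : m = bowenMargulis Γ δ μ x₀) :
    IsProbabilityMeasure m ∧
    Countable s.Letter ∧
    IsStationaryChain (nu s m) (transProb s m) ∧
    ∃ (Θ : GeodQuot Γ → ℤ → s.Letter) (μM : Measure (ℤ → s.Letter)),
      -- `Θ` is the itinerary map of the partition `(E_β)`, with values in `X_A`
      (∀ x i β, Θ x i = β ↔ GeodQuot.flow Γ i x ∈ s.cell β) ∧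
      Measurable Θ ∧ (∀ x, Θ x ∈ s.subshift) ∧
      -- `μM` is the Markov measure associated with `(π, ν)`
      IsMarkovMeasure (nu s m) (transProb s m) μM ∧
      (∀ μ', IsMarkovMeasure (nu s m) (transProb s m) μ' → μ' = μM) ∧
      μM.support = s.subshift ∧
      m.map Θ = μM ∧
      -- without cusps, `Θ` itself is a conjugacy
      (D.r = 0 → IsMeasurableConjugacy m (GeodQuot.flow Γ 1) μM seqShift Θ) ∧
      -- in general, a countable-state Markov coding refining `Θ` is a conjugacy
      ∃ (B : Type) (_ : Countable B) (_ : MeasurableSpace B) (_ : DiscreteMeasurableSpace B)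
        (p : B → ENNReal) (P : B → B → ENNReal) (μB : Measure (ℤ → B))
        (F : GeodQuot Γ → ℤ → B) (q : B → s.Letter),
        IsStationaryChain p P ∧ IsMarkovMeasure p P μB ∧
        IsMeasurableConjugacy m (GeodQuot.flow Γ 1) μB seqShift F ∧
        ∀ x i, q (F x i) = Θ x i := by
  subst hm
  have hb := branching_of_isMinimal hT hne hmin
  have hD : D.IsFree := hfree
  have := countable_of_locallyFinite hT hlf
  have := countable_of_isDiscreteGroup hT hdisc
  have hcount := countable_letter s
  have htop := s.bowenMargulisUp_fundDomain_ne_top hT hlf hval hunif hb hD hdisc hδ hμ x₀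
  have hprob := s.isProbabilityMeasure_bowenMargulis hT hb hD hμ x₀ htop
  obtain ⟨N, L, h⟩ := CuspDecomposition.Lifts.exists_isNormaliser hT hD s
  have hL := h.isMarkovLabel_letter hT hb hD
  have hmeas := hL.measurable_code hT hD
  have := Measure.isProbabilityMeasure_map (μ := bowenMargulis Γ δ μ x₀) hmeas.aemeasurable
  have hmark := hL.isMarkovMeasure_map_code hT hD hμ x₀ htop
  have hchain := isStationaryChain_of_invariant (hL.map_code_invariant hT hD hμ x₀)
    (hL.initialLaw_map_code_ne_zero hT hD hμ x₀ htop)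
  rw [h.initialLaw_code_eq_nu hT hD, h.transitionLaw_code_eq_transProb hT hD] at hmark hchain
  -- The Markov measure is taken to be the push-forward itself: the image formula is then `rfl`, and
  -- the content lies in the cylinder formula and in uniqueness.
  refine ⟨hprob, hcount, hchain, hL.code, _, h.code_eq_iff hL, hmeas,
    h.code_mem_subshift hT hD hL, hmark, fun μ' hμ' => hμ'.unique hmark,
    h.support_map_code hT hb hD hμ x₀ htop hL, rfl, fun hr => ?_,
    CuspDecomposition.Lifts.exists_markov_conjugacy hT hb hD hμ x₀ htop h hL⟩
  refine CuspDecomposition.Lifts.isMeasurableConjugacy_code hT hb hD hL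
    (fun ℓ hℓ ℓ' hℓ' he => h.eq_of_refined hℓ hℓ' fun i =>
      h.refined_eq_of_letter hD hr (he i) ?_) _
  rw [Geodesic.shift_shift, Geodesic.shift_shift]
  exact he _
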